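/- **Setting.** Let $Z$ be a complex manifold of dimension $k+1$ with a holomorphic map $\pi:Z\to\mathbb P^1$, and let $M$ be a complex manifold. Let $F\subset Z\times M$ be a complex submanifold whose projection $\nu:F\to M$ is proper and regular (its differential is surjective everywhere), and let $\mu:F\to Z$ be the other projection. Suppose that $\pi\circ\mu$ maps each fibre $\nu^{-1}(x)$ biholomorphically onto $\mathbb P^1$, so that the curves $X_x=\mu(\nu^{-1}(x))\cong\mathbb P^1$ are holomorphic sections of $\pi$. Let $N_x=TZ|_{X_x}/TX_x$ be the normal bundle. Suppose that the family is complete: for every $x\in M$ the Kodaira map $\kappa_x:T_xM\to H^0(X_x,N_x)$, $\kappa_x(u)=[d\mu(\tilde u)]$ with $d\nu(\tilde u)=u$, is an isomorphism. Cover $\mathbb P^1$ by $U=\mathbb P^1\setminus\{\infty\}$, with coordinate $\lambda$, and $\hat U=\mathbb P^1\setminus\{0\}$, with coordinate $\hat\lambda=\lambda^{-1}$. Given holomorphic trivialisations of $N_x$ over $U$ and $\hat U$ (for example by $\partial/\partial w^\mu$ and $\partial/\partial\hat w^\mu$ for fibre coordinates $w$, $\hat w$ of $Z\to\mathbb P^1$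 near $X_x$), let $\mathcal F$ be the patching matrix on $U\cap\hat U$, which maps components over $U$ to components over $\hat U$, and let $dw|$ and $d\hat w|$ denote the components of $\kappa_x$ over $U$ and over $\hat U$. A *splitting of type* $n=(n_1,\dots,n_k)\in\mathbb Z^k$ is a pair of holomorphic maps $H:U\to GL(k,\mathbb C)$ and $\hat H:\hat U\to GL(k,\mathbb C)$ with $$\mathcal F=\hat H\,\mathrm{diag}(\lambda^{-n_1},\dots,\lambda^{-n_k})\,H^{-1}\quad\text{on } U\cap\hat U .$$ **Theorem.** For every $x\in M$, trivialisations of $N_x$ over $U$ and $\hat U$ exist, and there are integers $n_1\ge\dots\ge n_k$ such that, for every choice of them: 1. A splitting of type $n$ exists, and the type of any splitting is a permutation of $n$. 2. For every splitting $(H,\hat H)$ of type $n$, the frame section $v=H^{-1}dw|$ over $U$, $\hat v=\hat H^{-1}d\hat w|$ over $\hat U$, satisfies $\hat v^i=\lambda^{-n_i}v^i$ on $U\cap\hat U$, so that it is a global section of $N_x\otimes\Lambda^1_x(M)$, with $N_x\cong\bigoplus_i\mathcal O(n_i)$. There are unique covectors $e^{i,j}\in T_x^*M$ ($1\le i\le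 k$, $0\le j\le n_i$) with $$v^i=\sum_{j=0}^{n_i}e^{i,j}\lambda^j$$ (so $v^i=0$ if $n_i<0$), and they form a basis of $T_x^*M$: the frame. 3. The splitting, and with it the frame, is unique up to $H^0(X_x,N_x\otimes N_x^*)$: for any two splittings $(H,\hat H)$, $(H',\hat H')$ of type $n$ there is a unique invertible $g\in H^0(X_x,N_x\otimes N_x^*)$ with $H'=GH$ and $\hat H'=\hat G\hat H$, where $G$, $\hat G$ are the matrices of $g$ in the trivialisations; conversely, $(GH,\hat G\hat H)$ is a splitting of type $n$ for every splitting $(H,\hat H)$ of type $n$ and every such $g$. 4. The set of all the frames $(e^{i,j})$ so obtained at $x$ does not depend on the choice of the trivialisations. Moreover, if on an open set $W\subset M$ splittings of a fixed type are chosen for all $x\in W$, and if the trivialisation over $U$ and the matrix $H$ depend holomorphically on $(x,\lambda)\in W\times U$, then the $e^{i,j}$ are holomorphic one-forms on $W$. -/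

import Mathlib

open scoped Manifold ContDiff Topology
open Set Function

noncomputable section

/-! ### The projective line as a complex manifold

The projective line is `OnePoint ℂ = ℂ ∪ {∞}`, covered by `U = {∞}ᶜ` with coordinate `l` and by
`Û = {0}ᶜ` with coordinate `1 / l`. -/

namespace ProjLine

/-- The involution `l ↦ 1 / l`, as a map of sets. -/
def invFun (z : OnePoint ℂ) : OnePoint ℂ :=
  z.elim ((0 : ℂ) : OnePoint ℂ) (fun l => if l = 0 then OnePoint.infty else ((l⁻¹ : ℂ) : OnePoint ℂ))

theorem invFun_infty : invFun OnePoint.infty = ((0 : ℂ) : OnePoint ℂ) := rfl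

theorem invFun_zero : invFun ((0 : ℂ) : OnePoint ℂ) = OnePoint.infty := by
  simp [invFun]

theorem invFun_coe {l : ℂ} (hl : l ≠ 0) : invFun (l : OnePoint ℂ) = ((l⁻¹ : ℂ) : OnePoint ℂ) := by
  simp [invFun, hl]

theorem invFun_invFun (z : OnePoint ℂ) : invFun (invFun z) = z := by
  induction z using OnePoint.rec with
  | infty => rw [invFun_infty, invFun_zero]
  | coe l =>
    by_cases hl : l = 0
    · subst hl; rw [invFun_zero, invFun_infty]
    · rw [invFun_coe hl, invFun_coe (inv_ne_zero hl), inv_inv]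

theorem continuous_invFun : Continuous invFun := by
  rw [continuous_iff_continuousAt]
  intro z
  induction z using OnePoint.rec with
  | infty =>
    rw [OnePoint.continuousAt_infty', invFun_infty]
    have h1 : Filter.Tendsto (fun l : ℂ => l⁻¹) (Filter.coclosedCompact ℂ) (𝓝 0) := by
      rw [Filter.coclosedCompact_eq_cocompact, ← Metric.cobounded_eq_cocompact]
      exact Filter.tendsto_inv₀_cobounded
    have h2 : Filter.Tendsto (fun l : ℂ => ((l⁻¹ : ℂ) : OnePoint ℂ)) (Filter.coclosedCompact ℂ)
        (𝓝 ((0 : ℂ) : OnePoint ℂ)) := (OnePoint.continuous_coe.tendsto 0).comp h1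
    refine h2.congr' ?_
    have h3 : ∀ᶠ l : ℂ in Filter.coclosedCompact ℂ, l ≠ 0 := by
      rw [Filter.coclosedCompact_eq_cocompact]
      exact (isCompact_singleton (x := (0 : ℂ))).compl_mem_cocompact
    filter_upwards [h3] with l hl
    simp [invFun_coe hl]
  | coe l =>
    rw [OnePoint.continuousAt_coe]
    by_cases hl : l = 0
    · subst hl
      have h1 : Filter.Tendsto (fun l : ℂ => ((l⁻¹ : ℂ) : OnePoint ℂ)) (𝓝[≠] 0)
          (𝓝 OnePoint.infty) := by
        refine OnePoint.tendsto_coe_infty.comp ?_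
        rw [Filter.coclosedCompact_eq_cocompact, ← Metric.cobounded_eq_cocompact]
        exact Filter.tendsto_inv₀_nhdsNE_zero
      have h2 : Filter.Tendsto (invFun ∘ ((↑) : ℂ → OnePoint ℂ)) (𝓝[≠] 0)
          (𝓝 OnePoint.infty) := by
        refine h1.congr' ?_
        filter_upwards [self_mem_nhdsWithin] with l hl
        simp [invFun_coe (show l ≠ 0 from hl)]
      have h3 : ContinuousWithinAt (invFun ∘ ((↑) : ℂ → OnePoint ℂ)) {0}ᶜ 0 := by
        simpa [ContinuousWithinAt, invFun_zero] using h2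
      exact continuousWithinAt_compl_self.mp h3
    · have h1 : ContinuousAt (fun l : ℂ => ((l⁻¹ : ℂ) : OnePoint ℂ)) l :=
        OnePoint.continuous_coe.continuousAt.comp (continuousAt_inv₀ hl)
      refine h1.congr ?_
      filter_upwards [isOpen_ne.mem_nhds hl] with m hm
      simp [invFun_coe (show m ≠ 0 from hm)]

/-- The involution `l ↦ 1 / l` of the projective line, exchanging `0` and `∞`. -/
def inv : OnePoint ℂ ≃ₜ OnePoint ℂ where
  toFun := invFun
  invFun := invFun
  left_inv := invFun_invFun
  right_inv := invFun_invFun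
  continuous_toFun := continuous_invFun
  continuous_invFun := continuous_invFun

theorem inv_coe {l : ℂ} (hl : l ≠ 0) : inv (l : OnePoint ℂ) = ((l⁻¹ : ℂ) : OnePoint ℂ) :=
  invFun_coe hl

theorem inv_zero : inv ((0 : ℂ) : OnePoint ℂ) = OnePoint.infty := invFun_zero

theorem inv_infty : inv OnePoint.infty = ((0 : ℂ) : OnePoint ℂ) := invFun_infty

theorem inv_inv (z : OnePoint ℂ) : inv (inv z) = z := invFun_invFun z

/-- The affine coordinate `l` on `U`. -/
def chartZero : OpenPartialHomeomorph (OnePoint ℂ) ℂ :=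
  (OnePoint.isOpenEmbedding_coe.toOpenPartialHomeomorph ((↑) : ℂ → OnePoint ℂ)).symm

/-- The affine coordinate `1 / l` on `Û`. -/
def chartInfty : OpenPartialHomeomorph (OnePoint ℂ) ℂ :=
  inv.toOpenPartialHomeomorph.trans chartZero

theorem chartZero_source : chartZero.source = {OnePoint.infty}ᶜ := by
  simp [chartZero, OnePoint.compl_infty]

theorem chartInfty_source : chartInfty.source = {((0 : ℂ) : OnePoint ℂ)}ᶜ := by
  ext z
  have h : inv z = OnePoint.infty ↔ z = ((0 : ℂ) : OnePoint ℂ) := by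
    rw [← inv_zero]; exact inv.injective.eq_iff
  simp [chartInfty, chartZero_source, h]

instance instChartedSpace : ChartedSpace ℂ (OnePoint ℂ) where
  atlas := {chartZero, chartInfty}
  chartAt z := open Classical in if z = OnePoint.infty then chartInfty else chartZero
  mem_chart_source z := by
    by_cases hz : z = OnePoint.infty
    · simp [hz, chartInfty_source]
    · simp [hz, chartZero_source]
  chart_mem_atlas z := by
    by_cases hz : z = OnePoint.infty <;> simp [hz]

theorem chartZero_coe (l : ℂ) : chartZero (l : OnePoint ℂ) = l := by
  have := (OnePoint.isOpenEmbedding_coe.toOpenPartialHomeomorph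
    ((↑) : ℂ → OnePoint ℂ)).left_inv (x := l) (by simp)
  simpa [chartZero] using this

theorem chartZero_symm (l : ℂ) : chartZero.symm l = (l : OnePoint ℂ) := by
  simp [chartZero]

theorem chartInfty_apply (z : OnePoint ℂ) : chartInfty z = chartZero (inv z) := by
  simp [chartInfty]

theorem chartInfty_symm (l : ℂ) : chartInfty.symm l = inv (l : OnePoint ℂ) := by
  simp [chartInfty, chartZero_symm, inv, Homeomorph.symm]

instance instIsManifold : IsManifold 𝓘(ℂ) ω (OnePoint ℂ) := by
  have key : ∀ s : Set ℂ, (∀ l ∈ s, l ≠ 0) → ∀ f : ℂ → ℂ, (∀ l, l ≠ 0 → f l = l⁻¹) →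
      ContDiffOn ℂ ω f s := by
    intro s hs f hf
    have h : ContDiffOn ℂ ω (fun l : ℂ => l⁻¹) s := fun l hl =>
      (contDiffAt_inv ℂ (hs l hl)).contDiffWithinAt
    exact h.congr fun l hl => hf l (hs l hl)
  have kid : ∀ s : Set ℂ, ∀ f : ℂ → ℂ, (∀ l, f l = l) → ContDiffOn ℂ ω f s := by
    intro s f hf
    exact contDiffOn_id.congr fun l _ => hf l
  refine isManifold_of_contDiffOn 𝓘(ℂ) ω (OnePoint ℂ) ?_
  intro e e' he he'
  have he1 : e = chartZero ∨ e = chartInfty := he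
  have he2 : e' = chartZero ∨ e' = chartInfty := he'
  rcases he1 with rfl | rfl <;> rcases he2 with rfl | rfl
  · refine kid _ _ fun l => ?_
    simp [chartZero_symm, chartZero_coe]
  · refine key _ ?_ _ ?_
    · intro l hl h0
      subst h0
      simp [chartZero_symm, chartInfty_source] at hl
    · intro l hl
      simp [chartZero_symm, chartInfty_apply, inv_coe hl, chartZero_coe]
  · refine key _ ?_ _ ?_
    · intro l hl h0
      subst h0
      simp [chartInfty_symm, chartZero_source, inv_zero] at hl
    · intro l hl
      simp [chartInfty_symm, inv_coe hl, chartZero_coe]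
  · refine kid _ _ fun l => ?_
    simp [chartInfty_symm, chartInfty_apply, inv_inv, chartZero_coe]

/-- The affine patch `U`. -/
def U : Set (OnePoint ℂ) := {OnePoint.infty}ᶜ

/-- The affine patch `Û`. -/
def Uhat : Set (OnePoint ℂ) := {((0 : ℂ) : OnePoint ℂ)}ᶜ

theorem coe_mem_U (l : ℂ) : (l : OnePoint ℂ) ∈ U := by simp [U]

theorem coe_mem_Uhat (l : ℂˣ) : ((l : ℂ) : OnePoint ℂ) ∈ Uhat := by simp [Uhat]

theorem inv_mem_Uhat (m : ℂ) : inv (m : OnePoint ℂ) ∈ Uhat := by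
  intro h
  have h' : inv (inv (m : OnePoint ℂ)) = inv ((0 : ℂ) : OnePoint ℂ) := congrArg inv h
  rw [inv_inv, inv_zero] at h'
  exact OnePoint.coe_ne_infty m h'

end ProjLine

/-! ### Holomorphic families of rational curves -/

/-- A collection of covectors at a point `x` of the complex manifold `M`, modelled on `EM`: for each
`i`, one for each of the `n i + 1` monomials `1, l, …, l ^ n i` (none if `n i < 0`). -/
abbrev Coframe (EM : Type*) {M : Type*} [NormedAddCommGroup EM] [NormedSpace ℂ EM]
    [TopologicalSpace M] [ChartedSpace EM M] {k : ℕ} (n : Fin k → ℤ) (x : M) : Type _ :=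
  ∀ i, Fin (n i + 1).toNat → Module.Dual ℂ (TangentSpace 𝓘(ℂ, EM) x)

section Family

variable {EZ EM EF Z M F : Type*}
  [NormedAddCommGroup EZ] [NormedSpace ℂ EZ] [TopologicalSpace Z] [ChartedSpace EZ Z]
  [IsManifold 𝓘(ℂ, EZ) ω Z]
  [NormedAddCommGroup EM] [NormedSpace ℂ EM] [TopologicalSpace M] [ChartedSpace EM M]
  [IsManifold 𝓘(ℂ, EM) ω M]
  [NormedAddCommGroup EF] [NormedSpace ℂ EF] [TopologicalSpace F] [ChartedSpace EF F]

variable (EZ EM EF M F) in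
/-- A holomorphic family, with moduli space `M`, of rational curves in `Z → ℙ¹`: a submanifold `F`
of `Z × M` whose projection `F → M` is a proper regular map and whose fibres, seen as curves in `Z`,
are holomorphic sections of `Z → ℙ¹` (that is, the restriction of `F → Z → ℙ¹` to the fibre over
`x` is biholomorphic, with inverse `sec x`). -/
structure RationalCurveFamily (proj : Z → OnePoint ℂ) where
  /-- The inclusion of `F` in `Z × M`. -/
  incl : F → Z × M
  isEmbedding : Manifold.IsSmoothEmbedding 𝓘(ℂ, EF) (𝓘(ℂ, EZ).prod 𝓘(ℂ, EM)) ω incl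
  isProper : IsProperMap (fun p => (incl p).2)
  regular : ∀ p, Surjective (mfderiv 𝓘(ℂ, EF) 𝓘(ℂ, EM) (fun p => (incl p).2) p)
  /-- The inverse of `F → ℙ¹` on the fibre over a point of `M`. -/
  sec : M → OnePoint ℂ → F
  sec_holomorphic : ∀ x, ContMDiff 𝓘(ℂ) 𝓘(ℂ, EF) ω (sec x)
  snd_sec : ∀ x ζ, (incl (sec x ζ)).2 = x
  proj_sec : ∀ x ζ, proj (incl (sec x ζ)).1 = ζ
  sec_proj : ∀ p, sec (incl p).2 (proj (incl p).1) = p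

namespace RationalCurveFamily

variable {proj : Z → OnePoint ℂ} (C : RationalCurveFamily EZ EM EF M F proj)

/-- The projection `μ : F → Z`. -/
def mu (p : F) : Z := (C.incl p).1

/-- The projection `ν : F → M`. -/
def nu (p : F) : M := (C.incl p).2

/-- The tangent space at `p` of the fibre of `ν : F → M` through `p`. -/
abbrev vertical (p : F) : Submodule ℂ (TangentSpace 𝓘(ℂ, EF) p) :=
  LinearMap.ker (mfderiv 𝓘(ℂ, EF) 𝓘(ℂ, EM) C.nu p).toLinearMap

/-- The tangent space at `μ p` of the curve `X_x = μ (ν⁻¹ x)`, where `x = ν p`. -/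
abbrev curveTangent (p : F) : Submodule ℂ (TangentSpace 𝓘(ℂ, EZ) (C.mu p)) :=
  (C.vertical p).map (mfderiv 𝓘(ℂ, EF) 𝓘(ℂ, EZ) C.mu p).toLinearMap

/-- The fibre over `ζ` of the normal bundle `N_x = TZ|_{X_x} / TX_x`. -/
abbrev Normal (x : M) (ζ : OnePoint ℂ) : Type _ :=
  TangentSpace 𝓘(ℂ, EZ) (C.mu (C.sec x ζ)) ⧸ C.curveTangent (C.sec x ζ)

/-- A section of `N_x` is holomorphic on the open set `V` of `X_x = ℙ¹` if it lifts locally to a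
holomorphic section of `TZ|_{X_x}`. -/
def IsHolomorphicSection (x : M) (V : Set (OnePoint ℂ)) (s : ∀ ζ, C.Normal x ζ) : Prop :=
  ∀ ζ₀ ∈ V, ∃ W ∈ 𝓝 ζ₀, ∃ τ : ∀ ζ, TangentSpace 𝓘(ℂ, EZ) (C.mu (C.sec x ζ)),
    ContMDiffOn 𝓘(ℂ) 𝓘(ℂ, EZ).tangent ω
      (fun ζ => (⟨C.mu (C.sec x ζ), τ ζ⟩ : TangentBundle 𝓘(ℂ, EZ) Z)) W ∧
    ∀ ζ ∈ W, Submodule.Quotient.mk (τ ζ) = s ζ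

/-- The same for a family of sections of the `N_x`, on the open set `S` of `M × ℙ¹`. -/
def IsHolomorphicSectionFamily (S : Set (M × OnePoint ℂ)) (s : ∀ x ζ, C.Normal x ζ) : Prop :=
  ∀ q₀ ∈ S, ∃ W ∈ 𝓝 q₀,
    ∃ τ : ∀ q : M × OnePoint ℂ, TangentSpace 𝓘(ℂ, EZ) (C.mu (C.sec q.1 q.2)),
    ContMDiffOn (𝓘(ℂ, EM).prod 𝓘(ℂ)) 𝓘(ℂ, EZ).tangent ω
      (fun q => (⟨C.mu (C.sec q.1 q.2), τ q⟩ : TangentBundle 𝓘(ℂ, EZ) Z)) W ∧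
    ∀ q ∈ W, Submodule.Quotient.mk (τ q) = s q.1 q.2

/-- The group `H⁰(X_x, N_x)`. -/
def globalSections (x : M) : Set (∀ ζ, C.Normal x ζ) :=
  {s | C.IsHolomorphicSection x univ s}

/-- The group `H⁰(X_x, N_x ⊗ N_x*)`: families of endomorphisms of the fibres of `N_x` that map
holomorphic local sections to holomorphic local sections. -/
def endSections (x : M) : Set (∀ ζ, Module.End ℂ (C.Normal x ζ)) :=
  {g | ∀ V : Set (OnePoint ℂ), IsOpen V → ∀ s, C.IsHolomorphicSection x V s →
    C.IsHolomorphicSection x V (fun ζ => g ζ (s ζ))}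

/-- The map `T_{ν p} M = T_p F / ker dν → T_{μ p} Z / dμ (ker dν)` induced by `dμ`. -/
def kodairaAt (p : F) : TangentSpace 𝓘(ℂ, EM) (C.nu p) →ₗ[ℂ]
    TangentSpace 𝓘(ℂ, EZ) (C.mu p) ⧸ C.curveTangent p :=
  ((C.vertical p).mapQ (C.curveTangent p) (mfderiv 𝓘(ℂ, EF) 𝓘(ℂ, EZ) C.mu p).toLinearMap
      (Submodule.le_comap_map _ _)) ∘ₗ
    ((mfderiv 𝓘(ℂ, EF) 𝓘(ℂ, EM) C.nu p).toLinearMap.quotKerEquivOfSurjective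
      (C.regular p)).symm.toLinearMap

/-- The Kodaira map from `T_x M` to sections of `N_x`. Here `T_x M` and `T_y M` with
`y = ν (sec x ζ)` are the same space, since `y = x`. -/
def kodaira (x : M) (u : TangentSpace 𝓘(ℂ, EM) x) (ζ : OnePoint ℂ) : C.Normal x ζ :=
  C.kodairaAt (C.sec x ζ) u

/-- The family is complete: the Kodaira map is an isomorphism `T_x M = H⁰(X_x, N_x)`. -/
def IsComplete : Prop :=
  ∀ x, Injective (C.kodaira x) ∧ range (C.kodaira x) = C.globalSections x

/-- `b` is a holomorphic frame of `N_x` over the open set `V` of `X_x = ℙ¹`. -/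
structure IsHolomorphicFrame {k : ℕ} (x : M) (V : Set (OnePoint ℂ))
    (b : Fin k → ∀ ζ, C.Normal x ζ) : Prop where
  holomorphic : ∀ i, C.IsHolomorphicSection x V (b i)
  linearIndependent : ∀ ζ ∈ V, LinearIndependent ℂ (fun i => b i ζ)
  span_eq_top : ∀ ζ ∈ V, ⊤ ≤ Submodule.span ℂ (range fun i => b i ζ)

/-- Holomorphic trivialisations of `N_x` over `U` and over `Û`. In terms of fibre coordinates `w^i`
of `Z → ℙ¹` near `X_x` over `U`, and `ŵ^i` over `Û`, these are given by the classes of `∂/∂w^i` and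
`∂/∂ŵ^i`; the component of `kodaira x u` along `∂/∂w^i` is then `d w^i| (u)`. -/
structure Trivialisation (k : ℕ) (x : M) where
  frame : Fin k → ∀ ζ, C.Normal x ζ
  frameHat : Fin k → ∀ ζ, C.Normal x ζ
  isFrame : C.IsHolomorphicFrame x ProjLine.U frame
  isFrameHat : C.IsHolomorphicFrame x ProjLine.Uhat frameHat

namespace Trivialisation

variable {C} {k : ℕ} {x : M} (T : C.Trivialisation k x)

/-- The basis of `N_x` over the point with coordinate `l` given by the trivialisation over `U`. -/
def basis (l : ℂ) : Module.Basis (Fin k) ℂ (C.Normal x (l : OnePoint ℂ)) :=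
  Module.Basis.mk (T.isFrame.linearIndependent _ (ProjLine.coe_mem_U l))
    (T.isFrame.span_eq_top _ (ProjLine.coe_mem_U l))

/-- The basis of `N_x` over the point `ζ` given by the trivialisation over `Û`. -/
def basisHat (ζ : OnePoint ℂ) (hζ : ζ ∈ ProjLine.Uhat) : Module.Basis (Fin k) ℂ (C.Normal x ζ) :=
  Module.Basis.mk (T.isFrameHat.linearIndependent _ hζ) (T.isFrameHat.span_eq_top _ hζ)

/-- The patching matrix of `N_x` on `U ∩ Û`: it maps components over `U` to components over `Û`. -/
def patching (l : ℂˣ) : Matrix (Fin k) (Fin k) ℂ :=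
  (T.basisHat _ (ProjLine.coe_mem_Uhat l)).toMatrix (T.basis (l : ℂ))

/-- A Birkhoff–Grothendieck splitting of the patching of `N_x`, exhibiting `N_x` as the sum of the
line bundles `O(n i)`. The matrix `H` is a function of the coordinate `l` on `U`, and `Hhat` is a
function of the coordinate `1 / l` on `Û`. -/
structure IsSplitting (n : Fin k → ℤ) (H Hhat : ℂ → Matrix (Fin k) (Fin k) ℂ) : Prop where
  holomorphic : ∀ i j, Differentiable ℂ fun l => H l i j
  holomorphicHat : ∀ i j, Differentiable ℂ fun m => Hhat m i j
  isUnit : ∀ l, IsUnit (H l)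
  isUnitHat : ∀ m, IsUnit (Hhat m)
  split : ∀ l : ℂˣ, T.patching l =
    Hhat ((l : ℂ)⁻¹) * Matrix.diagonal (fun i => (l : ℂ) ^ (-n i)) * (H l)⁻¹

/-- The frame section `v = H⁻¹ dw|` over `U`, evaluated at `u ∈ T_x M` and at the coordinate `l`. -/
def frameSection (H : ℂ → Matrix (Fin k) (Fin k) ℂ) (u : TangentSpace 𝓘(ℂ, EM) x) (l : ℂ) :
    Fin k → ℂ :=
  (H l)⁻¹.mulVec ((T.basis l).repr (C.kodaira x u (l : OnePoint ℂ)))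

/-- The frame section `Ĥ⁻¹ dŵ|` over `Û`, at the point with coordinate `1 / l = m`. -/
def frameSectionHat (Hhat : ℂ → Matrix (Fin k) (Fin k) ℂ) (u : TangentSpace 𝓘(ℂ, EM) x) (m : ℂ) :
    Fin k → ℂ :=
  (Hhat m)⁻¹.mulVec ((T.basisHat _ (ProjLine.inv_mem_Uhat m)).repr
    (C.kodaira x u (ProjLine.inv (m : OnePoint ℂ))))

/-- The matrix of an endomorphism of `N_x` in the trivialisation over `U`. -/
def endMatrix (g : ∀ ζ, Module.End ℂ (C.Normal x ζ)) (l : ℂ) : Matrix (Fin k) (Fin k) ℂ :=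
  LinearMap.toMatrix (T.basis l) (T.basis l) (g (l : OnePoint ℂ))

/-- The matrix of an endomorphism of `N_x` in the trivialisation over `Û`, at `1 / l = m`. -/
def endMatrixHat (g : ∀ ζ, Module.End ℂ (C.Normal x ζ)) (m : ℂ) : Matrix (Fin k) (Fin k) ℂ :=
  LinearMap.toMatrix (T.basisHat _ (ProjLine.inv_mem_Uhat m))
    (T.basisHat _ (ProjLine.inv_mem_Uhat m)) (g (ProjLine.inv (m : OnePoint ℂ)))

/-- `e` is the collection of covectors at `x` that the frame section `v = H⁻¹ dw|` gives rise to: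
`v^i = ∑ⱼ e^{i,j} l ^ j`. -/
def GivesFrame {n : Fin k → ℤ} (H : ℂ → Matrix (Fin k) (Fin k) ℂ) (e : Coframe EM n x) : Prop :=
  ∀ u l i, T.frameSection H u l i = ∑ j, e i j u * l ^ (j : ℕ)

/-- The preferred family of frames at `x`, as constructed by means of the trivialisations `T`. -/
def frames (n : Fin k → ℤ) : Set (Coframe EM n x) :=
  {e | ∃ H Hhat, T.IsSplitting n H Hhat ∧ T.GivesFrame H e}

end Trivialisation

end RationalCurveFamily

/-- A field `θ` of covectors is a holomorphic one-form on the open set `W`. -/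
def IsHolomorphicOneFormOn (W : Set M) (θ : ∀ x : M, Module.Dual ℂ (TangentSpace 𝓘(ℂ, EM) x)) :
    Prop :=
  ∀ W' ⊆ W, IsOpen W' → ∀ X : ∀ x : M, TangentSpace 𝓘(ℂ, EM) x,
    ContMDiffOn 𝓘(ℂ, EM) 𝓘(ℂ, EM).tangent ω
      (fun x => (⟨x, X x⟩ : TangentBundle 𝓘(ℂ, EM) M)) W' →
    ContMDiffOn 𝓘(ℂ, EM) 𝓘(ℂ) ω (fun x => θ x (X x)) W'

end Family

end

/-! Everything rests on three facts: the normal bundles are holomorphic bundles varying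
holomorphically with `x`; a bundle on the projective line with finite-dimensional `H⁰` splits into
line bundles; and a splitting is the same thing as a pair of frames of `N_x` in which the patching
is diagonal.

Geometry. The map `(ν, π ∘ μ) : F → M × ℙ¹` has bijective differential: a vertical vector is the
velocity of a section `sec x`, hence is determined by its image in `ℙ¹`. By the inverse function
theorem `sec` is holomorphic in both variables (`contMDiff_sec`). The tangents of the curves
therefore form a holomorphic line in `TZ`, the quotient by it is locally trivial
(`exists_localTriv`), and the Kodaira map is the derivative of the curves with respect to `x`
(`kodaira_eq`).

Splitting. Completeness makes `H⁰(X_x, N_x)` finite-dimensional, being the image of `T_x M`. This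
bounds the order to which sections over `ℂ` can vanish at `∞`. Take `k` sections over `ℂ` with poles
at `∞`, independent at some point, with the least total pole order. If they were dependent at a
finite point, a combination could be divided by `z - p`; if their leading coefficients at `∞` were
dependent, a combination would have a smaller pole. Either would lower the total, so the sections
are a frame over `U`, and the sections divided by powers of `z` are a frame over `Û`
(`exists_frame`).

Sections to start from are produced by analysis (`exists_section_through`). Local constant sections
are glued with cutoffs, and the error in `∂/∂z̄` is removed with Cauchy transforms on the patches.
This leads to an integral equation whose kernels are smooth, because the cutoffs are constant where
the densities live. Rational approximation of the Cauchy kernel turns the equation into a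
contraction at the price of finitely many poles, which are cleared by a polynomial
(`exists_solution_integral_equation`).

Consequences. A splitting of the patching of `T` is exactly the change of basis to a trivialisation
`T'` with `frame i = l ^ (-n i) • frameHat i`, called adapted (`IsAdapted.isSplitting`,
`IsSplitting.exists_isAdapted`). In these terms `H⁻¹ dw|` is the vector of components of the Kodaira
section in `T'`, so `T` drops out. A function entire in `l` and, up to a factor `l ^ n`, entire in
`1 / l` is a polynomial of degree at most `n`. Hence global sections are vectors of polynomials of
degree at most `n i`, and completeness turns their coefficients into a basis of covectors. The same
fact makes entries between adapted frames vanish when the degree is negative, which determines the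
type. The automorphism relating two splittings takes one adapted frame to the other. Finally, the
coefficients are recovered from values at `l = 0, …, n i` by a Vandermonde matrix, so they are as
holomorphic in `x` as the splitting. -/

/-! ### Inverse and implicit functions on manifolds; joint holomorphy of the sections -/

section Geometry

variable {EZ EM EF Z M F : Type*}
  [NormedAddCommGroup EZ] [NormedSpace ℂ EZ] [TopologicalSpace Z] [ChartedSpace EZ Z]
  [IsManifold 𝓘(ℂ, EZ) ω Z]
  [NormedAddCommGroup EM] [NormedSpace ℂ EM] [TopologicalSpace M] [ChartedSpace EM M]
  [IsManifold 𝓘(ℂ, EM) ω M]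
  [NormedAddCommGroup EF] [NormedSpace ℂ EF] [TopologicalSpace F] [ChartedSpace EF F]

/-- A tangent vector in the kernel of a submersion is the velocity of a curve in the fibre. -/
theorem exists_curve_in_fibre [FiniteDimensional ℂ EM] [FiniteDimensional ℂ EF]
    {f : F → M} {p : F} (hf : ContMDiffAt 𝓘(ℂ, EF) 𝓘(ℂ, EM) ω f p)
    (hs : Surjective (mfderiv 𝓘(ℂ, EF) 𝓘(ℂ, EM) f p)) (v : EF)
    (hv : mfderiv 𝓘(ℂ, EF) 𝓘(ℂ, EM) f p v = 0) :
    ∃ h : ℂ → F, h 0 = p ∧ (∀ᶠ t in 𝓝 0, f (h t) = f p) ∧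
      HasMFDerivAt 𝓘(ℂ) 𝓘(ℂ, EF) h 0 (ContinuousLinearMap.toSpanSingleton ℂ v) := by
  have := FiniteDimensional.complete ℂ EF
  have := FiniteDimensional.complete ℂ EM
  set φ := writtenInExtChartAt 𝓘(ℂ, EF) 𝓘(ℂ, EM) p f with hφ
  set a := extChartAt 𝓘(ℂ, EF) p p with ha
  have hd : ContDiffAt ℂ ω φ a := by
    have := (contMDiffAt_iff.1 hf).2
    simpa [hφ, ha, writtenInExtChartAt, contDiffWithinAt_univ] using this
  have hmd : mfderiv 𝓘(ℂ, EF) 𝓘(ℂ, EM) f p = fderiv ℂ φ a := by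
    have := hf.mdifferentiableAt (by simp)
    simp only [mfderiv, this, hφ, ha, modelWithCornersSelf_coe, range_id, fderivWithin_univ]
    rfl
  have hst : HasStrictFDerivAt φ (fderiv ℂ φ a) a := hd.hasStrictFDerivAt (by simp)
  have hr : (fderiv ℂ φ a).range = ⊤ := LinearMap.range_eq_top.2 (by
    have := hs; rw [hmd] at this; exact this)
  have hk : v ∈ (fderiv ℂ φ a).ker := by rw [hmd] at hv; exact hv
  -- The implicit function parametrises the level set of `φ` through `a` by the kernel of the
  -- derivative, and its own derivative at `0` is the inclusion of the kernel.
  set g := hst.implicitFunction φ (fderiv ℂ φ a) hr (φ a) with hg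
  have hg1 : HasStrictFDerivAt g _ 0 := hst.to_implicitFunction hr
  have hg0 : g 0 = a := by
    have := hst.implicitFunction_apply_image hr
    exact this
  have hg2 : ∀ᶠ q in 𝓝 (0 : (fderiv ℂ φ a).ker), φ (g q) = φ a := by
    have h1 := hst.map_implicitFunction_eq hr
    have h2 : Filter.Tendsto (fun q : (fderiv ℂ φ a).ker => (φ a, q)) (𝓝 0) (𝓝 (φ a, 0)) :=
      (Continuous.prodMk continuous_const continuous_id).tendsto' _ _ rfl
    exact h2.eventually h1
  set c : ℂ → EF := fun t => g (t • ⟨v, hk⟩) with hc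
  have hcd : HasFDerivAt c (ContinuousLinearMap.toSpanSingleton ℂ v) 0 := by
    have h1 : HasFDerivAt (fun t : ℂ => t • (⟨v, hk⟩ : (fderiv ℂ φ a).ker))
        (ContinuousLinearMap.toSpanSingleton ℂ (⟨v, hk⟩ : (fderiv ℂ φ a).ker)) 0 :=
      (ContinuousLinearMap.toSpanSingleton ℂ (⟨v, hk⟩ : (fderiv ℂ φ a).ker)).hasFDerivAt
    have h2 := HasFDerivAt.comp (x := (0:ℂ)) (g := g)
      (f := fun t : ℂ => t • (⟨v, hk⟩ : (fderiv ℂ φ a).ker))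
      (by simpa using hg1.hasFDerivAt) h1
    have h3 : (fderiv ℂ φ a).ker.subtypeL ∘L
        ContinuousLinearMap.toSpanSingleton ℂ (⟨v, hk⟩ : (fderiv ℂ φ a).ker) =
        ContinuousLinearMap.toSpanSingleton ℂ v := by
      ext; simp
    rw [← h3]
    exact h2
  have hc0 : c 0 = a := by rw [← hg0]; simp only [hc, zero_smul]
  have hct : ∀ᶠ t in 𝓝 (0 : ℂ), c t ∈ (extChartAt 𝓘(ℂ, EF) p).target := by
    have h1 := hcd.continuousAt
    refine h1.eventually (p := fun y => y ∈ (extChartAt 𝓘(ℂ, EF) p).target) ?_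
    rw [hc0]
    exact extChartAt_target_mem_nhds p
  have hcc : ContinuousAt (fun t => (extChartAt 𝓘(ℂ, EF) p).symm (c t)) 0 := by
    refine ContinuousAt.comp (g := (extChartAt 𝓘(ℂ, EF) p).symm) ?_ hcd.continuousAt
    rw [hc0]; exact continuousAt_extChartAt_symm p
  refine ⟨fun t => (extChartAt 𝓘(ℂ, EF) p).symm (c t), by simp [hc0, ha], ?_, hcc, ?_⟩
  · have h1 : ∀ᶠ t in 𝓝 (0 : ℂ), φ (c t) = φ a := by
      have h2 : Filter.Tendsto (fun t : ℂ => t • (⟨v, hk⟩ : (fderiv ℂ φ a).ker)) (𝓝 0) (𝓝 0) :=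
        (Continuous.smul continuous_id continuous_const).tendsto' _ _ (by simp)
      exact h2.eventually hg2
    have h3 : ∀ᶠ t in 𝓝 (0 : ℂ),
        f ((extChartAt 𝓘(ℂ, EF) p).symm (c t)) ∈ (extChartAt 𝓘(ℂ, EM) (f p)).source := by
      have h4 : (extChartAt 𝓘(ℂ, EF) p).symm (c 0) = p := by simp [hc0, ha]
      refine hcc.eventually (p := fun y => f y ∈ (extChartAt 𝓘(ℂ, EM) (f p)).source) ?_
      simp only [h4]
      exact hf.continuousAt.eventually (extChartAt_source_mem_nhds (f p))
    filter_upwards [h1, h3] with t ht1 ht3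
    have : φ a = extChartAt 𝓘(ℂ, EM) (f p) (f p) := by simp [hφ, ha, writtenInExtChartAt]
    rw [this] at ht1
    exact (extChartAt 𝓘(ℂ, EM) (f p)).injOn ht3 (mem_extChartAt_source (f p)) ht1
  · have h0 : (extChartAt 𝓘(ℂ, EF) p).symm (c 0) = p := by simp [hc0, ha]
    simp only [writtenInExtChartAt, extChartAt_model_space_eq_id, h0]
    refine (HasFDerivAt.congr_of_eventuallyEq (f₁ := _) hcd ?_).hasFDerivWithinAt
    filter_upwards [hct] with t ht
    exact (extChartAt 𝓘(ℂ, EF) p).right_inv ht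

/-- The inverse function theorem on complex manifolds. -/
theorem exists_local_right_inverse {E H N : Type*} [NormedAddCommGroup E] [NormedSpace ℂ E]
    [TopologicalSpace H] {I : ModelWithCorners ℂ E H} [I.Boundaryless] [TopologicalSpace N]
    [ChartedSpace H N] [IsManifold I ω N] [IsManifold 𝓘(ℂ, EF) ω F]
    [FiniteDimensional ℂ EF] {f : F → N} {p : F}
    (hf : ContMDiffAt 𝓘(ℂ, EF) I ω f p) (hs : Bijective (mfderiv 𝓘(ℂ, EF) I f p)) :
    ∃ g : N → F, g (f p) = p ∧ (∀ᶠ q in 𝓝 (f p), f (g q) = q) ∧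
      ContMDiffAt I 𝓘(ℂ, EF) ω g (f p) := by
  have := FiniteDimensional.complete ℂ EF
  set φ := writtenInExtChartAt 𝓘(ℂ, EF) I p f with hφ
  set a := extChartAt 𝓘(ℂ, EF) p p with ha
  have hd : ContDiffAt ℂ ω φ a := by
    have := (contMDiffAt_iff.1 hf).2
    simpa [hφ, ha, writtenInExtChartAt, contDiffWithinAt_univ] using this
  have hmd : mfderiv 𝓘(ℂ, EF) I f p = fderiv ℂ φ a := by
    have := hf.mdifferentiableAt (by simp)
    simp only [mfderiv, this, hφ, ha, modelWithCornersSelf_coe, range_id,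
      fderivWithin_univ]
    rfl
  rw [hmd] at hs
  let L : EF ≃L[ℂ] E :=
    (LinearEquiv.ofBijective (fderiv ℂ φ a : EF →ₗ[ℂ] E) hs).toContinuousLinearEquiv
  have hL : (L : EF →L[ℂ] E) = fderiv ℂ φ a := by ext; rfl
  have hL' : HasFDerivAt φ (L : EF →L[ℂ] E) a := by
    rw [hL]; exact (hd.differentiableAt (by simp)).hasFDerivAt
  set g := hd.localInverse hL' (by simp) with hg
  have hg1 : ContDiffAt ℂ ω g (φ a) := hd.to_localInverse hL' (by simp)
  have hg0 : g (φ a) = a := hd.localInverse_apply_image hL' (by simp)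
  have hg2 : ∀ᶠ y in 𝓝 (φ a), φ (g y) = y :=
    (hd.hasStrictFDerivAt' hL' (by simp)).eventually_right_inverse
  have hφa : φ a = extChartAt I (f p) (f p) := by
    simp [hφ, ha, writtenInExtChartAt]
  set h : N → F := fun q => (extChartAt 𝓘(ℂ, EF) p).symm (g (extChartAt I (f p) q)) with hh
  have hh0 : h (f p) = p := by
    have h1 : h (f p) = (extChartAt 𝓘(ℂ, EF) p).symm (g (φ a)) := by rw [hφa]
    rw [h1, hg0, ha, extChartAt_to_inv]
  have hh1 : ContMDiffAt I 𝓘(ℂ, EF) ω h (f p) := by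
    have h1 : ContMDiffAt I 𝓘(ℂ, E) ω (extChartAt I (f p)) (f p) := contMDiffAt_extChartAt
    have h2 : ContMDiffAt 𝓘(ℂ, E) 𝓘(ℂ, EF) ω g (extChartAt I (f p) (f p)) := by
      rw [← hφa]; exact hg1.contMDiffAt
    have h3 : ContMDiffAt 𝓘(ℂ, EF) 𝓘(ℂ, EF) ω (extChartAt 𝓘(ℂ, EF) p).symm
        (g (extChartAt I (f p) (f p))) := by
      rw [← hφa, hg0]
      exact (contMDiffOn_extChartAt_symm p).contMDiffAt (extChartAt_target_mem_nhds p)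
    exact ContMDiffAt.comp (f p) (g := (extChartAt 𝓘(ℂ, EF) p).symm) h3 (h2.comp (f p) h1)
  refine ⟨h, hh0, ?_, hh1⟩
  have e1 : ∀ᶠ q in 𝓝 (f p), φ (g (extChartAt I (f p) q)) = extChartAt I (f p) q := by
    have h1 := continuousAt_extChartAt (I := I) (f p)
    rw [ContinuousAt, ← hφa] at h1
    exact h1.eventually hg2
  have e2 : ∀ᶠ q in 𝓝 (f p), f (h q) ∈ (extChartAt I (f p)).source := by
    refine hh1.continuousAt.eventually (p := fun y => f y ∈ (extChartAt I (f p)).source) ?_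
    rw [hh0]
    exact hf.continuousAt.eventually (extChartAt_source_mem_nhds (f p))
  filter_upwards [e1, e2, extChartAt_source_mem_nhds (I := I) (f p)] with q h1 h2 h3
  exact (extChartAt I (f p)).injOn h2 h3 h1

namespace RationalCurveFamily

variable {proj : Z → OnePoint ℂ} (C : RationalCurveFamily EZ EM EF M F proj)

theorem contMDiff_mu : ContMDiff 𝓘(ℂ, EF) 𝓘(ℂ, EZ) ω C.mu :=
  contMDiff_fst.comp C.isEmbedding.contMDiff

theorem contMDiff_nu : ContMDiff 𝓘(ℂ, EF) 𝓘(ℂ, EM) ω C.nu :=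
  contMDiff_snd.comp C.isEmbedding.contMDiff

theorem nu_sec (x : M) (ζ : OnePoint ℂ) : C.nu (C.sec x ζ) = x := C.snd_sec x ζ

theorem proj_mu_sec (x : M) (ζ : OnePoint ℂ) : proj (C.mu (C.sec x ζ)) = ζ := C.proj_sec x ζ

theorem sec_nu_proj (p : F) : C.sec (C.nu p) (proj (C.mu p)) = p := C.sec_proj p

/-- `F → ℙ¹` splits the derivative of the section `sec x`. -/
theorem mfderiv_proj_sec (hproj : ContMDiff 𝓘(ℂ, EZ) 𝓘(ℂ) ω proj) (x : M) (ζ : OnePoint ℂ)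
    (c : ℂ) :
    mfderiv 𝓘(ℂ, EF) 𝓘(ℂ) (proj ∘ C.mu) (C.sec x ζ)
      (mfderiv 𝓘(ℂ) 𝓘(ℂ, EF) (C.sec x) ζ c) = c := by
  have h1 : (proj ∘ C.mu) ∘ C.sec x = id := by
    ext1 ξ; exact C.proj_mu_sec x ξ
  have h2 : MDifferentiableAt 𝓘(ℂ, EF) 𝓘(ℂ) (proj ∘ C.mu) (C.sec x ζ) :=
    ((hproj.comp C.contMDiff_mu).mdifferentiable (by simp)) _
  have h3 : MDifferentiableAt 𝓘(ℂ) 𝓘(ℂ, EF) (C.sec x) ζ :=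
    (C.sec_holomorphic x).mdifferentiable (by simp) _
  have h4 := mfderiv_comp ζ h2 h3
  rw [h1, mfderiv_id] at h4
  exact (DFunLike.congr_fun h4 c).symm

theorem mfderiv_nu_sec (x : M) (ζ : OnePoint ℂ) (c : ℂ) :
    mfderiv 𝓘(ℂ, EF) 𝓘(ℂ, EM) C.nu (C.sec x ζ)
      (mfderiv 𝓘(ℂ) 𝓘(ℂ, EF) (C.sec x) ζ c) = 0 := by
  have h1 : C.nu ∘ C.sec x = fun _ => x := by
    ext1 ξ; exact C.nu_sec x ξ
  have h2 : MDifferentiableAt 𝓘(ℂ, EF) 𝓘(ℂ, EM) C.nu (C.sec x ζ) :=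
    (C.contMDiff_nu.mdifferentiable (by simp)) _
  have h3 : MDifferentiableAt 𝓘(ℂ) 𝓘(ℂ, EF) (C.sec x) ζ :=
    (C.sec_holomorphic x).mdifferentiable (by simp) _
  have h4 := mfderiv_comp ζ h2 h3
  rw [h1, mfderiv_const] at h4
  exact (DFunLike.congr_fun h4 c).symm

variable [FiniteDimensional ℂ EM] [FiniteDimensional ℂ EF]

/-- The vertical tangent vectors are the velocities of the sections. -/
theorem eq_mfderiv_sec_of_mem_vertical (hproj : ContMDiff 𝓘(ℂ, EZ) 𝓘(ℂ) ω proj) (x : M)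
    (ζ : OnePoint ℂ) (v : EF) (hv : mfderiv 𝓘(ℂ, EF) 𝓘(ℂ, EM) C.nu (C.sec x ζ) v = 0) :
    v = mfderiv 𝓘(ℂ) 𝓘(ℂ, EF) (C.sec x) ζ
      (mfderiv 𝓘(ℂ, EF) 𝓘(ℂ) (proj ∘ C.mu) (C.sec x ζ) v) := by
  obtain ⟨h, h0, h1, h2⟩ := exists_curve_in_fibre (C.contMDiff_nu (C.sec x ζ))
    (C.regular (C.sec x ζ)) v hv
  -- A curve in the fibre over `x` is recovered by `sec x` from its projection to `ℙ¹`; the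
  -- assertion is the derivative of this identity at `0`.
  have e : h =ᶠ[𝓝 0] C.sec x ∘ (proj ∘ C.mu) ∘ h := by
    filter_upwards [h1] with t ht
    rw [C.nu_sec] at ht
    have := C.sec_nu_proj (h t)
    rw [ht] at this
    exact this.symm
  have d1 : MDifferentiableAt 𝓘(ℂ, EF) 𝓘(ℂ) (proj ∘ C.mu) (C.sec x ζ) :=
    ((hproj.comp C.contMDiff_mu).mdifferentiable (by simp)) _
  have hz : (proj ∘ C.mu) (h 0) = ζ := by rw [h0]; exact C.proj_mu_sec x ζ
  have d2 : HasMFDerivAt 𝓘(ℂ) 𝓘(ℂ, EF) (C.sec x) ((proj ∘ C.mu) (h 0))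
      (mfderiv 𝓘(ℂ) 𝓘(ℂ, EF) (C.sec x) ζ) := by
    rw [hz]; exact ((C.sec_holomorphic x).mdifferentiable (by simp) _).hasMFDerivAt
  have d3 : HasMFDerivAt 𝓘(ℂ, EF) 𝓘(ℂ) (proj ∘ C.mu) (h 0)
      (mfderiv 𝓘(ℂ, EF) 𝓘(ℂ) (proj ∘ C.mu) (C.sec x ζ)) := by
    rw [h0]; exact d1.hasMFDerivAt
  have d4 := (HasMFDerivAt.comp (0 : ℂ) (f := (proj ∘ C.mu) ∘ h) d2
    (d3.comp (0 : ℂ) h2)).congr_of_eventuallyEq e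
  have d5 := hasMFDerivAt_unique h2 d4
  have d6 := DFunLike.congr_fun d5 (1 : ℂ)
  have d7 : ContinuousLinearMap.toSpanSingleton ℂ v (1 : ℂ) = v := by simp
  let A : EF →L[ℂ] ℂ := mfderiv 𝓘(ℂ, EF) 𝓘(ℂ) (proj ∘ C.mu) (C.sec x ζ)
  let B : ℂ →L[ℂ] EF := mfderiv 𝓘(ℂ) 𝓘(ℂ, EF) (C.sec x) ζ
  have d8 : ContinuousLinearMap.toSpanSingleton ℂ v (1 : ℂ) =
    B (A (ContinuousLinearMap.toSpanSingleton ℂ v (1 : ℂ))) := d6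
  rw [d7] at d8
  exact d8

/-- The sections of the family depend holomorphically on the parameters. -/
theorem contMDiff_sec [IsManifold 𝓘(ℂ, EF) ω F] (hproj : ContMDiff 𝓘(ℂ, EZ) 𝓘(ℂ) ω proj) :
    ContMDiff (𝓘(ℂ, EM).prod 𝓘(ℂ)) 𝓘(ℂ, EF) ω (fun q : M × OnePoint ℂ => C.sec q.1 q.2) := by
  rintro ⟨x, ζ⟩
  set p := C.sec x ζ with hp
  have hd : MDifferentiableAt 𝓘(ℂ, EF) 𝓘(ℂ) (proj ∘ C.mu) p :=
    ((hproj.comp C.contMDiff_mu).mdifferentiable (by simp)) _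
  have hn : MDifferentiableAt 𝓘(ℂ, EF) 𝓘(ℂ, EM) C.nu p :=
    (C.contMDiff_nu.mdifferentiable (by simp)) _
  have hmf : ∀ v : EF, mfderiv 𝓘(ℂ, EF) (𝓘(ℂ, EM).prod 𝓘(ℂ))
      (fun p => (C.nu p, (proj ∘ C.mu) p)) p v =
      (mfderiv 𝓘(ℂ, EF) 𝓘(ℂ, EM) C.nu p v, mfderiv 𝓘(ℂ, EF) 𝓘(ℂ) (proj ∘ C.mu) p v) := by
    intro v
    rw [mfderiv_prodMk hn hd]; rfl
  -- Injective, because a vertical vector is determined by its image in `ℙ¹`; surjective, because a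
  -- lift of `u` can be corrected by a velocity of `sec x`, which is vertical and has any prescribed
  -- image in `ℙ¹`.
  have hb : Bijective (mfderiv 𝓘(ℂ, EF) (𝓘(ℂ, EM).prod 𝓘(ℂ))
      (fun p => (C.nu p, (proj ∘ C.mu) p)) p) := by
    constructor
    · refine (injective_iff_map_eq_zero _).2 fun v hv => ?_
      have hv' := (hmf v).symm.trans hv
      have h1 : mfderiv 𝓘(ℂ, EF) 𝓘(ℂ, EM) C.nu p v = 0 := congrArg Prod.fst hv'
      have h2 : mfderiv 𝓘(ℂ, EF) 𝓘(ℂ) (proj ∘ C.mu) p v = 0 := congrArg Prod.snd hv'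
      have h3 := C.eq_mfderiv_sec_of_mem_vertical hproj x ζ v h1
      exact h3.trans ((congrArg _ h2).trans (map_zero (mfderiv 𝓘(ℂ) 𝓘(ℂ, EF) (C.sec x) ζ)))
    · rintro ⟨u, c⟩
      let A : EF →L[ℂ] EM := mfderiv 𝓘(ℂ, EF) 𝓘(ℂ, EM) C.nu p
      let A' : EF →L[ℂ] ℂ := mfderiv 𝓘(ℂ, EF) 𝓘(ℂ) (proj ∘ C.mu) p
      let B : ℂ →L[ℂ] EF := mfderiv 𝓘(ℂ) 𝓘(ℂ, EF) (C.sec x) ζ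
      have hA : Surjective A := C.regular p
      have k1 : ∀ c, A (B c) = 0 := C.mfderiv_nu_sec x ζ
      have k2 : ∀ c, A' (B c) = c := C.mfderiv_proj_sec hproj x ζ
      have key : ∀ (u : EM) (c : ℂ), ∃ v, A v = u ∧ A' v = c := fun u c => by
        obtain ⟨v, hv⟩ := hA u
        exact ⟨v + B (c - A' v), by rw [map_add, k1, hv, add_zero],
          by rw [map_add, k2, add_sub_cancel]⟩
      obtain ⟨v, h1, h2⟩ := key u c
      exact ⟨v, (hmf _).trans (Prod.ext h1 h2)⟩
  have hf : ContMDiffAt 𝓘(ℂ, EF) (𝓘(ℂ, EM).prod 𝓘(ℂ)) ω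
      (fun p => (C.nu p, (proj ∘ C.mu) p)) p :=
    (C.contMDiff_nu p).prodMk ((hproj.comp C.contMDiff_mu) p)
  obtain ⟨g, -, hg1, hg2⟩ := exists_local_right_inverse hf hb
  have hp' : (C.nu p, (proj ∘ C.mu) p) = (x, ζ) := by
    rw [hp, C.nu_sec]; exact Prod.ext rfl (C.proj_mu_sec x ζ)
  simp only [hp'] at hg1 hg2
  -- The map `sec` is a global left inverse of `(ν, proj ∘ μ)`, so it agrees with any local right
  -- inverse.
  refine hg2.congr_of_eventuallyEq ?_
  filter_upwards [hg1] with q hq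
  have := C.sec_nu_proj (g q)
  rw [← hq] at this ⊢
  refine Eq.trans ?_ (C.sec_nu_proj _)
  rw [hq]
  exact congrArg₂ C.sec (congrArg Prod.fst hq).symm (congrArg Prod.snd hq).symm

end RationalCurveFamily

end Geometry

/-- A complement of a line, with the two projections. -/
theorem exists_complement_of_ne_zero {E : Type*} [NormedAddCommGroup E] [NormedSpace ℂ E] {k : ℕ}
    (hdim : Module.finrank ℂ E = k + 1) {t : E} (ht : t ≠ 0) :
    ∃ (a : E →L[ℂ] ℂ) (P : E →L[ℂ] (Fin k → ℂ)) (R : (Fin k → ℂ) →L[ℂ] E),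
      a t = 1 ∧ P t = 0 ∧ (∀ c, P (R c) = c) ∧ (∀ c, a (R c) = 0) ∧
      ∀ v, v = a v • t + R (P v) := by
  have : FiniteDimensional ℂ E := Module.finite_of_finrank_pos (by omega)
  obtain ⟨S, hS⟩ := Submodule.exists_isCompl (ℂ ∙ t)
  have h1 : Module.finrank ℂ (ℂ ∙ t) = 1 := finrank_span_singleton ht
  have h2 : Module.finrank ℂ S = k := by
    have := Submodule.finrank_add_eq_of_isCompl hS
    omega
  let b : S ≃ₗ[ℂ] (Fin k → ℂ) := (LinearEquiv.ofFinrankEq S (Fin k → ℂ) (by simp [h2]))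
  let l : (ℂ ∙ t) ≃ₗ[ℂ] ℂ := (LinearEquiv.toSpanNonzeroSingleton ℂ E t ht).symm
  let a : E →ₗ[ℂ] ℂ := l.toLinearMap ∘ₗ Submodule.projectionOnto (ℂ ∙ t) S hS
  let P : E →ₗ[ℂ] (Fin k → ℂ) := b.toLinearMap ∘ₗ Submodule.projectionOnto S (ℂ ∙ t) hS.symm
  let R : (Fin k → ℂ) →ₗ[ℂ] E := S.subtype ∘ₗ b.symm.toLinearMap
  have ht' : t ∈ ℂ ∙ t := Submodule.mem_span_singleton_self t
  refine ⟨LinearMap.toContinuousLinearMap a, LinearMap.toContinuousLinearMap P,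
    LinearMap.toContinuousLinearMap R, ?_, ?_, ?_, ?_, ?_⟩
  · have : Submodule.projectionOnto (ℂ ∙ t) S hS t = ⟨t, ht'⟩ :=
      Submodule.projectionOnto_apply_left hS ⟨t, ht'⟩
    simp only [a, LinearMap.coe_toContinuousLinearMap', LinearMap.comp_apply, this]
    simp [l, LinearEquiv.symm_apply_eq]
  · have : Submodule.projectionOnto S (ℂ ∙ t) hS.symm t = 0 :=
      Submodule.projectionOnto_apply_right hS.symm ⟨t, ht'⟩
    simp [P, this]
  · intro c
    simp [P, R]
  · intro c
    simp [a, R]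
  · intro v
    have h3 : (l.symm (a v) : E) = a v • t := rfl
    have h4 := Submodule.projection_add_projection_eq_self hS v
    simp only [LinearMap.coe_toContinuousLinearMap']
    rw [← h3]
    simpa [a, P, R] using h4.symm

/-- Subtracting from `w` the multiple of `t` with the same `a`-component leaves a vector determined
by its image under `P`. The expression on the right thus has kernel `ℂ t` and depends rationally on
`t`, which is what allows the quotient by a moving line to be trivialised. -/
theorem exists_eq_smul_iff {E E' : Type*} [AddCommGroup E] [TopologicalSpace E] [Module ℂ E]
    [AddCommGroup E'] [TopologicalSpace E'] [Module ℂ E'] {a : E →L[ℂ] ℂ} {P : E →L[ℂ] E'}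
    {R : E' →L[ℂ] E} {t₀ : E} (hv : ∀ v, v = a v • t₀ + R (P v)) {t : E} (ht : a t ≠ 0) (w : E) :
    (∃ c : ℂ, w = c • t) ↔ P w - a w • (a t)⁻¹ • P t = 0 := by
  constructor
  · rintro ⟨c, rfl⟩
    simp [smul_smul, ht]
  · intro h
    rw [sub_eq_zero, smul_smul] at h
    refine ⟨a w * (a t)⁻¹, ?_⟩
    have h1 : (a w * (a t)⁻¹) • t = (a w * (a t)⁻¹) • (a t • t₀ + R (P t)) := congrArg _ (hv t)
    rw [h1, smul_add, smul_smul, inv_mul_cancel_right₀ ht, ← map_smul, ← h]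
    exact hv w

/-- Allows `kodairaAt`, which is defined through a quotient by `ker dν`, to be computed with any
lift of the tangent vector. -/
theorem mapQ_quotKerEquivOfSurjective_symm {V W Y : Type*} [AddCommGroup V] [Module ℂ V]
    [AddCommGroup W] [Module ℂ W] [AddCommGroup Y] [Module ℂ Y] (A : V →ₗ[ℂ] W)
    (hA : Surjective A) (B : V →ₗ[ℂ] Y) (v : V) :
    (A.ker.mapQ (A.ker.map B) B (Submodule.le_comap_map _ _) ∘ₗ
      (A.quotKerEquivOfSurjective hA).symm.toLinearMap) (A v) = Submodule.Quotient.mk (B v) := by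
  have h : (A.quotKerEquivOfSurjective hA).symm (A v) = Submodule.Quotient.mk v := by
    rw [LinearEquiv.symm_apply_eq]; rfl
  simp [h]

/-! ### Holomorphic local coordinates on the normal bundles -/

section NormalBundle

variable {EZ EM EF Z M F : Type*}
  [NormedAddCommGroup EZ] [NormedSpace ℂ EZ] [TopologicalSpace Z] [ChartedSpace EZ Z]
  [IsManifold 𝓘(ℂ, EZ) ω Z]
  [NormedAddCommGroup EM] [NormedSpace ℂ EM] [FiniteDimensional ℂ EM]
  [TopologicalSpace M] [ChartedSpace EM M] [IsManifold 𝓘(ℂ, EM) ω M]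
  [NormedAddCommGroup EF] [NormedSpace ℂ EF] [FiniteDimensional ℂ EF]
  [TopologicalSpace F] [ChartedSpace EF F] [IsManifold 𝓘(ℂ, EF) ω F]
  {proj : Z → OnePoint ℂ} (C : RationalCurveFamily EZ EM EF M F proj)

namespace RationalCurveFamily

/-- The point with parameters `q` of the family of curves in `Z`. -/
def point (q : M × OnePoint ℂ) : Z := C.mu (C.sec q.1 q.2)

theorem contMDiff_point (hproj : ContMDiff 𝓘(ℂ, EZ) 𝓘(ℂ) ω proj) :
    ContMDiff (𝓘(ℂ, EM).prod 𝓘(ℂ)) 𝓘(ℂ, EZ) ω C.point :=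
  C.contMDiff_mu.comp (C.contMDiff_sec hproj)

theorem mfderiv_point_right (x : M) (ζ : OnePoint ℂ) (c : ℂ) :
    mfderiv 𝓘(ℂ) 𝓘(ℂ, EZ) (fun ξ => C.point (x, ξ)) ζ c =
      mfderiv 𝓘(ℂ, EF) 𝓘(ℂ, EZ) C.mu (C.sec x ζ) (mfderiv 𝓘(ℂ) 𝓘(ℂ, EF) (C.sec x) ζ c) := by
  have h := mfderiv_comp (I := 𝓘(ℂ)) (I' := 𝓘(ℂ, EF)) (I'' := 𝓘(ℂ, EZ)) (f := C.sec x)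
    (g := C.mu) ζ ((C.contMDiff_mu.mdifferentiable (by simp)) _)
    ((C.sec_holomorphic x).mdifferentiable (by simp) _)
  exact DFunLike.congr_fun h c

theorem mem_curveTangent_iff (hproj : ContMDiff 𝓘(ℂ, EZ) 𝓘(ℂ) ω proj) (x : M) (ζ : OnePoint ℂ)
    (w : EZ) :
    w ∈ C.curveTangent (C.sec x ζ) ↔
      ∃ c : ℂ, w = mfderiv 𝓘(ℂ) 𝓘(ℂ, EZ) (fun ξ => C.point (x, ξ)) ζ c := by
  constructor
  · rintro ⟨v, hv, rfl⟩
    refine ⟨mfderiv 𝓘(ℂ, EF) 𝓘(ℂ) (proj ∘ C.mu) (C.sec x ζ) v, ?_⟩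
    refine Eq.trans ?_ (C.mfderiv_point_right x ζ _).symm
    exact congrArg (mfderiv 𝓘(ℂ, EF) 𝓘(ℂ, EZ) C.mu (C.sec x ζ))
      (C.eq_mfderiv_sec_of_mem_vertical hproj x ζ v hv)
  · rintro ⟨c, rfl⟩
    exact ⟨mfderiv 𝓘(ℂ) 𝓘(ℂ, EF) (C.sec x) ζ c, C.mfderiv_nu_sec x ζ c,
      (C.mfderiv_point_right x ζ c).symm⟩

/-- The curve is a section of `proj`, so its derivative has a left inverse; the tangent line never
degenerates. -/
theorem mfderiv_point_right_injective (hproj : ContMDiff 𝓘(ℂ, EZ) 𝓘(ℂ) ω proj) (x : M)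
    (ζ : OnePoint ℂ) (c : ℂ)
    (h : mfderiv 𝓘(ℂ) 𝓘(ℂ, EZ) (fun ξ => C.point (x, ξ)) ζ c = (0 : EZ)) : c = 0 := by
  have h1 : proj ∘ (fun ξ => C.point (x, ξ)) = id := by
    ext1 ξ; exact C.proj_mu_sec x ξ
  have h2 := mfderiv_comp (I := 𝓘(ℂ)) (I' := 𝓘(ℂ, EZ)) (I'' := 𝓘(ℂ)) (g := proj)
    (f := fun ξ => C.point (x, ξ)) ζ ((hproj.mdifferentiable (by simp)) _)
    (((C.contMDiff_point hproj).comp (contMDiff_const.prodMk contMDiff_id)).mdifferentiable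
      (by simp) _)
  rw [h1, mfderiv_id] at h2
  let A : EZ →L[ℂ] ℂ := mfderiv 𝓘(ℂ, EZ) 𝓘(ℂ) proj (C.point (x, ζ))
  have h3 : c = A (mfderiv 𝓘(ℂ) 𝓘(ℂ, EZ) (fun ξ => C.point (x, ξ)) ζ c) :=
    DFunLike.congr_fun h2 c
  exact h3.trans ((congrArg A h).trans (map_zero A))

/-- The Kodaira map is the derivative of the curves with respect to the parameters. -/
theorem kodaira_eq (hproj : ContMDiff 𝓘(ℂ, EZ) 𝓘(ℂ) ω proj) (x : M) (u : EM)
    (ζ : OnePoint ℂ) :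
    C.kodaira x u ζ =
      Submodule.Quotient.mk (mfderiv 𝓘(ℂ, EM) 𝓘(ℂ, EZ) (fun y => C.point (y, ζ)) x u) := by
  have hs : MDifferentiableAt 𝓘(ℂ, EM) 𝓘(ℂ, EF) (fun y => C.sec y ζ) x :=
    (((C.contMDiff_sec hproj).comp (contMDiff_id.prodMk contMDiff_const)).mdifferentiable
      (by simp) x :)
  have h1 : C.nu ∘ (fun y => C.sec y ζ) = id := by
    ext1 y; exact C.nu_sec y ζ
  have h2 := mfderiv_comp (I := 𝓘(ℂ, EM)) (I' := 𝓘(ℂ, EF)) (I'' := 𝓘(ℂ, EM)) (g := C.nu)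
    (f := fun y => C.sec y ζ) x ((C.contMDiff_nu.mdifferentiable (by simp)) _) hs
  rw [h1, mfderiv_id] at h2
  have h3 := mfderiv_comp (I := 𝓘(ℂ, EM)) (I' := 𝓘(ℂ, EF)) (I'' := 𝓘(ℂ, EZ)) (g := C.mu)
    (f := fun y => C.sec y ζ) x ((C.contMDiff_mu.mdifferentiable (by simp)) _) hs
  have h4 := DFunLike.congr_fun h2 u
  have h5 := DFunLike.congr_fun h3 u
  refine Eq.trans ?_ (congrArg Submodule.Quotient.mk h5).symm
  -- The velocity of `y ↦ sec y ζ` is a lift of `u` to `F`.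
  let v : TangentSpace 𝓘(ℂ, EF) (C.sec x ζ) :=
    mfderiv 𝓘(ℂ, EM) 𝓘(ℂ, EF) (fun y => C.sec y ζ) x u
  have h6 : C.kodairaAt (C.sec x ζ) u = C.kodairaAt (C.sec x ζ)
      (mfderiv 𝓘(ℂ, EF) 𝓘(ℂ, EM) C.nu (C.sec x ζ) v) := congrArg _ h4
  exact h6.trans (mapQ_quotKerEquivOfSurjective_symm
    (mfderiv 𝓘(ℂ, EF) 𝓘(ℂ, EM) C.nu (C.sec x ζ)).toLinearMap (C.regular _)
    (mfderiv 𝓘(ℂ, EF) 𝓘(ℂ, EZ) C.mu (C.sec x ζ)).toLinearMap v)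

variable {k : ℕ}

/-- In a trivialisation of `TZ` the tangent of the curve is spanned by a nowhere zero vector `t q`,
holomorphic in `q`. With a complement of `t q₀` held fixed, `Λ q` is the projection to this
complement along `t q`, and `R` is the inclusion of the complement, the same for all `q`. -/
theorem exists_normal_chart (hdim : Module.finrank ℂ EZ = k + 1)
    (hproj : ContMDiff 𝓘(ℂ, EZ) 𝓘(ℂ) ω proj) (q₀ : M × OnePoint ℂ) :
    ∃ (Λ : M × OnePoint ℂ → EZ →L[ℂ] (Fin k → ℂ)) (R : (Fin k → ℂ) →L[ℂ] EZ),
      ∀ᶠ q in 𝓝 q₀,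
        ContMDiffAt (𝓘(ℂ, EM).prod 𝓘(ℂ)) 𝓘(ℂ, EZ →L[ℂ] (Fin k → ℂ)) ω Λ q ∧
        C.point q ∈ (trivializationAt EZ (TangentSpace 𝓘(ℂ, EZ)) (C.point q₀)).baseSet ∧
        (∀ c, Λ q (R c) = c) ∧
        ∀ w : TangentSpace 𝓘(ℂ, EZ) (C.mu (C.sec q.1 q.2)), w ∈ C.curveTangent (C.sec q.1 q.2) ↔
          Λ q ((trivializationAt EZ (TangentSpace 𝓘(ℂ, EZ)) (C.point q₀)).linearMapAt ℂ
            (C.point q) w) = 0 := by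
  have hZ : IsManifold 𝓘(ℂ, EZ) 1 Z := IsManifold.of_le (n := ω) (by simp)
  set e := trivializationAt EZ (TangentSpace 𝓘(ℂ, EZ)) (C.point q₀) with he
  -- The velocity in the `ℙ¹` direction, read in the trivialisations of both tangent bundles at
  -- `q₀`; the one of `ℙ¹` only contributes a nonzero scalar.
  set t : M × OnePoint ℂ → EZ := fun q =>
    inTangentCoordinates 𝓘(ℂ) 𝓘(ℂ, EZ) Prod.snd C.point
      (fun q => mfderiv 𝓘(ℂ) 𝓘(ℂ, EZ) (fun ξ => C.point (q.1, ξ)) q.2) q₀ q 1 with ht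
  have ht1 : ContMDiffAt (𝓘(ℂ, EM).prod 𝓘(ℂ)) 𝓘(ℂ, EZ) ω t q₀ := by
    have h1 : ContMDiffAt ((𝓘(ℂ, EM).prod 𝓘(ℂ)).prod 𝓘(ℂ)) 𝓘(ℂ, EZ) ω
        (uncurry fun (q : M × OnePoint ℂ) ξ => C.point (q.1, ξ)) (q₀, q₀.2) :=
      ((C.contMDiff_point hproj).comp
        ((contMDiff_fst.comp contMDiff_fst).prodMk contMDiff_snd)) _
    have h2 := ContMDiffAt.mfderiv (m := ω) (fun (q : M × OnePoint ℂ) ξ => C.point (q.1, ξ))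
      Prod.snd h1 contMDiffAt_snd (by simp)
    exact h2.clm_apply contMDiffAt_const
  have ebase : ∀ᶠ q in 𝓝 q₀, C.point q ∈ e.baseSet :=
    (C.contMDiff_point hproj).continuous.continuousAt.eventually
      (e.open_baseSet.mem_nhds (FiberBundle.mem_baseSet_trivializationAt' _))
  have pbase : ∀ᶠ q in 𝓝 q₀,
      q.2 ∈ (trivializationAt ℂ (TangentSpace 𝓘(ℂ) (M := OnePoint ℂ)) q₀.2).baseSet :=
    continuousAt_snd.eventually ((trivializationAt ℂ (TangentSpace 𝓘(ℂ) (M := OnePoint ℂ))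
      q₀.2).open_baseSet.mem_nhds (FiberBundle.mem_baseSet_trivializationAt' q₀.2))
  have key : ∀ q, C.point q ∈ e.baseSet →
      q.2 ∈ (trivializationAt ℂ (TangentSpace 𝓘(ℂ) (M := OnePoint ℂ)) q₀.2).baseSet →
      t q ≠ 0 ∧ ∀ w : TangentSpace 𝓘(ℂ, EZ) (C.mu (C.sec q.1 q.2)),
        w ∈ C.curveTangent (C.sec q.1 q.2) ↔ ∃ c : ℂ, e.linearMapAt ℂ (C.point q) w = c • t q := by
    intro q hq hq2
    set e' := trivializationAt ℂ (TangentSpace 𝓘(ℂ) (M := OnePoint ℂ)) q₀.2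
    let A : ℂ →L[ℂ] EZ := mfderiv 𝓘(ℂ) 𝓘(ℂ, EZ) (fun ξ => C.point (q.1, ξ)) q.2
    let L : EZ ≃L[ℂ] EZ := e.continuousLinearEquivAt ℂ (C.point q) hq
    let L' : ℂ ≃L[ℂ] ℂ := e'.continuousLinearEquivAt ℂ q.2 hq2
    have h1 : t q = L (A (L'.symm 1)) :=
      DFunLike.congr_fun (ContinuousLinearMap.inCoordinates_eq (F := ℂ) (F' := EZ)
        (x₀ := q₀.2) (y₀ := C.point q₀) (ϕ := mfderiv 𝓘(ℂ) 𝓘(ℂ, EZ)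
        (fun ξ => C.point (q.1, ξ)) q.2) hq2 hq) (1 : ℂ)
    have hA : ∀ c, A c = 0 → c = 0 := C.mfderiv_point_right_injective hproj q.1 q.2
    have hL' : L'.symm 1 ≠ 0 := by simp
    have hc : ∀ c : ℂ, A c = (c * (L'.symm 1)⁻¹) • A (L'.symm 1) := fun c => by
      rw [← map_smul, smul_eq_mul, mul_assoc, inv_mul_cancel₀ hL', mul_one]
    have hLw : ∀ w : EZ, e.linearMapAt ℂ (C.point q) w = L w := fun w => by
      simp only [L, Bundle.Trivialization.coe_linearMapAt_of_mem e hq]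
      rfl
    refine ⟨fun h => ?_, fun w => ?_⟩
    · rw [h1] at h
      exact hL' (hA _ (L.map_eq_zero_iff.1 h))
    · refine (C.mem_curveTangent_iff hproj q.1 q.2 w).trans ?_
      rw [hLw w, h1]
      constructor
      · rintro ⟨c, hw⟩
        exact ⟨c * (L'.symm 1)⁻¹, by rw [← map_smul, ← hc]; exact congrArg L hw⟩
      · rintro ⟨c, hw⟩
        refine ⟨c * L'.symm 1, ?_⟩
        rw [← map_smul, ← map_smul, smul_eq_mul] at hw
        exact L.injective hw
  obtain ⟨a, P, R, ha, hP, hPR, haR, hv⟩ := exists_complement_of_ne_zero hdim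
    (key q₀ ebase.self_of_nhds pbase.self_of_nhds).1
  refine ⟨fun q => P - ContinuousLinearMap.smulRight a ((a (t q))⁻¹ • P (t q)), R, ?_⟩
  have ht2 := (contMDiffAt_iff_contMDiffAt_nhds (by simp)).1 ht1
  have ht3 : ∀ᶠ q in 𝓝 q₀, a (t q) ≠ 0 :=
    (a.continuous.continuousAt.comp ht1.continuousAt).eventually_ne (by simp [ha])
  filter_upwards [ht2, ht3, ebase, pbase] with q h2 h3 h4 h5
  refine ⟨?_, h4, fun c => by simp [hPR, haR], fun w => ?_⟩
  · have hat : ContMDiffAt (𝓘(ℂ, EM).prod 𝓘(ℂ)) 𝓘(ℂ) ω (fun q => (a (t q))⁻¹) q :=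
      (a.contMDiff.contMDiffAt.comp q h2).inv₀ h3
    have hPt : ContMDiffAt (𝓘(ℂ, EM).prod 𝓘(ℂ)) 𝓘(ℂ, Fin k → ℂ) ω
        (fun q => (a (t q))⁻¹ • P (t q)) q := hat.smul (P.contMDiff.contMDiffAt.comp q h2)
    exact contMDiffAt_const.sub
      ((ContinuousLinearMap.smulRightL ℂ EZ (Fin k → ℂ) a).contMDiff.contMDiffAt.comp q hPt)
  · rw [(key q h4 h5).2 w]
    exact exists_eq_smul_iff hv h3 _

/-- Passage of `Λ q` to the quotient. The last clause is what lets a section given in coordinates be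
lifted to `TZ`, as the definition of holomorphy demands. -/
theorem exists_normalCoord (hdim : Module.finrank ℂ EZ = k + 1)
    (hproj : ContMDiff 𝓘(ℂ, EZ) 𝓘(ℂ) ω proj) (q₀ : M × OnePoint ℂ) :
    ∃ (Λ : M × OnePoint ℂ → EZ →L[ℂ] (Fin k → ℂ)) (R : (Fin k → ℂ) →L[ℂ] EZ)
      (Θ : ∀ q : M × OnePoint ℂ, C.Normal q.1 q.2 →ₗ[ℂ] (Fin k → ℂ)),
      ∀ᶠ q in 𝓝 q₀,
        ContMDiffAt (𝓘(ℂ, EM).prod 𝓘(ℂ)) 𝓘(ℂ, EZ →L[ℂ] (Fin k → ℂ)) ω Λ q ∧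
        C.point q ∈ (trivializationAt EZ (TangentSpace 𝓘(ℂ, EZ)) (C.point q₀)).baseSet ∧
        Bijective (Θ q) ∧
        (∀ w : TangentSpace 𝓘(ℂ, EZ) (C.mu (C.sec q.1 q.2)), Θ q (Submodule.Quotient.mk w) =
          Λ q (trivializationAt EZ (TangentSpace 𝓘(ℂ, EZ)) (C.point q₀) ⟨C.point q, w⟩).2) ∧
        ∀ c, Θ q (Submodule.Quotient.mk ((trivializationAt EZ (TangentSpace 𝓘(ℂ, EZ))
          (C.point q₀)).symm (C.point q) (R c))) = c := by
  classical
  obtain ⟨Λ, R, h⟩ := C.exists_normal_chart hdim hproj q₀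
  set e := trivializationAt EZ (TangentSpace 𝓘(ℂ, EZ)) (C.point q₀)
  let A : ∀ q : M × OnePoint ℂ, TangentSpace 𝓘(ℂ, EZ) (C.mu (C.sec q.1 q.2)) →ₗ[ℂ] (Fin k → ℂ) :=
    fun q => (Λ q).toLinearMap ∘ₗ e.linearMapAt ℂ (C.point q)
  -- The value `0` is a default for points far from `q₀`, where `Λ q` need not kill the tangent of
  -- the curve.
  refine ⟨Λ, R, fun q => if hq : C.curveTangent (C.sec q.1 q.2) ≤ LinearMap.ker (A q) then
    (C.curveTangent (C.sec q.1 q.2)).liftQ (A q) hq else 0, ?_⟩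
  filter_upwards [h] with q ⟨h1, h2, h3, h4⟩
  have hk : C.curveTangent (C.sec q.1 q.2) = LinearMap.ker (A q) := by
    ext w; exact h4 w
  have h5 : ∀ w : TangentSpace 𝓘(ℂ, EZ) (C.mu (C.sec q.1 q.2)),
      A q w = Λ q (e ⟨C.point q, w⟩).2 := fun w => by
    have := congrFun (e.coe_linearMapAt_of_mem (R := ℂ) h2) w
    exact congrArg (Λ q) this
  have h6 : ∀ c : Fin k → ℂ, A q (e.symm (C.point q) (R c)) = c := fun c => by
    refine (h5 _).trans ?_
    have := e.apply_mk_symm h2 (R c)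
    exact (congrArg (fun y => Λ q y.2) this).trans (h3 c)
  simp only [hk.le, dite_true]
  refine ⟨h1, h2, ⟨?_, fun c => ⟨Submodule.Quotient.mk (e.symm (C.point q) (R c)), h6 c⟩⟩,
    h5, h6⟩
  rw [← LinearMap.ker_eq_bot, Submodule.ker_liftQ_eq_bot _ _ _ hk.ge]

/-- A local trivialisation of `N_x`, in terms of which holomorphic sections are given by
holomorphic functions. -/
theorem exists_localTriv (hdim : Module.finrank ℂ EZ = k + 1)
    (hproj : ContMDiff 𝓘(ℂ, EZ) 𝓘(ℂ) ω proj) (x : M) (ζ₀ : OnePoint ℂ) :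
    ∃ Θ : ∀ ζ, C.Normal x ζ →ₗ[ℂ] (Fin k → ℂ), ∀ᶠ ζ in 𝓝 ζ₀, Bijective (Θ ζ) ∧
      ∀ s : ∀ ζ, C.Normal x ζ, C.IsHolomorphicSection x {ζ} s ↔
        ContMDiffAt 𝓘(ℂ) 𝓘(ℂ, Fin k → ℂ) ω (fun ξ => Θ ξ (s ξ)) ζ := by
  obtain ⟨Λ, R, Θ, h⟩ := C.exists_normalCoord hdim hproj (x, ζ₀)
  have hc : Continuous fun ζ : OnePoint ℂ => (x, ζ) := by fun_prop
  have hm : ContMDiff 𝓘(ℂ) (𝓘(ℂ, EM).prod 𝓘(ℂ)) ω fun ζ : OnePoint ℂ => (x, ζ) :=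
    contMDiff_const.prodMk contMDiff_id
  have h' := (hc.continuousAt (x := ζ₀)).eventually h
  set e := trivializationAt EZ (TangentSpace 𝓘(ℂ, EZ)) (C.point (x, ζ₀))
  refine ⟨fun ζ => Θ (x, ζ), ?_⟩
  filter_upwards [h'.eventually_nhds] with ζ hζ
  obtain ⟨h1, h2, h3, h4, h5⟩ := hζ.self_of_nhds
  refine ⟨h3, fun s => ⟨fun hs => ?_, fun hs => ?_⟩⟩
  · obtain ⟨W, hW, τ, hτ, hτs⟩ := hs ζ rfl
    have hτ' := hτ.contMDiffAt hW
    have h6 := ((e.contMDiffAt_iff (IB := 𝓘(ℂ, EZ)) (e.mem_source.2 h2)).1 hτ').2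
    refine ((h1.comp ζ (hm ζ)).clm_apply h6).congr_of_eventuallyEq ?_
    filter_upwards [hW, hζ] with ξ hξ1 hξ2
    rw [← hτs ξ hξ1]
    exact hξ2.2.2.2.1 _
  · intro ζ' hζ'
    rw [mem_singleton_iff.1 hζ']
    -- The lift lies in the fixed complement, and is holomorphic because its coordinates are.
    let τ : ∀ ξ, TangentSpace 𝓘(ℂ, EZ) (C.mu (C.sec x ξ)) := fun ξ =>
      e.symm (C.point (x, ξ)) (R (Θ (x, ξ) (s ξ)))
    have hτ : ContMDiffAt 𝓘(ℂ) 𝓘(ℂ, EZ).tangent ω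
        (fun ξ => (⟨C.mu (C.sec x ξ), τ ξ⟩ : TangentBundle 𝓘(ℂ, EZ) Z)) ζ := by
      refine (e.contMDiffAt_iff (IB := 𝓘(ℂ, EZ)) (e.mem_source.2 h2)).2
        ⟨((C.contMDiff_point hproj).comp hm) ζ, ?_⟩
      refine (R.contMDiff.contMDiffAt.comp ζ hs).congr_of_eventuallyEq ?_
      filter_upwards [hζ] with ξ hξ
      exact congrArg Prod.snd (e.apply_mk_symm hξ.2.1 (R (Θ (x, ξ) (s ξ))))
    have hZ : IsManifold 𝓘(ℂ, EZ).tangent ω (TangentBundle 𝓘(ℂ, EZ) Z) := inferInstance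
    obtain ⟨u, hu, hu'⟩ := (contMDiffAt_iff_contMDiffOn_nhds (by simp)).1 hτ
    refine ⟨u ∩ {ξ | Bijective (Θ (x, ξ)) ∧ ∀ c, Θ (x, ξ) (Submodule.Quotient.mk
      (e.symm (C.point (x, ξ)) (R c))) = c}, Filter.inter_mem hu ?_, τ,
      hu'.mono inter_subset_left, ?_⟩
    · filter_upwards [hζ] with ξ hξ using ⟨hξ.2.2.1, hξ.2.2.2.2⟩
    · rintro ξ ⟨-, hξ1, hξ2⟩
      exact hξ1.1 (hξ2 _)

/-- Coordinates on the fibres of the normal bundles at a fixed point of `ℙ¹`, in which the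
components of holomorphic families of sections depend holomorphically on the curve. -/
theorem exists_coord_family (hdim : Module.finrank ℂ EZ = k + 1)
    (hproj : ContMDiff 𝓘(ℂ, EZ) 𝓘(ℂ) ω proj) (x : M) (ζ : OnePoint ℂ) :
    ∃ Θ : ∀ y, C.Normal y ζ →ₗ[ℂ] (Fin k → ℂ), (∀ᶠ y in 𝓝 x, Bijective (Θ y)) ∧
      (∀ s : ∀ y ζ, C.Normal y ζ, C.IsHolomorphicSectionFamily {(x, ζ)} s →
        ContMDiffAt 𝓘(ℂ, EM) 𝓘(ℂ, Fin k → ℂ) ω (fun y => Θ y (s y ζ)) x) ∧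
      ∀ X : ∀ y : M, TangentSpace 𝓘(ℂ, EM) y, ContMDiffAt 𝓘(ℂ, EM) 𝓘(ℂ, EM).tangent ω
        (fun y => (⟨y, X y⟩ : TangentBundle 𝓘(ℂ, EM) M)) x →
        ContMDiffAt 𝓘(ℂ, EM) 𝓘(ℂ, Fin k → ℂ) ω (fun y => Θ y (C.kodaira y (X y) ζ)) x := by
  obtain ⟨Λ, R, Θ, h⟩ := C.exists_normalCoord hdim hproj (x, ζ)
  have hm : ContMDiff 𝓘(ℂ, EM) (𝓘(ℂ, EM).prod 𝓘(ℂ)) ω fun y : M => (y, ζ) :=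
    contMDiff_id.prodMk contMDiff_const
  have h' := (hm.continuous.continuousAt (x := x)).eventually h
  set e := trivializationAt EZ (TangentSpace 𝓘(ℂ, EZ)) (C.point (x, ζ))
  obtain ⟨h1, h2, h3, h4, h5⟩ := h'.self_of_nhds
  refine ⟨fun y => Θ (y, ζ), h'.mono fun y hy => hy.2.2.1, fun s hs => ?_, fun X hX => ?_⟩
  · obtain ⟨W, hW, τ, hτ, hτs⟩ := hs (x, ζ) rfl
    have hτ' := (hτ.contMDiffAt hW).comp x (hm x)
    have h6 := ((e.contMDiffAt_iff (IB := 𝓘(ℂ, EZ)) (e.mem_source.2 h2)).1 hτ').2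
    refine ((h1.comp x (hm x)).clm_apply h6).congr_of_eventuallyEq ?_
    filter_upwards [hm.continuous.continuousAt.eventually hW, h'] with y hy1 hy2
    rw [← hτs (y, ζ) hy1]
    exact hy2.2.2.2.1 _
  · have h6 : ContMDiff 𝓘(ℂ, EM).tangent 𝓘(ℂ, EZ).tangent ω
        (tangentMap 𝓘(ℂ, EM) 𝓘(ℂ, EZ) fun y => C.point (y, ζ)) :=
      ((C.contMDiff_point hproj).comp hm).contMDiff_tangentMap (m := ω) (by simp)
    have h7 := (h6 _).comp x hX
    have h8 := ((e.contMDiffAt_iff (IB := 𝓘(ℂ, EZ)) (e.mem_source.2 h2)).1 h7).2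
    refine ((h1.comp x (hm x)).clm_apply h8).congr_of_eventuallyEq ?_
    filter_upwards [h'] with y hy2
    exact (congrArg (Θ (y, ζ)) (C.kodaira_eq hproj y (X y) ζ)).trans (hy2.2.2.2.1 _)

end RationalCurveFamily

end NormalBundle

/-! ### The Cauchy transform and the Cauchy-Pompeiu formula -/

section CauchyTransform

open MeasureTheory Complex

variable {E : Type*} [NormedAddCommGroup E] [NormedSpace ℂ E]

/-- The Wirtinger derivative `∂f/∂z̄`. -/
noncomputable def dbar (f : ℂ → E) (z : ℂ) : E :=
  (2 : ℂ)⁻¹ • (fderiv ℝ f z 1 + I • fderiv ℝ f z I)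

/-- The Cauchy transform, a right inverse of `∂/∂z̄`. -/
noncomputable def cauchyTransform (f : ℂ → E) (z : ℂ) : E :=
  (Real.pi : ℂ)⁻¹ • ∫ w, (z - w)⁻¹ • f w

/-- In polar coordinates the factor `r` of the area element cancels `1 / r`. -/
theorem locallyIntegrable_inv : LocallyIntegrable (fun w : ℂ => w⁻¹) := by
  have h : ∀ R : ℝ, IntegrableOn (fun w : ℂ => w⁻¹) (Metric.ball 0 R) := by
    intro R
    have h1 : Integrable (fun w : ℂ => (Iio R).indicator (fun y : ℝ => y⁻¹) ‖w‖) := by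
      rw [integrable_fun_norm_addHaar volume (f := (Iio R).indicator (fun y : ℝ => y⁻¹))]
      have h2 : IntegrableOn (fun _ : ℝ => (1 : ℝ)) (Ioo 0 R) := by
        simp
      have h3 : IntegrableOn ((Iio R).indicator fun _ : ℝ => (1 : ℝ)) (Ioi 0) := by
        rw [integrableOn_indicator_iff measurableSet_Iio, inter_comm]
        exact h2
      refine h3.congr_fun ?_ measurableSet_Ioi
      intro y hy
      have hy' : y ≠ 0 := (ne_of_gt hy)
      by_cases hR : y < R <;> simp [hR, hy']
    have h2 : Integrable ((Metric.ball (0 : ℂ) R).indicator fun w : ℂ => w⁻¹) := by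
      refine h1.mono' ?_ (Filter.Eventually.of_forall fun w => ?_)
      · exact (measurable_inv.indicator measurableSet_ball).aestronglyMeasurable
      · by_cases hw : ‖w‖ < R
        · rw [indicator_of_mem (by simpa using hw), indicator_of_mem (by simpa using hw)]
          simp
        · rw [indicator_of_notMem (by simpa using hw), indicator_of_notMem (by simpa using hw)]
          simp
    rwa [integrable_indicator_iff measurableSet_ball] at h2
  intro z
  exact ⟨Metric.ball 0 (‖z‖ + 1), Metric.isOpen_ball.mem_nhds (by simp), h _⟩

/-- As a convolution, the transform can be differentiated by letting the derivative fall on `f`,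
away from the singular kernel. -/
theorem cauchyTransform_eq_convolution (f : ℂ → E) :
    cauchyTransform f = fun z => (Real.pi : ℂ)⁻¹ •
      convolution (fun w : ℂ => w⁻¹) f (ContinuousLinearMap.lsmul ℝ ℂ) volume z := by
  ext z
  rw [cauchyTransform, convolution_eq_swap]
  rfl

theorem contDiff_cauchyTransform [CompleteSpace E] {f : ℂ → E} (hf : ContDiff ℝ 1 f)
    (hs : HasCompactSupport f) : ContDiff ℝ 1 (cauchyTransform f) := by
  rw [cauchyTransform_eq_convolution]
  exact (hs.contDiff_convolution_right (n := 1) (ContinuousLinearMap.lsmul ℝ ℂ)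
    locallyIntegrable_inv hf).const_smul _

theorem fderiv_cauchyTransform [CompleteSpace E] {f : ℂ → E} (hf : ContDiff ℝ 1 f)
    (hs : HasCompactSupport f) (z v : ℂ) :
    fderiv ℝ (cauchyTransform f) z v = (Real.pi : ℂ)⁻¹ • ∫ w, w⁻¹ • fderiv ℝ f (z - w) v := by
  rw [cauchyTransform_eq_convolution]
  have h := (hs.hasFDerivAt_convolution_right (ContinuousLinearMap.lsmul ℝ ℂ)
    locallyIntegrable_inv hf z).const_smul (Real.pi : ℂ)⁻¹
  erw [h.fderiv]
  rw [ContinuousLinearMap.smul_apply, convolution, ContinuousLinearMap.integral_apply]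
  · rfl
  · exact ((hs.fderiv ℝ).convolutionExists_right _ locallyIntegrable_inv
      (hf.continuous_fderiv (by simp))) z

/-- The values at a point of a function with compact support are given by integrals of its
derivative in polar coordinates (the Cauchy-Pompeiu formula). -/
theorem integral_inv_smul_dbar [CompleteSpace E] {f : ℂ → E} (hf : ContDiff ℝ 1 f)
    (hs : HasCompactSupport f) (z : ℂ) :
    ∫ w, w⁻¹ • (fderiv ℝ f (z - w) 1 + I • fderiv ℝ f (z - w) I) = (2 * Real.pi : ℂ) • f z := by
  set e : ℝ → ℂ := fun θ => (Real.cos θ : ℂ) + Real.sin θ * I with he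
  have hec : Continuous e := by fun_prop
  have hen : ∀ θ, ‖e θ‖ = 1 := fun θ => by
    have : e θ = Complex.exp (θ * I) := by simp [he, Complex.exp_mul_I]
    rw [this, Complex.norm_exp_ofReal_mul_I]
  have hed : ∀ θ, HasDerivAt e (I * e θ) θ := fun θ => by
    have h1 := ((Real.hasDerivAt_cos θ).ofReal_comp).add
      (((Real.hasDerivAt_sin θ).ofReal_comp).mul_const I)
    refine h1.congr_deriv ?_
    simp only [he, mul_add, Complex.ofReal_neg]
    linear_combination -(Real.sin θ : ℂ) * I_mul_I
  have hepi : e Real.pi = e (-Real.pi) := by simp [he]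
  -- `h₁` and `h₂` are the derivatives of `f` in the radial and in the angular direction at `z - r
  -- e^{iθ}`.
  set h₁ : ℝ × ℝ → E := fun p => fderiv ℝ f (z - p.1 * e p.2) (e p.2) with hh₁
  set h₂ : ℝ × ℝ → E := fun p => fderiv ℝ f (z - p.1 * e p.2) (I * e p.2) with hh₂
  have hDc := hf.continuous_fderiv (by simp)
  have hc₁ : Continuous h₁ := by
    refine (hDc.comp ?_).clm_apply ?_ <;> fun_prop
  have hc₂ : Continuous h₂ := by
    refine (hDc.comp ?_).clm_apply ?_ <;> fun_prop
  obtain ⟨R, hR⟩ : ∃ R : ℝ, ∀ w, R < ‖w‖ → f w = 0 ∧ fderiv ℝ f w = 0 := by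
    obtain ⟨R, hR⟩ := hs.isCompact.isBounded.exists_norm_le
    refine ⟨R, fun w hw => ?_⟩
    have : w ∉ tsupport f := fun h => absurd (hR w h) (not_le.2 hw)
    exact ⟨image_eq_zero_of_notMem_tsupport this,
      image_eq_zero_of_notMem_tsupport fun h => this (tsupport_fderiv_subset ℝ h)⟩
  have hbig : ∀ r θ : ℝ, R + ‖z‖ < |r| → R < ‖z - r * e θ‖ := fun r θ hr => by
    have h1 : ‖(r : ℂ) * e θ‖ = |r| := by rw [norm_mul, hen, mul_one, Complex.norm_real,
      Real.norm_eq_abs]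
    have h2 := norm_sub_norm_le ((r : ℂ) * e θ) z
    rw [norm_sub_rev] at h2
    linarith
  have hint : ∀ h : ℝ × ℝ → E, Continuous h → (∀ r θ, R + ‖z‖ < |r| → h (r, θ) = 0) →
      IntegrableOn h (Ioi 0 ×ˢ Ioo (-Real.pi) Real.pi) := fun h hc h0 => by
    have h1 : IntegrableOn h (Icc (-(R + ‖z‖)) (R + ‖z‖) ×ˢ Icc (-Real.pi) Real.pi) :=
      hc.continuousOn.integrableOn_compact (isCompact_Icc.prod isCompact_Icc)
    refine h1.of_forall_diff_eq_zero (measurableSet_Ioi.prod measurableSet_Ioo) ?_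
    rintro ⟨r, θ⟩ ⟨⟨-, hθ⟩, hp⟩
    apply h0
    by_contra hr
    exact hp ⟨abs_le.1 (not_lt.1 hr), Ioo_subset_Icc_self hθ⟩
  have hi₁ := hint h₁ hc₁ fun r θ hr => by simp [hh₁, (hR _ (hbig r θ hr)).2]
  have hi₂ := hint h₂ hc₂ fun r θ hr => by simp [hh₂, (hR _ (hbig r θ hr)).2]
  -- With `w = r e^{iθ}` and `D` the derivative, `e^{-iθ} (D 1 + i D i) = D e^{iθ} + i D (i
  -- e^{iθ})`. The factor `r` of the area element cancels the remaining `1 / r`.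
  have key : ∀ p ∈ Ioi (0 : ℝ) ×ˢ Ioo (-Real.pi) Real.pi,
      p.1 • ((Complex.polarCoord.symm p)⁻¹ • (fderiv ℝ f (z - Complex.polarCoord.symm p) 1 +
        I • fderiv ℝ f (z - Complex.polarCoord.symm p) I)) = h₁ p + I • h₂ p := by
    rintro ⟨r, θ⟩ ⟨hr, -⟩
    have hr0 : (r : ℂ) ≠ 0 := by exact_mod_cast (ne_of_gt hr)
    simp only [Complex.polarCoord_symm_apply, hh₁, hh₂]
    change r • (((r : ℂ) * e θ)⁻¹ • (fderiv ℝ f (z - r * e θ) 1 +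
      I • fderiv ℝ f (z - r * e θ) I)) = _
    set D := fderiv ℝ f (z - r * e θ)
    have e1 : e θ = Real.cos θ • (1 : ℂ) + Real.sin θ • I := by simp [he]
    have e2 : I * e θ = Real.cos θ • I + (-Real.sin θ) • (1 : ℂ) := by
      simp only [he, Complex.real_smul, mul_add, Complex.ofReal_neg]
      linear_combination (Real.sin θ : ℂ) * I_mul_I
    have e3 : (e θ)⁻¹ = (Real.cos θ : ℂ) - Real.sin θ * I := by
      rw [inv_eq_iff_eq_inv, eq_comm]
      refine inv_eq_of_mul_eq_one_left ?_
      have := Real.sin_sq_add_cos_sq θ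
      have h3 : (Real.sin θ : ℂ) ^ 2 + (Real.cos θ : ℂ) ^ 2 = 1 := by exact_mod_cast this
      simp only [he]
      linear_combination h3 - (Real.sin θ : ℂ) ^ 2 * I_mul_I
    have e4 : D (e θ) = Real.cos θ • D 1 + Real.sin θ • D I := by
      rw [e1, map_add, map_smul, map_smul]
    have e5 : D (I * e θ) = Real.cos θ • D I + (-Real.sin θ) • D 1 := by
      rw [e2, map_add, map_smul, map_smul]
    rw [e4, e5, mul_inv, e3]
    simp only [← Complex.coe_smul, smul_add, smul_smul]
    have h4 : (r : ℂ) * ((r : ℂ)⁻¹ * ((Real.cos θ : ℂ) - Real.sin θ * I)) =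
      (Real.cos θ : ℂ) - Real.sin θ * I := by field_simp
    have h5 : (r : ℂ) * ((r : ℂ)⁻¹ * ((Real.cos θ : ℂ) - Real.sin θ * I) * I) =
      (Real.sin θ : ℂ) + Real.cos θ * I := by
        field_simp
        linear_combination -(Real.sin θ : ℂ) * I_mul_I
    rw [h4, h5]
    push_cast
    module
  -- On each ray the radial part integrates to the boundary value `f z`, since `f` has compact
  -- support.
  have hrad : ∀ θ : ℝ, ∫ r in Ioi (0 : ℝ), h₁ (r, θ) = f z := fun θ => by
    have h1 : ∀ r ∈ Ici (0 : ℝ), HasDerivAt (fun r : ℝ => -f (z - r * e θ)) (h₁ (r, θ)) r := by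
      intro r _
      have h2 : HasDerivAt (fun r : ℝ => z - (r : ℂ) * e θ) (-e θ) r := by
        have := (((hasDerivAt_id r).ofReal_comp).mul_const (e θ)).const_sub z
        simpa using this
      have h3 := ((hf.differentiable (by simp)).differentiableAt.hasFDerivAt
        (x := z - r * e θ)).comp_hasDerivAt r h2
      simp only [map_neg] at h3
      refine h3.neg.congr_deriv (neg_neg _)
    have h4 : IntegrableOn (fun r => h₁ (r, θ)) (Ioi 0) := by
      have h5 : IntegrableOn (fun r => h₁ (r, θ)) (Icc (-(R + ‖z‖)) (R + ‖z‖)) :=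
        (hc₁.comp (by fun_prop : Continuous fun r : ℝ => (r, θ))).continuousOn.integrableOn_compact
          isCompact_Icc
      refine h5.of_forall_diff_eq_zero measurableSet_Ioi ?_
      rintro r ⟨-, hr⟩
      have : R + ‖z‖ < |r| := by
        by_contra hr'
        exact hr (abs_le.1 (not_lt.1 hr'))
      simp [hh₁, (hR _ (hbig r θ this)).2]
    have h6 : Filter.Tendsto (fun r : ℝ => -f (z - r * e θ)) Filter.atTop (𝓝 0) := by
      refine tendsto_const_nhds.congr' ?_
      filter_upwards [Filter.eventually_gt_atTop (R + ‖z‖)] with r hr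
      rw [(hR _ (hbig r θ (hr.trans_le (le_abs_self r)))).1, neg_zero]
    rw [integral_Ioi_of_hasDerivAt_of_tendsto' h1 h4 h6]
    simp
  -- Up to the factor `-r`, the angular part is the derivative of a function on a closed circle, so
  -- it integrates to zero.
  have hang : ∀ r ∈ Ioi (0 : ℝ), ∫ θ in Ioo (-Real.pi) Real.pi, h₂ (r, θ) = 0 := fun r hr => by
    have hr0 : (r : ℂ) ≠ 0 := by exact_mod_cast (ne_of_gt hr)
    have hr1 : r ≠ 0 := ne_of_gt hr
    have h1 : ∀ θ : ℝ, HasDerivAt (fun θ : ℝ => f (z - r * e θ)) (-r • h₂ (r, θ)) θ := by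
      intro θ
      have h2 : HasDerivAt (fun θ : ℝ => z - (r : ℂ) * e θ) (-(r * (I * e θ))) θ :=
        ((hed θ).const_mul (r : ℂ)).const_sub z
      have h3 := ((hf.differentiable (by simp)).differentiableAt.hasFDerivAt
        (x := z - r * e θ)).comp_hasDerivAt θ h2
      refine h3.congr_deriv ?_
      have : -((r : ℂ) * (I * e θ)) = (-r) • (I * e θ) := by simp
      rw [this, map_smul]
    have h4 := intervalIntegral.integral_eq_sub_of_hasDerivAt (a := -Real.pi) (b := Real.pi)
      (fun θ _ => h1 θ) (by
        refine Continuous.intervalIntegrable ?_ _ _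
        exact (hc₂.comp (by fun_prop : Continuous fun θ : ℝ => (r, θ))).const_smul (-r))
    rw [hepi, sub_self, intervalIntegral.integral_of_le (by linarith [Real.pi_pos]),
      integral_Ioc_eq_integral_Ioo, integral_smul] at h4
    exact (smul_eq_zero.1 h4).resolve_left (neg_ne_zero.2 hr1)
  rw [← Complex.integral_comp_polarCoord_symm]
  have htar : polarCoord.target = Ioi (0 : ℝ) ×ˢ Ioo (-Real.pi) Real.pi := rfl
  rw [htar, setIntegral_congr_fun (measurableSet_Ioi.prod measurableSet_Ioo) key]
  have hadd := integral_add hi₁ (hi₂.smul I)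
  simp only [Pi.smul_apply, integral_smul] at hadd
  rw [hadd]
  have i₂ : ∫ p in Ioi (0 : ℝ) ×ˢ Ioo (-Real.pi) Real.pi, h₂ p = 0 := by
    rw [Measure.volume_eq_prod, setIntegral_prod _ hi₂, setIntegral_congr_fun measurableSet_Ioi hang]
    simp
  have i₁ : ∫ p in Ioi (0 : ℝ) ×ˢ Ioo (-Real.pi) Real.pi, h₁ p = (2 * Real.pi : ℂ) • f z := by
    rw [Measure.volume_eq_prod, ← Measure.prod_restrict, integral_prod_symm]
    · simp only [hrad]
      simp only [integral_const, MeasurableSet.univ, measureReal_restrict_apply, univ_inter,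
        Real.volume_real_Ioo]
      rw [max_eq_left (by linarith [Real.pi_pos]), ← Complex.coe_smul]
      push_cast
      ring_nf
    · rw [Measure.prod_restrict]; exact hi₁
  rw [i₁, i₂, smul_zero, add_zero]

theorem dbar_cauchyTransform [CompleteSpace E] {f : ℂ → E} (hf : ContDiff ℝ 1 f)
    (hs : HasCompactSupport f) (z : ℂ) : dbar (cauchyTransform f) z = f z := by
  have hi : ∀ v : ℂ, Integrable fun w => w⁻¹ • fderiv ℝ f (z - w) v := fun v => by
    have h1 : HasCompactSupport fun w => fderiv ℝ f w v := (hs.fderiv ℝ).comp_left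
      (g := fun L : ℂ →L[ℝ] E => L v) rfl
    exact h1.convolutionExists_right (ContinuousLinearMap.lsmul ℝ ℂ) locallyIntegrable_inv
      ((hf.continuous_fderiv (by simp)).clm_apply continuous_const) z
  have h2 := integral_inv_smul_dbar hf hs z
  simp only [smul_add] at h2
  rw [integral_add (hi 1)] at h2
  · have h3 : ∀ w : ℂ, w⁻¹ • I • fderiv ℝ f (z - w) I = I • w⁻¹ • fderiv ℝ f (z - w) I :=
      fun w => smul_comm _ _ _
    simp only [h3, integral_smul] at h2
    rw [dbar, fderiv_cauchyTransform hf hs, fderiv_cauchyTransform hf hs, smul_comm I, ← smul_add,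
      h2, smul_smul, smul_smul]
    have : (Real.pi : ℂ) ≠ 0 := by exact_mod_cast Real.pi_ne_zero
    rw [show (2 : ℂ)⁻¹ * (Real.pi : ℂ)⁻¹ * (2 * Real.pi) = 1 by field_simp, one_smul]
  · have h3 : ∀ w : ℂ, w⁻¹ • I • fderiv ℝ f (z - w) I = I • w⁻¹ • fderiv ℝ f (z - w) I :=
      fun w => smul_comm _ _ _
    simp only [h3]
    exact (hi I).smul I

end CauchyTransform

/-! ### Calculus of `∂/∂z̄` and rational approximation of the Cauchy kernel -/

section IntegralEquation

open MeasureTheory Complex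

variable {E : Type*} [NormedAddCommGroup E] [NormedSpace ℂ E]

theorem dbar_congr {f g : ℂ → E} {z : ℂ} (h : f =ᶠ[𝓝 z] g) : dbar f z = dbar g z := by
  rw [dbar, dbar, h.fderiv_eq]

theorem dbar_eq_zero {f : ℂ → E} {z : ℂ} (hf : DifferentiableAt ℂ f z) : dbar f z = 0 := by
  have h := (differentiableAt_complex_iff_differentiableAt_real.1 hf).2
  rw [dbar, h, smul_smul, I_mul_I, neg_one_smul, add_neg_cancel, smul_zero]

theorem differentiableAt_of_dbar_eq_zero {f : ℂ → E} {z : ℂ} (hf : DifferentiableAt ℝ f z)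
    (h : dbar f z = 0) : DifferentiableAt ℂ f z := by
  refine differentiableAt_complex_iff_differentiableAt_real.2 ⟨hf, ?_⟩
  rw [dbar, smul_eq_zero] at h
  have h1 := congrArg (fun v => I • v) (h.resolve_left (by norm_num))
  simp only [smul_add, smul_smul, I_mul_I, neg_one_smul, smul_zero] at h1
  rw [add_neg_eq_zero] at h1
  exact h1.symm

theorem dbar_sub {f g : ℂ → E} {z : ℂ} (hf : DifferentiableAt ℝ f z)
    (hg : DifferentiableAt ℝ g z) : dbar (fun z => f z - g z) z = dbar f z - dbar g z := by
  rw [dbar, dbar, dbar, fderiv_fun_sub hf hg]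
  simp only [ContinuousLinearMap.sub_apply]
  module

theorem dbar_sum {ι : Type*} {s : Finset ι} {f : ι → ℂ → E} {z : ℂ}
    (hf : ∀ i ∈ s, DifferentiableAt ℝ (f i) z) :
    dbar (fun z => ∑ i ∈ s, f i z) z = ∑ i ∈ s, dbar (f i) z := by
  simp only [dbar]
  rw [fderiv_fun_sum hf]
  simp only [ContinuousLinearMap.sum_apply, Finset.smul_sum, ← Finset.sum_add_distrib]

theorem dbar_smul {φ : ℂ → ℂ} {f : ℂ → E} {z : ℂ} (hφ : DifferentiableAt ℝ φ z)
    (hf : DifferentiableAt ℝ f z) :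
    dbar (fun z => φ z • f z) z = dbar φ z • f z + φ z • dbar f z := by
  simp only [dbar]
  rw [fderiv_fun_smul hφ hf]
  simp only [ContinuousLinearMap.add_apply, ContinuousLinearMap.smul_apply,
    ContinuousLinearMap.smulRight_apply, smul_eq_mul]
  module

theorem dbar_clm_apply {E' : Type*} [NormedAddCommGroup E'] [NormedSpace ℂ E']
    {G : ℂ → E →L[ℂ] E'} {f : ℂ → E} {z : ℂ} (hG : DifferentiableAt ℂ G z)
    (hf : DifferentiableAt ℝ f z) : DifferentiableAt ℝ (fun z => G z (f z)) z ∧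
    dbar (fun z => G z (f z)) z = G z (dbar f z) := by
  let B : (E →L[ℂ] E') →L[ℝ] E →L[ℝ] E' :=
    (ContinuousLinearMap.restrictScalarsL ℂ E E' ℝ ℝ)
  have h1 : HasFDerivAt (fun z => B (G z)) (B ∘L (fderiv ℂ G z).restrictScalars ℝ) z :=
    B.hasFDerivAt.comp z (hG.hasFDerivAt.restrictScalars ℝ)
  have h2 := h1.clm_apply hf.hasFDerivAt
  have h3 : (fun z => B (G z) (f z)) = fun z => G z (f z) := rfl
  rw [h3] at h2
  refine ⟨h2.differentiableAt, ?_⟩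
  rw [dbar, h2.fderiv, dbar]
  simp only [ContinuousLinearMap.add_apply, ContinuousLinearMap.comp_apply,
    ContinuousLinearMap.flip_apply, map_smul, map_add]
  have h4 : fderiv ℂ G z I = I • fderiv ℂ G z 1 := by
    rw [← map_smul, smul_eq_mul, mul_one]
  have h5 : (B ((fderiv ℂ G z).restrictScalars ℝ I)) (f z) =
      I • (B ((fderiv ℂ G z).restrictScalars ℝ 1)) (f z) := by
    change fderiv ℂ G z I (f z) = I • fderiv ℂ G z 1 (f z)
    rw [h4]; rfl
  rw [h5]
  have h6 : ∀ v, B (G z) v = G z v := fun _ => rfl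
  simp only [h6]
  have h7 : ∀ v : E', I • I • v = -v := fun v => by
    rw [smul_smul, I_mul_I, neg_one_smul]
  simp only [smul_add, h7]
  module

variable [CompleteSpace E]

theorem differentiableAt_setIntegral_inv_smul {S : Set ℂ} (hS : IsCompact S) {a : ℂ → E}
    (ha : Continuous a) {z : ℂ} (hz : z ∉ S) :
    DifferentiableAt ℂ (fun z => ∫ w in S, (z - w)⁻¹ • a w) z := by
  obtain ⟨d, hd, hdS⟩ : ∃ d > 0, ∀ w ∈ S, ∀ z' ∈ Metric.ball z d, d ≤ ‖z' - w‖ := by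
    obtain ⟨d, hd, h⟩ := Metric.isOpen_iff.1 hS.isClosed.isOpen_compl z hz
    refine ⟨d / 2, by linarith, fun w hw z' hz' => ?_⟩
    by_contra hlt
    refine h (a := w) ?_ hw
    rw [Metric.mem_ball, dist_eq_norm] at *
    calc ‖w - z‖ = ‖-(z' - w) + (z' - z)‖ := by congr 1; ring
      _ ≤ ‖z' - w‖ + ‖z' - z‖ := (norm_add_le _ _).trans_eq (by rw [norm_neg])
      _ < d := by linarith [not_le.1 hlt]
  have hmeas : ∀ (f : ℂ → ℂ), Measurable f → AEStronglyMeasurable (fun w => f w • a w)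
      (volume.restrict S) := fun f hf =>
    (hf.aestronglyMeasurable).smul ha.aestronglyMeasurable
  have hai : IntegrableOn (fun w => ‖a w‖) S := ha.norm.continuousOn.integrableOn_compact hS
  have hbd : ∀ᵐ w ∂(volume.restrict S), ∀ z' ∈ Metric.ball z d,
      ‖(-((z' - w) ^ 2)⁻¹) • a w‖ ≤ (d ^ 2)⁻¹ * ‖a w‖ := by
    filter_upwards [ae_restrict_mem hS.measurableSet] with w hw z' hz'
    rw [norm_smul, norm_neg, norm_inv, norm_pow]
    gcongr
    exact hdS w hw z' hz'
  refine (hasDerivAt_integral_of_dominated_loc_of_deriv_le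
    (F' := fun z' w => (-((z' - w) ^ 2)⁻¹) • a w) (bound := fun w => (d ^ 2)⁻¹ * ‖a w‖)
    (Metric.ball_mem_nhds z hd) (Filter.Eventually.of_forall fun z' => hmeas _ (by fun_prop))
    ?_ (hmeas _ (by fun_prop)) hbd (hai.const_mul _) ?_).2.differentiableAt
  · refine (hai.const_mul d⁻¹).mono' (hmeas _ (by fun_prop)) ?_
    filter_upwards [ae_restrict_mem hS.measurableSet] with w hw
    rw [norm_smul, norm_inv]
    gcongr
    exact hdS w hw z (Metric.mem_ball_self hd)
  · filter_upwards [ae_restrict_mem hS.measurableSet] with w hw z' hz'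
    have h1 : z' - w ≠ 0 := by
      have := hdS w hw z' hz'
      exact norm_pos_iff.1 (hd.trans_le this)
    have h2 := ((hasDerivAt_id z').sub_const w).inv h1
    refine HasDerivAt.smul_const (h2.congr_deriv ?_) (a w)
    simp [neg_div]

omit [CompleteSpace E] in
-- The singularities of `u` are harmless, as `K` vanishes near them and the product is extended by
-- zero.
theorem contDiff_clm_apply_of_support {K : ℂ → E →L[ℂ] E} (hK : ContDiff ℝ 1 K) {A O : Set ℂ}
    (hA : IsClosed A) (hO : IsOpen O) (hAO : A ⊆ O) (hKA : ∀ z, z ∉ A → K z = 0) {u : ℂ → E}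
    (hu : ContDiffOn ℝ 1 u O) : ContDiff ℝ 1 (fun z => K z (u z)) := by
  let B : (E →L[ℂ] E) →L[ℝ] E →L[ℝ] E := (ContinuousLinearMap.restrictScalarsL ℂ E E ℝ ℝ)
  rw [contDiff_iff_contDiffAt]
  intro z
  by_cases hz : z ∈ A
  · have h1 : ContDiffAt ℝ 1 (fun z => B (K z)) z := B.contDiff.contDiffAt.comp z hK.contDiffAt
    exact h1.clm_apply (hu.contDiffAt (hO.mem_nhds (hAO hz)))
  · refine (contDiffAt_const (c := (0 : E))).congr_of_eventuallyEq ?_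
    filter_upwards [hA.isOpen_compl.mem_nhds hz] with y hy
    simp [hKA y hy]

/-- The Cauchy kernel can be approximated uniformly by rational functions. -/
theorem exists_simpleFunc_approx_inv {A S : Set ℂ} (hA : IsCompact A) (hS : IsCompact S)
    (hAS : Disjoint A S) {ε : ℝ} (hε : 0 < ε) :
    ∃ p : SimpleFunc ℂ ℂ, (∀ w ∈ S, p w ∉ A) ∧
      ∀ z ∈ A, ∀ w ∈ S, ‖(z - w)⁻¹ - (z - p w)⁻¹‖ ≤ ε := by
  obtain ⟨d, hd, hdAS⟩ : ∃ d > 0, ∀ z ∈ A, ∀ w ∈ S, d ≤ ‖z - w‖ := by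
    obtain ⟨r, hr, h⟩ := Metric.exists_pos_forall_lt_edist hA hS.isClosed hAS
    refine ⟨r, hr, fun z hz w hw => ?_⟩
    have := h z hz w hw
    rw [edist_eq_enorm_sub, ← ofReal_norm, ← ENNReal.ofReal_coe_nnreal] at this
    exact ((ENNReal.ofReal_lt_ofReal_iff_of_nonneg r.2).1 this).le
  -- In `(z - w)⁻¹ - (z - q)⁻¹ = (w - q) / ((z - w) (z - q))` one has `|z - w| ≥ d`. The first bound
  -- on `|w - q|` gives `|z - q| ≥ d / 2`, and the second one makes the quotient at most `ε`.
  set δ := min (d / 2) (ε * d * (d / 2)) with hδ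
  have hδ0 : 0 < δ := by positivity
  obtain ⟨t, ht⟩ := hS.elim_finite_subcover (fun n : ℕ => Metric.ball (TopologicalSpace.denseSeq ℂ n) δ)
    (fun _ => Metric.isOpen_ball) (fun w _ => by
      obtain ⟨n, hn⟩ := (TopologicalSpace.denseRange_denseSeq ℂ).exists_dist_lt w hδ0
      exact mem_iUnion.2 ⟨n, hn⟩)
  obtain ⟨N, hN⟩ := t.bddAbove
  have hp : ∀ w ∈ S, ‖w - SimpleFunc.nearestPt (TopologicalSpace.denseSeq ℂ) N w‖ < δ := by
    intro w hw
    obtain ⟨n, hn, hwn⟩ := mem_iUnion₂.1 (ht hw)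
    have h1 := SimpleFunc.edist_nearestPt_le (TopologicalSpace.denseSeq ℂ) w (hN hn)
    rw [edist_dist, edist_dist, ENNReal.ofReal_le_ofReal_iff dist_nonneg] at h1
    rw [← dist_eq_norm, dist_comm]
    exact h1.trans_lt (by rwa [Metric.mem_ball, dist_comm] at hwn)
  have hfar : ∀ z ∈ A, ∀ w ∈ S,
      d / 2 ≤ ‖z - SimpleFunc.nearestPt (TopologicalSpace.denseSeq ℂ) N w‖ := by
    intro z hz w hw
    have h1 := hdAS z hz w hw
    have h2 := (hp w hw).trans_le (min_le_left _ _)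
    have h3 := norm_sub_le_norm_sub_add_norm_sub z
      (SimpleFunc.nearestPt (TopologicalSpace.denseSeq ℂ) N w) w
    have h4 := norm_sub_rev w (SimpleFunc.nearestPt (TopologicalSpace.denseSeq ℂ) N w)
    linarith
  refine ⟨SimpleFunc.nearestPt (TopologicalSpace.denseSeq ℂ) N, fun w hw hA' => ?_,
    fun z hz w hw => ?_⟩
  · have := hfar _ hA' w hw
    simp only [sub_self, norm_zero] at this
    linarith
  · set q := SimpleFunc.nearestPt (TopologicalSpace.denseSeq ℂ) N w with hq
    have h1 := hdAS z hz w hw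
    have h2 := hfar z hz w hw
    have h3 : z - w ≠ 0 := norm_pos_iff.1 (hd.trans_le h1)
    have h4 : z - q ≠ 0 := norm_pos_iff.1 ((half_pos hd).trans_le h2)
    have h5 : (z - w)⁻¹ - (z - q)⁻¹ = (w - q) / ((z - w) * (z - q)) := by
      field_simp; ring
    rw [h5, norm_div, norm_mul, div_le_iff₀ (by positivity)]
    calc ‖w - q‖ ≤ ε * d * (d / 2) := (hp w hw).le.trans (min_le_right _ _)
      _ ≤ ε * (‖z - w‖ * ‖z - q‖) := by
        rw [mul_assoc]; gcongr

end IntegralEquation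

/-! ### Solution of the integral equation by contraction -/

section IntegralEquationSolution

open MeasureTheory Complex

variable {E : Type*} [NormedAddCommGroup E] [NormedSpace ℂ E] [CompleteSpace E]

/-- The kernel is constant in `w` on each level set of `p`, so the integral is a rational function
of `z` with simple poles in `P`. -/
theorem setIntegral_inv_simpleFunc_smul {S : Set ℂ} (hS : IsCompact S) (p : SimpleFunc ℂ ℂ)
    (P : Finset ℂ) (hP : ∀ w ∈ S, p w ∈ P) {a : ℂ → E} (ha : Continuous a) (z : ℂ) :
    ∫ w in S, (z - p w)⁻¹ • a w = ∑ q ∈ P, (z - q)⁻¹ • ∫ w in S ∩ p ⁻¹' {q}, a w := by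
  have hai : IntegrableOn a S := ha.continuousOn.integrableOn_compact hS
  have hm : ∀ q, MeasurableSet (p ⁻¹' {q}) := fun q => p.measurableSet_preimage _
  have h1 : ∫ w in S, (z - p w)⁻¹ • a w =
      ∫ w in S, ∑ q ∈ P, (p ⁻¹' {q}).indicator (fun w => (z - q)⁻¹ • a w) w := by
    refine setIntegral_congr_fun hS.measurableSet fun w hw => ?_
    rw [Finset.sum_eq_single_of_mem (p w) (hP w hw)]
    · rw [indicator_of_mem (by simp)]
    · intro q _ hq
      exact indicator_of_notMem (by simpa using hq.symm) _
  rw [h1, integral_finsetSum]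
  · refine Finset.sum_congr rfl fun q _ => ?_
    rw [setIntegral_indicator (hm q), integral_smul]
  · intro q _
    exact (hai.smul _).indicator (hm q)

/-- The operator `K` sees the Cauchy integral only on `A i`, away from `S i`. There the kernel is
uniformly close to a rational one, so that after subtraction of principal parts the remaining
operator is a contraction. The subtracted terms are the price: they replace the finite-dimensional
obstruction to solving the original equation. The poles are chosen before `b`, so that a later
choice of `b` can avoid them. -/
theorem exists_solution_integral_equation {ι : Type*} [Fintype ι] {K : ι → ι → ℂ → E →L[ℂ] E}
    (hK : ∀ j i, ContDiff ℝ 1 (K j i)) {A S : ι → Set ℂ} (hA : ∀ i, IsCompact (A i))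
    (hS : ∀ i, IsCompact (S i)) (hAS : ∀ i, Disjoint (A i) (S i))
    (hKA : ∀ j i z, z ∉ A i → K j i z = 0) :
    ∃ P : ι → Finset ℂ, (∀ i, ∀ p ∈ P i, p ∉ A i) ∧ ∀ b : ι → ℂ → E,
      (∀ j, ContDiff ℝ 1 (b j)) → (∀ j, HasCompactSupport (b j)) →
      ∃ a ρ : ι → ℂ → E, (∀ j, ContDiff ℝ 1 (a j)) ∧ ∀ j z, a j z = b j z -
        ∑ i, K j i z ((Real.pi : ℂ)⁻¹ • (∫ w in S i, (z - w)⁻¹ • a i w) -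
          ∑ p ∈ P i, (z - p)⁻¹ • ρ i p) := by
  classical
  have hbK : ∀ j i, ∃ B, ∀ z, ‖K j i z‖ ≤ B := fun j i =>
    (HasCompactSupport.intro (hA i) fun z hz => hKA j i z hz).exists_bound_of_continuous
      (hK j i).continuous
  choose B hB using hbK
  set v : ι → ℝ := fun i => volume.real (S i) with hv
  -- Chosen so that the operator has Lipschitz constant at most `1 / 2`; the summand `1` keeps the
  -- denominator positive.
  set ε : ℝ := (2 * ((∑ j, ∑ i, |B j i| * (Real.pi⁻¹ * v i)) + 1))⁻¹ with hε
  have hsum0 : 0 ≤ ∑ j, ∑ i, |B j i| * (Real.pi⁻¹ * v i) :=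
    Finset.sum_nonneg fun j _ => Finset.sum_nonneg fun i _ => by positivity
  have hε0 : 0 < ε := by positivity
  choose p hpA hpε using fun i => exists_simpleFunc_approx_inv (hA i) (hS i) (hAS i) hε0
  -- The range of `p i` may meet `A i` through values taken off `S i`; these are discarded.
  set P : ι → Finset ℂ := fun i => (p i).range.filter (· ∉ A i) with hP
  have hPA : ∀ i, ∀ q ∈ P i, q ∉ A i := fun i q hq => (Finset.mem_filter.1 hq).2
  have hpP : ∀ i, ∀ w ∈ S i, p i w ∈ P i := fun i w hw =>
    Finset.mem_filter.2 ⟨(p i).mem_range_self w, hpA i w hw⟩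
  refine ⟨P, hPA, fun b hb hbc => ?_⟩
  set ρ : (ℂ → E) → ι → ℂ → E := fun a i q => (Real.pi : ℂ)⁻¹ • ∫ w in S i ∩ p i ⁻¹' {q}, a w
    with hρ
  set u : (ℂ → E) → ι → ℂ → E := fun a i z => (Real.pi : ℂ)⁻¹ • (∫ w in S i, (z - w)⁻¹ • a w) -
    ∑ q ∈ P i, (z - q)⁻¹ • ρ a i q with hu
  have hAS' : ∀ i z, z ∈ A i → z ∉ S i := fun i z hz hz' => (hAS i).le_bot ⟨hz, hz'⟩
  have hud : ∀ a : ℂ → E, Continuous a → ∀ i,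
      ContDiffOn ℝ 1 (u a i) (S i ∪ (P i : Set ℂ))ᶜ := by
    intro a ha i
    have hopen : IsOpen (S i ∪ (P i : Set ℂ))ᶜ :=
      ((hS i).isClosed.union (P i).finite_toSet.isClosed).isOpen_compl
    have hdiff : DifferentiableOn ℂ (u a i) (S i ∪ (P i : Set ℂ))ᶜ := by
      intro z hz
      rw [mem_compl_iff, mem_union, not_or] at hz
      refine DifferentiableAt.differentiableWithinAt ?_
      refine ((differentiableAt_setIntegral_inv_smul (hS i) ha hz.1).const_smul _).sub ?_
      refine DifferentiableAt.fun_sum fun q hq => ?_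
      have hne : z - q ≠ 0 := sub_ne_zero.2 fun h => hz.2 (h ▸ hq)
      exact ((differentiableAt_id.sub_const q).inv hne).smul_const _
    exact (hdiff.contDiffOn hopen).restrict_scalars ℝ
  have hKu : ∀ a : ℂ → E, Continuous a → ∀ j i,
      ContDiff ℝ 1 (fun z => K j i z (u a i z)) := by
    intro a ha j i
    refine contDiff_clm_apply_of_support (hK j i) (hA i).isClosed
      ((hS i).isClosed.union (P i).finite_toSet.isClosed).isOpen_compl ?_ (hKA j i) (hud a ha i)
    intro z hz h
    rcases h with h | h
    · exact hAS' i z hz h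
    · exact hPA i z h hz
  -- On `A i` the two terms of `u` combine to one integral against the difference of the kernels,
  -- which is at most `ε`.
  have hu_eq : ∀ a : ℂ → E, Continuous a → ∀ i, ∀ z ∈ A i, u a i z =
      (Real.pi : ℂ)⁻¹ • ∫ w in S i, ((z - w)⁻¹ - (z - p i w)⁻¹) • a w := by
    intro a ha i z hz
    have h1 : ∑ q ∈ P i, (z - q)⁻¹ • ρ a i q =
        (Real.pi : ℂ)⁻¹ • ∫ w in S i, (z - p i w)⁻¹ • a w := by
      rw [setIntegral_inv_simpleFunc_smul (hS i) (p i) (P i) (hpP i) ha, Finset.smul_sum]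
      exact Finset.sum_congr rfl fun q _ => smul_comm _ _ _
    have hai : IntegrableOn a (S i) := ha.continuousOn.integrableOn_compact (hS i)
    have hi1 : IntegrableOn (fun w => (z - w)⁻¹ • a w) (S i) := by
      refine ContinuousOn.integrableOn_compact (hS i) ?_
      refine ContinuousOn.smul (ContinuousOn.inv₀ (by fun_prop) fun w hw => ?_) ha.continuousOn
      exact sub_ne_zero.2 fun h => hAS' i z hz (h ▸ hw)
    have hi2 : IntegrableOn (fun w => (z - p i w)⁻¹ • a w) (S i) := by
      have h2 : IntegrableOn (fun w => ∑ q ∈ P i,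
          (p i ⁻¹' {q}).indicator (fun w => (z - q)⁻¹ • a w) w) (S i) :=
        integrable_finsetSum _ fun q _ => (hai.smul _).indicator ((p i).measurableSet_preimage _)
      refine h2.congr_fun (fun w hw => ?_) (hS i).measurableSet
      beta_reduce
      rw [Finset.sum_eq_single_of_mem (p i w) (hpP i w hw)]
      · rw [indicator_of_mem (by simp)]
      · intro q _ hq
        exact indicator_of_notMem (by simpa using hq.symm) _
    simp only [hu]
    rw [h1, ← smul_sub, ← integral_sub hi1 hi2]
    simp only [sub_smul]
  let Φ : (ι → BoundedContinuousFunction ℂ E) → ι → ℂ → E := fun a j z =>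
    b j z - ∑ i, K j i z (u (a i) i z)
  have hΦc : ∀ a j, ContDiff ℝ 1 (Φ a j) := fun a j =>
    (hb j).sub (ContDiff.sum fun i _ => hKu (a i) (a i).continuous j i)
  have hΦb : ∀ a j, ∃ B, ∀ z, ‖Φ a j z‖ ≤ B := by
    intro a j
    refine HasCompactSupport.exists_bound_of_continuous ?_ (hΦc a j).continuous
    refine HasCompactSupport.intro ((hbc j).isCompact.union (isCompact_iUnion hA)) fun z hz => ?_
    rw [mem_union, not_or, mem_iUnion, not_exists] at hz
    simp only [Φ]
    rw [image_eq_zero_of_notMem_tsupport hz.1, Finset.sum_eq_zero, sub_zero]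
    intro i _
    rw [hKA j i z (hz.2 i), ContinuousLinearMap.zero_apply]
  choose Bd hBd using hΦb
  let Ψ : (ι → BoundedContinuousFunction ℂ E) → ι → BoundedContinuousFunction ℂ E := fun a j =>
    BoundedContinuousFunction.ofNormedAddCommGroup (Φ a j) (hΦc a j).continuous (Bd a j) (hBd a j)
  have hcontr : ContractingWith 2⁻¹ Ψ := by
    refine ⟨by norm_num, LipschitzWith.of_dist_le_mul fun a a' => ?_⟩
    refine (dist_pi_le_iff (by positivity)).2 fun j => ?_
    refine (BoundedContinuousFunction.dist_le (by positivity)).2 fun z => ?_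
    have h1 : ∀ i, ‖K j i z (u (a i) i z) - K j i z (u (a' i) i z)‖ ≤
        |B j i| * (Real.pi⁻¹ * v i) * (ε * dist a a') := by
      intro i
      by_cases hz : z ∈ A i
      · rw [← map_sub, hu_eq _ (a i).continuous i z hz, hu_eq _ (a' i).continuous i z hz,
          ← smul_sub, ← integral_sub]
        · refine (ContinuousLinearMap.le_opNorm _ _).trans ?_
          rw [mul_assoc, norm_smul]
          have hpi : ‖(Real.pi : ℂ)⁻¹‖ = Real.pi⁻¹ := by
            rw [norm_inv, norm_real, Real.norm_of_nonneg Real.pi_pos.le]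
          rw [hpi, mul_assoc]
          gcongr
          · exact (hB j i z).trans (le_abs_self _)
          · rw [mul_comm (v i)]
            refine norm_setIntegral_le_of_norm_le_const (hS i).measure_lt_top fun w hw => ?_
            rw [← smul_sub, norm_smul]
            gcongr
            · exact hpε i z hz w hw
            · rw [← dist_eq_norm]
              exact (BoundedContinuousFunction.dist_coe_le_dist w).trans (dist_le_pi_dist a a' i)
        all_goals
          refine Integrable.bdd_smul (C := ε) ?_ ?_ ?_
        · exact (a i).continuous.continuousOn.integrableOn_compact (hS i)
        · exact ((measurable_const.sub measurable_id).inv.sub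
            (measurable_const.sub (p i).measurable).inv).aestronglyMeasurable
        · filter_upwards [ae_restrict_mem (hS i).measurableSet] with w hw
          exact hpε i z hz w hw
        · exact (a' i).continuous.continuousOn.integrableOn_compact (hS i)
        · exact ((measurable_const.sub measurable_id).inv.sub
            (measurable_const.sub (p i).measurable).inv).aestronglyMeasurable
        · filter_upwards [ae_restrict_mem (hS i).measurableSet] with w hw
          exact hpε i z hz w hw
      · rw [hKA j i z hz]
        simp only [ContinuousLinearMap.zero_apply, sub_zero, norm_zero]
        positivity
    have h2 : dist (Ψ a j z) (Ψ a' j z) =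
        ‖∑ i, (K j i z (u (a i) i z) - K j i z (u (a' i) i z))‖ := by
      rw [dist_eq_norm, ← norm_neg, Finset.sum_sub_distrib]
      congr 1
      simp only [Ψ, Φ, BoundedContinuousFunction.coe_ofNormedAddCommGroup]
      abel
    rw [h2]
    refine (norm_sum_le _ _).trans ((Finset.sum_le_sum fun i _ => h1 i).trans ?_)
    rw [← Finset.sum_mul, ← mul_assoc]
    have h3 : (∑ i, |B j i| * (Real.pi⁻¹ * v i)) ≤ ∑ j, ∑ i, |B j i| * (Real.pi⁻¹ * v i) :=
      Finset.single_le_sum (f := fun j => ∑ i, |B j i| * (Real.pi⁻¹ * v i))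
        (fun j _ => Finset.sum_nonneg fun i _ => by positivity) (Finset.mem_univ j)
    have h4 : (∑ i, |B j i| * (Real.pi⁻¹ * v i)) * ε ≤ 2⁻¹ := by
      rw [hε, ← div_eq_mul_inv, div_le_iff₀ (by positivity)]
      linarith
    push_cast
    gcongr
  obtain ⟨a, ha⟩ : ∃ a, Ψ a = a := ⟨_, hcontr.fixedPoint_isFixedPt⟩
  have ha' : ∀ j z, a j z = Φ a j z := fun j z => by
    conv_lhs => rw [← ha]
    rfl
  -- The fixed point is found among bounded continuous functions; it is `C¹` because it equals `Φ
  -- a`.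
  refine ⟨fun j => a j, fun i => ρ (a i) i, fun j => ?_, fun j z => ha' j z⟩
  have h1 : (a j : ℂ → E) = Φ a j := funext (ha' j)
  beta_reduce
  rw [h1]
  exact hΦc a j

end IntegralEquationSolution

/-! ### Bundles over the plane, and poles of sections at infinity -/

section HolomorphicBundle

open Filter Bornology

/-- The inverse of a linear map, or zero if there is none. -/
noncomputable def LinearMap.inverseOrZero {V W : Type*} [AddCommGroup V] [Module ℂ V]
    [AddCommGroup W] [Module ℂ W] (f : V →ₗ[ℂ] W) : W →ₗ[ℂ] V :=
  open Classical in
  if h : Bijective f then (LinearEquiv.ofBijective f h).symm.toLinearMap else 0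

theorem LinearMap.apply_inverseOrZero {V W : Type*} [AddCommGroup V] [Module ℂ V]
    [AddCommGroup W] [Module ℂ W] {f : V →ₗ[ℂ] W} (h : Bijective f) (w : W) :
    f (f.inverseOrZero w) = w := by
  rw [LinearMap.inverseOrZero, dif_pos h]
  exact (LinearEquiv.ofBijective f h).apply_symm_apply w

theorem LinearMap.inverseOrZero_apply {V W : Type*} [AddCommGroup V] [Module ℂ V]
    [AddCommGroup W] [Module ℂ W] {f : V →ₗ[ℂ] W} (h : Bijective f) (v : V) :
    f.inverseOrZero (f v) = v := by
  rw [LinearMap.inverseOrZero, dif_pos h]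
  exact (LinearEquiv.ofBijective f h).symm_apply_apply v

/-- A holomorphic vector bundle over the complex plane, together with a trivialisation near `∞`,
given by a notion of holomorphic local section. -/
structure HolomorphicBundle (k : ℕ) (N : ℂ → Type*) [∀ z, AddCommGroup (N z)]
    [∀ z, Module ℂ (N z)] where
  /-- The section is holomorphic near the point. -/
  HolAt : (∀ z, N z) → ℂ → Prop
  exists_triv : ∀ z₀, ∃ Θ : ∀ z, N z →ₗ[ℂ] (Fin k → ℂ), ∀ᶠ z in 𝓝 z₀, Bijective (Θ z) ∧
    ∀ s, HolAt s z ↔ AnalyticAt ℂ (fun ξ => Θ ξ (s ξ)) z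
  /-- The trivialisation near `∞`. -/
  triv : ∀ z, N z →ₗ[ℂ] (Fin k → ℂ)
  eventually_triv : ∀ᶠ z in cobounded ℂ, Bijective (triv z) ∧
    ∀ s, HolAt s z ↔ AnalyticAt ℂ (fun ξ => triv ξ (s ξ)) z

namespace HolomorphicBundle

variable {k : ℕ} {N : ℂ → Type*} [∀ z, AddCommGroup (N z)] [∀ z, Module ℂ (N z)]
  (B : HolomorphicBundle k N)

/-- The section has a pole of order at most `d` at `∞`, with the given leading coefficient. -/
def HasLeadingCoeff (s : ∀ z, N z) (d : ℤ) (L : Fin k → ℂ) : Prop :=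
  Tendsto (fun z => z ^ (-d) • B.triv z (s z)) (cobounded ℂ) (𝓝 L)

variable {B} {s t : ∀ z, N z} {z : ℂ}

theorem HolAt.congr (hs : B.HolAt s z) (h : ∀ᶠ y in 𝓝 z, s y = t y) : B.HolAt t z := by
  obtain ⟨Θ, hΘ⟩ := B.exists_triv z
  have h1 := hΘ.self_of_nhds.2
  refine (h1 t).2 (((h1 s).1 hs).congr ?_)
  filter_upwards [h] with y hy
  rw [hy]

theorem HolAt.add (hs : B.HolAt s z) (ht : B.HolAt t z) : B.HolAt (fun y => s y + t y) z := by
  obtain ⟨Θ, hΘ⟩ := B.exists_triv z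
  have h1 := hΘ.self_of_nhds.2
  refine (h1 _).2 ?_
  simp only [map_add]
  exact ((h1 s).1 hs).add ((h1 t).1 ht)

theorem HolAt.smul {φ : ℂ → ℂ} (hφ : AnalyticAt ℂ φ z) (hs : B.HolAt s z) :
    B.HolAt (fun y => φ y • s y) z := by
  obtain ⟨Θ, hΘ⟩ := B.exists_triv z
  have h1 := hΘ.self_of_nhds.2
  refine (h1 _).2 ?_
  simp only [map_smul]
  exact hφ.smul ((h1 s).1 hs)

variable (B z) in
theorem holAt_zero : B.HolAt (fun _ => 0) z := by
  obtain ⟨Θ, hΘ⟩ := B.exists_triv z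
  refine (hΘ.self_of_nhds.2 _).2 ?_
  simp only [map_zero]
  exact analyticAt_const

theorem HolAt.sum {ι : Type*} {u : Finset ι} {s : ι → ∀ z, N z} (h : ∀ i ∈ u, B.HolAt (s i) z) :
    B.HolAt (fun y => ∑ i ∈ u, s i y) z := by
  classical
  induction u using Finset.induction_on with
  | empty => simpa using B.holAt_zero z
  | insert i u hi ih =>
    simp only [Finset.sum_insert hi]
    exact (h i (Finset.mem_insert_self i u)).add
      (ih fun j hj => h j (Finset.mem_insert_of_mem hj))

/-- A section that vanishes at `p` can be divided by `z - p`. -/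
theorem HolAt.exists_div (hs : B.HolAt s z) (h0 : s z = 0) :
    ∃ v : N z, B.HolAt (update (fun y => (y - z)⁻¹ • s y) z v) z := by
  obtain ⟨Θ, hΘ⟩ := B.exists_triv z
  have h1 := hΘ.self_of_nhds
  -- In coordinates the quotient extends by the derivative, that is, it becomes the divided slope
  -- `dslope`.
  obtain ⟨v, hv⟩ := h1.1.2 (deriv (fun y => Θ y (s y)) z)
  refine ⟨v, (h1.2 _).2 ?_⟩
  have h2 : (fun y => Θ y (update (fun y => (y - z)⁻¹ • s y) z v y)) =
      dslope (fun y => Θ y (s y)) z := by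
    funext y
    by_cases hy : y = z
    · subst hy
      rw [update_self, hv, dslope_same]
    · rw [update_of_ne hy, dslope_of_ne _ hy, slope_def_module, h0, map_zero, sub_zero, map_smul]
  rw [h2]
  obtain ⟨p, hp⟩ := (h1.2 s).1 hs
  exact hp.has_fpower_series_dslope_fslope.analyticAt

/-- The identity theorem. -/
theorem eq_zero_of_eventually_eq_zero (hs : ∀ z, B.HolAt s z) (h0 : ∀ᶠ y in 𝓝 z, s y = 0)
    (y : ℂ) : s y = 0 := by
  have hclopen : IsClopen {z | ∀ᶠ y in 𝓝 z, s y = 0} := by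
    refine ⟨?_, ?_⟩
    · rw [← isOpen_compl_iff, isOpen_iff_mem_nhds]
      intro p hp
      obtain ⟨Θ, hΘ⟩ := B.exists_triv p
      have h2 := (hΘ.self_of_nhds.2 s).1 (hs p)
      have key : ∀ᶠ y in 𝓝 p, (Θ y (s y) = 0 ↔ s y = 0) := by
        filter_upwards [hΘ] with y hy
        exact map_eq_zero_iff _ hy.1.1
      rcases h2.eventually_eq_zero_or_eventually_ne_zero with h3 | h3
      · refine absurd ?_ hp
        filter_upwards [h3, key] with y hy1 hy2
        exact hy2.1 hy1
      · rw [eventually_nhdsWithin_iff] at h3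
        filter_upwards [(h3.and key).eventually_nhds] with y hy hy'
        by_cases hyp : y = p
        · subst hyp; exact hp hy'
        · have h4 := hy.self_of_nhds
          exact h4.1 hyp (h4.2.2 hy'.self_of_nhds)
    · rw [isOpen_iff_mem_nhds]
      intro p hp
      exact hp.eventually_nhds
  have := hclopen.eq_univ ⟨z, h0⟩
  exact (this ▸ mem_univ y : y ∈ {z | ∀ᶠ y in 𝓝 z, s y = 0}).self_of_nhds

/-- Linear independence of holomorphic sections is an open condition. -/
theorem eventually_linearIndependent {ι : Type*} [Finite ι] {s : ι → ∀ z, N z}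
    (hs : ∀ i, B.HolAt (s i) z) (h : LinearIndependent ℂ fun i => s i z) :
    ∀ᶠ y in 𝓝 z, LinearIndependent ℂ fun i => s i y := by
  obtain ⟨Θ, hΘ⟩ := B.exists_triv z
  have h1 := hΘ.self_of_nhds
  have h2 : LinearIndependent ℂ fun i => Θ z (s i z) :=
    h.map' (Θ z) (LinearMap.ker_eq_bot.2 h1.1.1)
  have h3 : ContinuousAt (fun y i => Θ y (s i y)) z :=
    continuousAt_pi.2 fun i => ((h1.2 (s i)).1 (hs i)).continuousAt
  filter_upwards [h3.eventually (h2.eventually), hΘ] with y hy _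
  exact LinearIndependent.of_comp (Θ y) hy

/-- In the coordinate `w = 1 / z`, a section with a pole at `∞` is given by a holomorphic
function. -/
theorem exists_analyticAt_of_hasLeadingCoeff (hs : ∀ z, B.HolAt s z) {d : ℤ} {L : Fin k → ℂ}
    (h : B.HasLeadingCoeff s d L) : ∃ f : ℂ → Fin k → ℂ, AnalyticAt ℂ f 0 ∧ f 0 = L ∧
      ∀ᶠ z in cobounded ℂ, f z⁻¹ = z ^ (-d) • B.triv z (s z) := by
  set g : ℂ → Fin k → ℂ := fun w => w ^ d • B.triv w⁻¹ (s w⁻¹) with hg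
  have h1 : ∀ᶠ w in 𝓝[≠] (0 : ℂ), DifferentiableAt ℂ g w := by
    filter_upwards [tendsto_inv₀_nhdsNE_zero.eventually B.eventually_triv, self_mem_nhdsWithin]
      with w hw hw0
    have h3 : DifferentiableAt ℂ (fun w => B.triv w⁻¹ (s w⁻¹)) w :=
      ((hw.2 s).1 (hs _)).differentiableAt.comp w (differentiableAt_inv hw0)
    exact (differentiableAt_zpow.2 (Or.inl hw0)).smul h3
  have h2 : Tendsto g (𝓝[≠] 0) (𝓝 L) := by
    refine (Tendsto.comp h tendsto_inv₀_nhdsNE_zero).congr fun w => ?_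
    simp [hg]
  have h3 : AnalyticAt ℂ (update g 0 L) 0 := by
    -- The existence of the leading coefficient makes `w = 0` a removable singularity.
    refine Complex.analyticAt_of_differentiable_on_punctured_nhds_of_continuousAt ?_ ?_
    · filter_upwards [h1, self_mem_nhdsWithin] with w hw hw0
      refine hw.congr_of_eventuallyEq ?_
      filter_upwards [isOpen_ne.mem_nhds hw0] with y hy
      exact update_of_ne hy _ _
    · exact continuousAt_update_same.2 h2
  refine ⟨_, h3, update_self _ _ _, ?_⟩
  filter_upwards [eventually_ne_cobounded (0 : ℂ)] with z hz
  have h4 : ∀ w, w = z → B.triv w (s w) = B.triv z (s z) := by rintro _ rfl; rfl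
  rw [update_of_ne (inv_ne_zero hz), hg]
  beta_reduce
  rw [h4 _ (inv_inv z), inv_zpow, zpow_neg]

/-- In the coordinate `w = 1 / z` the section is a holomorphic function vanishing at `0`, so it can
be divided by `w`. -/
theorem HasLeadingCoeff.exists_pred (hs : ∀ z, B.HolAt s z) {d : ℤ}
    (h : B.HasLeadingCoeff s d 0) : ∃ L, B.HasLeadingCoeff s (d - 1) L := by
  obtain ⟨f, hf, hf0, hfs⟩ := exists_analyticAt_of_hasLeadingCoeff hs h
  refine ⟨deriv f 0, ?_⟩
  have h1 : Tendsto (fun w => w⁻¹ • f w) (𝓝[≠] 0) (𝓝 (deriv f 0)) := by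
    have := hasDerivAt_iff_tendsto_slope.1 hf.differentiableAt.hasDerivAt
    refine this.congr fun w => ?_
    rw [slope_def_module, hf0, sub_zero, sub_zero]
  have h2 := h1.comp (tendsto_inv₀_cobounded.inf (tendsto_principal_principal.2
    (fun z (hz : z ∈ ({0}ᶜ : Set ℂ)) => inv_ne_zero hz)) : Tendsto (fun z : ℂ => z⁻¹)
      (cobounded ℂ ⊓ 𝓟 {0}ᶜ) (𝓝 0 ⊓ 𝓟 {0}ᶜ))
  have h3 : cobounded ℂ ⊓ 𝓟 {0}ᶜ = cobounded ℂ :=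
    inf_eq_left.2 (le_principal_iff.2 (eventually_ne_cobounded (0 : ℂ)))
  rw [h3] at h2
  refine h2.congr' ?_
  filter_upwards [hfs, eventually_ne_cobounded (0 : ℂ)] with z hz hz0
  rw [comp_apply, hz, inv_inv, smul_smul, neg_sub, sub_eq_add_neg, zpow_one_add₀ hz0]

theorem HasLeadingCoeff.of_lt {d d' : ℤ} {L : Fin k → ℂ} (h : B.HasLeadingCoeff s d L)
    (hd : d < d') : B.HasLeadingCoeff s d' 0 := by
  have h1 : Tendsto (fun z : ℂ => z ^ (d - d')) (cobounded ℂ) (𝓝 0) := by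
    obtain ⟨m, hm⟩ := Int.eq_ofNat_of_zero_le (sub_nonneg.2 hd.le)
    have hm0 : m ≠ 0 := by omega
    have h2 := (tendsto_inv₀_cobounded (α := ℂ)).pow m
    rw [zero_pow hm0] at h2
    refine h2.congr fun z => ?_
    rw [← neg_sub d' d, hm, zpow_neg, inv_pow]; rfl
  have h3 := h1.smul h
  rw [zero_smul] at h3
  refine h3.congr' ?_
  filter_upwards [eventually_ne_cobounded (0 : ℂ)] with z hz
  rw [smul_smul, ← zpow_add₀ hz]
  congr 2; ring

theorem HasLeadingCoeff.sum {ι : Type*} {u : Finset ι} {s : ι → ∀ z, N z} {d : ℤ}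
    {L : ι → Fin k → ℂ} (h : ∀ i ∈ u, B.HasLeadingCoeff (s i) d (L i)) :
    B.HasLeadingCoeff (fun z => ∑ i ∈ u, s i z) d (∑ i ∈ u, L i) := by
  refine (tendsto_finsetSum u h).congr fun z => ?_
  rw [map_sum, Finset.smul_sum]

theorem HasLeadingCoeff.const_smul {d : ℤ} {L : Fin k → ℂ} (h : B.HasLeadingCoeff s d L) (c : ℂ) :
    B.HasLeadingCoeff (fun z => c • s z) d (c • L) := by
  refine (Tendsto.const_smul h c).congr fun z => ?_
  rw [map_smul, smul_comm]

theorem HasLeadingCoeff.congr {d d' : ℤ} {L : Fin k → ℂ} (h : B.HasLeadingCoeff s d L)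
    (hst : ∀ᶠ z in cobounded ℂ, z ^ (-d) • s z = z ^ (-d') • t z) :
    B.HasLeadingCoeff t d' L := by
  refine Tendsto.congr' ?_ h
  filter_upwards [hst] with z hz
  rw [← map_smul, hz, map_smul]

end HolomorphicBundle

end HolomorphicBundle

/-! ### The Birkhoff-Grothendieck theorem by minimising the total pole order -/

section Grothendieck

open Filter Bornology

theorem linearIndependent_update_sum {ι V : Type*} [Fintype ι] [DecidableEq ι] [AddCommGroup V]
    [Module ℂ V] {v : ι → V} (hv : LinearIndependent ℂ v) {c : ι → ℂ} {j : ι} (hj : c j ≠ 0) :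
    LinearIndependent ℂ (update v j (∑ i, c i • v i)) := by
  rw [Fintype.linearIndependent_iff] at hv ⊢
  intro g hg
  have h1 : ∑ i, (update g j 0 i + g j * c i) • v i = 0 := by
    rw [← hg, ← Finset.add_sum_erase _ _ (Finset.mem_univ j),
      ← Finset.add_sum_erase _ (fun i => g i • update v j (∑ i, c i • v i) i) (Finset.mem_univ j)]
    have h2 : ∑ i ∈ Finset.univ.erase j, g i • update v j (∑ i, c i • v i) i =
        ∑ i ∈ Finset.univ.erase j, g i • v i :=
      Finset.sum_congr rfl fun i hi => by rw [update_of_ne (Finset.ne_of_mem_erase hi)]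
    have h3 : ∑ i ∈ Finset.univ.erase j, (update g j 0 i + g j * c i) • v i =
        ∑ i ∈ Finset.univ.erase j, g i • v i +
          g j • ∑ i ∈ Finset.univ.erase j, c i • v i := by
      rw [Finset.smul_sum, ← Finset.sum_add_distrib]
      exact Finset.sum_congr rfl fun i hi => by
        rw [update_of_ne (Finset.ne_of_mem_erase hi), add_smul, mul_smul]
    rw [h2, h3, update_self, update_self, zero_add, ← Finset.add_sum_erase _ (fun i => c i • v i)
      (Finset.mem_univ j), smul_add, mul_smul]
    abel
  have h2 := hv _ h1
  have hgj : g j = 0 := by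
    have := h2 j
    rw [update_self, zero_add] at this
    exact (mul_eq_zero.1 this).resolve_right hj
  intro i
  by_cases hi : i = j
  · rw [hi, hgj]
  · have := h2 i
    rwa [update_of_ne hi, hgj, zero_mul, add_zero] at this

namespace HolomorphicBundle

variable {k : ℕ} {N : ℂ → Type*} [∀ z, AddCommGroup (N z)] [∀ z, Module ℂ (N z)]
  (B : HolomorphicBundle k N)

/-- Sections `s i`, holomorphic on the complex plane, with a pole of order at most `d i` at `∞`,
that are linearly independent at some point. -/
structure IsFrameCandidate (s : Fin k → ∀ z, N z) (d : Fin k → ℤ) : Prop where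
  holAt : ∀ i z, B.HolAt (s i) z
  exists_leadingCoeff : ∀ i, ∃ L, B.HasLeadingCoeff (s i) (d i) L
  linearIndependent : ∃ z, LinearIndependent ℂ fun i => s i z

variable {B}

/-- Independence is an open condition, so the point that witnesses it can be moved away from `p`,
where a division by `z - p` would be delicate. -/
theorem IsFrameCandidate.exists_ne {s : Fin k → ∀ z, N z} {d : Fin k → ℤ}
    (h : B.IsFrameCandidate s d) (p : ℂ) : ∃ z ≠ p, LinearIndependent ℂ fun i => s i z := by
  obtain ⟨z, hz⟩ := h.linearIndependent
  have h1 := eventually_linearIndependent (fun i => h.holAt i z) hz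
  by_cases hzp : z = p
  · obtain ⟨y, hy, hyz⟩ :=
      ((h1.filter_mono nhdsWithin_le_nhds).and (self_mem_nhdsWithin (s := {z}ᶜ))).exists
    exact ⟨y, fun h => hyz (h.trans hzp.symm), hy⟩
  · exact ⟨z, hzp, hz⟩

/-- If the sections are dependent at `p`, then the sum of the orders of the poles can be reduced. -/
theorem IsFrameCandidate.exists_lt_of_not_linearIndependent {s : Fin k → ∀ z, N z} {d : Fin k → ℤ}
    (h : B.IsFrameCandidate s d) {p : ℂ} (hp : ¬ LinearIndependent ℂ fun i => s i p) :
    ∃ s' d', B.IsFrameCandidate s' d' ∧ ∑ i, d' i < ∑ i, d i := by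
  classical
  rw [Fintype.not_linearIndependent_iff] at hp
  obtain ⟨c, hc, i₀, hi₀⟩ := hp
  -- Among the sections that occur in the relation, the one with the largest pole is to be replaced;
  -- the combination `t` then has a pole of order at most `d j`.
  obtain ⟨j, hj, hmax⟩ := (Finset.univ.filter fun i => c i ≠ 0).exists_max_image d
    ⟨i₀, by simpa using hi₀⟩
  have hcj : c j ≠ 0 := by simpa using hj
  have hmax' : ∀ i, c i ≠ 0 → d i ≤ d j := fun i hi => hmax i (by simpa using hi)
  set t : ∀ z, N z := fun z => ∑ i, c i • s i z with ht
  have hthol : ∀ z, B.HolAt t z := fun z =>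
    HolAt.sum fun i _ => (h.holAt i z).smul analyticAt_const
  have htL : ∃ L, B.HasLeadingCoeff t (d j) L := by
    have : ∀ i, ∃ L, B.HasLeadingCoeff (fun z => c i • s i z) (d j) L := by
      intro i
      by_cases hci : c i = 0
      · refine ⟨0, ?_⟩
        simp only [hci, zero_smul, HasLeadingCoeff, map_zero, smul_zero]
        exact tendsto_const_nhds
      · obtain ⟨L, hL⟩ := h.exists_leadingCoeff i
        rcases (hmax' i hci).eq_or_lt with h1 | h1
        · exact ⟨_, h1 ▸ hL.const_smul (c i)⟩
        · exact ⟨_, (hL.of_lt h1).const_smul (c i)⟩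
    choose L hL using this
    exact ⟨_, HasLeadingCoeff.sum fun i _ => hL i⟩
  -- Since `t` vanishes at `p`, it is divisible by `z - p`, and the division lowers the order of the
  -- pole at `∞` by one.
  obtain ⟨v, hv⟩ := (hthol p).exists_div hc
  set t' := update (fun y => (y - p)⁻¹ • t y) p v with ht'
  refine ⟨update s j t', update d j (d j - 1), ⟨?_, ?_, ?_⟩, ?_⟩
  · intro i z
    by_cases hi : i = j
    · rw [hi, update_self]
      by_cases hz : z = p
      · rw [hz]; exact hv
      · have h1 : AnalyticAt ℂ (fun y => (y - p)⁻¹) z :=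
          (analyticAt_id.sub analyticAt_const).inv (sub_ne_zero.2 hz)
        refine ((hthol z).smul h1).congr ?_
        filter_upwards [isOpen_ne.mem_nhds hz] with y hy
        rw [ht', update_of_ne hy]
    · rw [update_of_ne hi]; exact h.holAt i z
  · intro i
    by_cases hi : i = j
    · rw [hi, update_self, update_self]
      obtain ⟨L, hL⟩ := htL
      refine ⟨L, ?_⟩
      have h1 : Tendsto (fun z : ℂ => z * (z - p)⁻¹) (cobounded ℂ) (𝓝 1) := by
        have h2 : Tendsto (fun z : ℂ => (1 - p * z⁻¹)⁻¹) (cobounded ℂ) (𝓝 1) := by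
          have := ((tendsto_inv₀_cobounded (α := ℂ)).const_mul p).const_sub 1
          rw [mul_zero, sub_zero] at this
          simpa using this.inv₀ one_ne_zero
        refine h2.congr' ?_
        filter_upwards [eventually_ne_cobounded (0 : ℂ)] with z hz
        have : z - p = z * (1 - p * z⁻¹) := by field_simp
        rw [this, mul_inv, mul_inv_cancel_left₀ hz]
      have h3 := h1.smul hL
      rw [one_smul] at h3
      refine h3.congr' ?_
      filter_upwards [eventually_ne_cobounded (0 : ℂ), eventually_ne_cobounded p] with z hz hzp
      rw [ht', update_of_ne hzp, map_smul, smul_smul, smul_smul]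
      congr 1
      rw [neg_sub, sub_eq_add_neg 1, zpow_one_add₀ hz]
      ring
    · rw [update_of_ne hi, update_of_ne hi]; exact h.exists_leadingCoeff i
  · obtain ⟨z, hz, hli⟩ := h.exists_ne p
    refine ⟨z, ?_⟩
    have h1 := linearIndependent_update_sum hli (c := fun i => (z - p)⁻¹ * c i) (j := j)
      (mul_ne_zero (inv_ne_zero (sub_ne_zero.2 hz)) hcj)
    convert h1 using 1
    funext i
    by_cases hi : i = j
    · subst hi
      rw [update_self, update_self, ht', update_of_ne hz, ht, Finset.smul_sum]
      simp only [mul_smul]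
    · rw [update_of_ne hi, update_of_ne hi]
  · rw [← Finset.add_sum_erase _ _ (Finset.mem_univ j), ← Finset.add_sum_erase _ d
      (Finset.mem_univ j), update_self]
    have : ∑ i ∈ Finset.univ.erase j, update d j (d j - 1) i = ∑ i ∈ Finset.univ.erase j, d i :=
      Finset.sum_congr rfl fun i hi => update_of_ne (Finset.ne_of_mem_erase hi) _ _
    rw [this]
    omega

/-- If the leading coefficients are dependent, then the sum of the orders of the poles can be
reduced. -/
theorem IsFrameCandidate.exists_lt_of_leadingCoeff {s : Fin k → ∀ z, N z} {d : Fin k → ℤ}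
    (h : B.IsFrameCandidate s d) {L : Fin k → Fin k → ℂ}
    (hL : ∀ i, B.HasLeadingCoeff (s i) (d i) (L i)) (hp : ¬ LinearIndependent ℂ L) :
    ∃ s' d', B.IsFrameCandidate s' d' ∧ ∑ i, d' i < ∑ i, d i := by
  classical
  rw [Fintype.not_linearIndependent_iff] at hp
  obtain ⟨c, hc, i₀, hi₀⟩ := hp
  obtain ⟨j, hj, hmax⟩ := (Finset.univ.filter fun i => c i ≠ 0).exists_max_image d
    ⟨i₀, by simpa using hi₀⟩
  have hcj : c j ≠ 0 := by simpa using hj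
  have hmax' : ∀ i, c i ≠ 0 → d i ≤ d j := fun i hi => hmax i (by simpa using hi)
  -- The powers of `z` raise all poles to order `d j`, so that the leading coefficients cancel by
  -- the relation. The truncation in `toNat` matters only where `c i = 0`.
  set t : ∀ z, N z := fun z => ∑ i, (c i * z ^ (d j - d i).toNat) • s i z with ht
  have hthol : ∀ z, B.HolAt t z := fun z =>
    HolAt.sum fun i _ => (h.holAt i z).smul (by fun_prop)
  have htL : B.HasLeadingCoeff t (d j) 0 := by
    rw [← hc]
    refine HasLeadingCoeff.sum fun i _ => ?_
    by_cases hci : c i = 0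
    · simp only [hci, zero_mul, zero_smul, HasLeadingCoeff, map_zero, smul_zero]
      exact tendsto_const_nhds
    · refine ((hL i).const_smul (c i)).congr ?_
      filter_upwards [eventually_ne_cobounded (0 : ℂ)] with z hz
      rw [smul_smul, smul_smul, mul_comm, mul_left_comm, ← zpow_natCast,
        Int.toNat_of_nonneg (sub_nonneg.2 (hmax' i hci)), ← zpow_add₀ hz]
      congr 3; ring
  obtain ⟨L', hL'⟩ := htL.exists_pred hthol
  refine ⟨update s j t, update d j (d j - 1), ⟨?_, ?_, ?_⟩, ?_⟩
  · intro i z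
    by_cases hi : i = j
    · rw [hi, update_self]; exact hthol z
    · rw [update_of_ne hi]; exact h.holAt i z
  · intro i
    by_cases hi : i = j
    · rw [hi, update_self, update_self]; exact ⟨L', hL'⟩
    · rw [update_of_ne hi, update_of_ne hi]; exact h.exists_leadingCoeff i
  · obtain ⟨z, hz, hli⟩ := h.exists_ne 0
    refine ⟨z, ?_⟩
    have h1 := linearIndependent_update_sum hli (c := fun i => c i * z ^ (d j - d i).toNat) (j := j)
      (mul_ne_zero hcj (pow_ne_zero _ hz))
    convert h1 using 1
    funext i
    by_cases hi : i = j
    · subst hi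
      rw [update_self, update_self]
    · rw [update_of_ne hi, update_of_ne hi]
  · rw [← Finset.add_sum_erase _ _ (Finset.mem_univ j), ← Finset.add_sum_erase _ d
      (Finset.mem_univ j), update_self]
    have : ∑ i ∈ Finset.univ.erase j, update d j (d j - 1) i = ∑ i ∈ Finset.univ.erase j, d i :=
      Finset.sum_congr rfl fun i hi => update_of_ne (Finset.ne_of_mem_erase hi) _ _
    rw [this]
    omega

variable (B) in
/-- The space of the sections that are holomorphic on the complex plane and have a pole of order at
most `d` at `∞`. -/
def sectionsWithPole (d : ℤ) : Submodule ℂ (∀ z, N z) where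
  carrier := {s | (∀ z, B.HolAt s z) ∧ ∃ L, B.HasLeadingCoeff s d L}
  add_mem' := by
    rintro s t ⟨hs, L, hL⟩ ⟨ht, L', hL'⟩
    refine ⟨fun z => (hs z).add (ht z), L + L', (Tendsto.add hL hL').congr fun z => ?_⟩
    rw [Pi.add_apply, map_add, smul_add]
  zero_mem' := by
    refine ⟨fun z => B.holAt_zero z, 0, ?_⟩
    simp only [HasLeadingCoeff, Pi.zero_apply, map_zero, smul_zero]
    exact tendsto_const_nhds
  smul_mem' := by
    rintro c s ⟨hs, L, hL⟩
    exact ⟨fun z => (hs z).smul (analyticAt_const (v := c)), _, hL.const_smul c⟩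

/-- A section that vanishes to infinite order at `∞` is zero. -/
theorem eq_zero_of_forall_mem_sectionsWithPole {s : ∀ z, N z}
    (h : ∀ m : ℕ, s ∈ B.sectionsWithPole (-m)) : s = 0 := by
  have hs := (h 0).1
  obtain ⟨L, hL⟩ := (h 0).2
  obtain ⟨f, hf, -, hfs⟩ := exists_analyticAt_of_hasLeadingCoeff hs hL
  have hf0 : ∀ᶠ w in 𝓝 0, f w = 0 := by
    by_contra hne
    -- If `f` had a zero of finite order `n` at `w = 0`, then `z ^ n` times the section would tend
    -- to `g 0 ≠ 0`; vanishing to order `n + 1` makes it tend to `0`.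
    obtain ⟨n, g, hg, hg0, hfg⟩ := hf.exists_eventuallyEq_pow_smul_nonzero_iff.2 hne
    obtain ⟨L', hL'⟩ := (h (n + 1)).2
    have h1 : Tendsto (fun z : ℂ => g z⁻¹) (cobounded ℂ) (𝓝 (g 0)) :=
      hg.continuousAt.tendsto.comp tendsto_inv₀_cobounded
    have h2 := (tendsto_inv₀_cobounded (α := ℂ)).smul hL'
    rw [zero_smul] at h2
    refine hg0 (tendsto_nhds_unique h1 (h2.congr' ?_))
    filter_upwards [hfs, eventually_ne_cobounded (0 : ℂ),
      tendsto_inv₀_cobounded.eventually hfg] with z hz hz0 hz1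
    rw [hz1] at hz
    simp only [Nat.cast_zero, neg_zero, zpow_zero, one_smul, sub_zero] at hz
    rw [← hz, smul_smul, smul_smul, neg_neg, zpow_natCast, inv_pow, pow_succ']
    rw [show z⁻¹ * (z * z ^ n) * (z ^ n)⁻¹ = 1 by field_simp, one_smul]
  obtain ⟨z, hz⟩ : ∃ z : ℂ, ∀ᶠ y in 𝓝 z, s y = 0 := by
    have h1 : ∀ᶠ z in cobounded ℂ, s z = 0 := by
      filter_upwards [hfs, tendsto_inv₀_cobounded.eventually hf0, B.eventually_triv]
        with z hz hz0 hz1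
      rw [hz0] at hz
      simp only [Nat.cast_zero, neg_zero, zpow_zero, one_smul] at hz
      exact (map_eq_zero_iff _ hz1.1.1).1 hz.symm
    obtain ⟨r, -, hr⟩ := (hasBasis_cobounded_norm (E := ℂ)).eventually_iff.1 h1
    obtain ⟨z, hz⟩ := NormedSpace.exists_lt_norm ℂ ℂ r
    refine ⟨z, ?_⟩
    filter_upwards [(isOpen_lt continuous_const continuous_norm).mem_nhds hz] with y hy
    exact hr (le_of_lt hy)
  exact funext (eq_zero_of_eventually_eq_zero hs hz)

theorem sectionsWithPole_mono {d d' : ℤ} (h : d ≤ d') :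
    B.sectionsWithPole d ≤ B.sectionsWithPole d' := by
  rintro s ⟨hs, L, hL⟩
  rcases h.eq_or_lt with rfl | h
  · exact ⟨hs, L, hL⟩
  · exact ⟨hs, _, hL.of_lt h⟩

/-- If the space of global sections is finite-dimensional, then the order to which a section can
vanish at `∞` is bounded. -/
theorem exists_sectionsWithPole_eq_bot (hfin : FiniteDimensional ℂ (B.sectionsWithPole 0)) :
    ∃ m : ℕ, B.sectionsWithPole (-m) = ⊥ := by
  have hle : ∀ m : ℕ, B.sectionsWithPole (-m) ≤ B.sectionsWithPole 0 := fun m =>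
    sectionsWithPole_mono (by omega)
  -- A descending chain of subspaces stabilises, and its final member consists of sections that
  -- vanish to infinite order.
  let f : ℕ →o (Submodule ℂ (B.sectionsWithPole 0))ᵒᵈ :=
    ⟨fun m => OrderDual.toDual ((B.sectionsWithPole (-m)).comap (B.sectionsWithPole 0).subtype),
      fun a b hab => Submodule.comap_mono (sectionsWithPole_mono (by omega))⟩
  obtain ⟨m, hm⟩ := IsArtinian.monotone_stabilizes f
  refine ⟨m, (Submodule.eq_bot_iff _).2 fun s hs => ?_⟩
  refine eq_zero_of_forall_mem_sectionsWithPole (B := B) fun n => ?_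
  rcases le_total n m with h | h
  · exact sectionsWithPole_mono (by omega) hs
  · have h1 : (⟨s, hle m hs⟩ : B.sectionsWithPole 0) ∈ OrderDual.ofDual (f m) := hs
    rw [hm n h] at h1
    exact h1

/-- The Birkhoff-Grothendieck theorem, for a bundle that has sufficiently many meromorphic sections
and a finite-dimensional space of global sections. -/
theorem exists_frame (hfin : FiniteDimensional ℂ (B.sectionsWithPole 0))
    (hex : ∃ s d, B.IsFrameCandidate s d) :
    ∃ (s : Fin k → ∀ z, N z) (d : Fin k → ℤ) (L : Fin k → Fin k → ℂ),
      (∀ i z, B.HolAt (s i) z) ∧ (∀ i, B.HasLeadingCoeff (s i) (d i) (L i)) ∧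
      (∀ z, LinearIndependent ℂ fun i => s i z) ∧ LinearIndependent ℂ L := by
  obtain ⟨m, hm⟩ := exists_sectionsWithPole_eq_bot hfin
  -- A member of a candidate is not the zero section, so its pole order is bounded below and the
  -- total attains a minimum.
  have hd : ∀ s d, B.IsFrameCandidate s d → ∀ i, -(m : ℤ) < d i := by
    intro s d h i
    by_contra hlt
    have h1 : s i ∈ B.sectionsWithPole (-m) :=
      sectionsWithPole_mono (not_lt.1 hlt) ⟨h.holAt i, h.exists_leadingCoeff i⟩
    rw [hm, Submodule.mem_bot] at h1
    obtain ⟨z, hz⟩ := h.linearIndependent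
    exact hz.ne_zero i (congrFun h1 z)
  obtain ⟨S, ⟨s, d, h, rfl⟩, hmin⟩ := Int.exists_least_of_bdd
    (P := fun S => ∃ s d, B.IsFrameCandidate s d ∧ ∑ i, d i = S)
    ⟨∑ _i : Fin k, -(m : ℤ), by
      rintro _ ⟨s, d, h, rfl⟩
      exact Finset.sum_le_sum fun i _ => (hd s d h i).le⟩
    (by obtain ⟨s, d, h⟩ := hex; exact ⟨_, s, d, h, rfl⟩)
  choose L hL using h.exists_leadingCoeff
  refine ⟨s, d, L, h.holAt, hL, fun z => ?_, ?_⟩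
  · by_contra hz
    obtain ⟨s', d', h', hlt⟩ := h.exists_lt_of_not_linearIndependent hz
    exact absurd (hmin _ ⟨s', d', h', rfl⟩) (not_le.2 hlt)
  · by_contra hz
    obtain ⟨s', d', h', hlt⟩ := h.exists_lt_of_leadingCoeff hL hz
    exact absurd (hmin _ ⟨s', d', h', rfl⟩) (not_le.2 hlt)

end HolomorphicBundle

end Grothendieck

/-! ### Cutoff functions, and estimates at infinity -/

section Cutoff

open Filter Bornology Complex MeasureTheory

theorem contDiff_dbar {f : ℂ → ℂ} (hf : ContDiff ℝ 2 f) : ContDiff ℝ 1 (dbar f) := by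
  have h1 : ContDiff ℝ 1 (fderiv ℝ f) := hf.fderiv_right (by norm_num)
  exact ((h1.clm_apply contDiff_const).add
    ((h1.clm_apply contDiff_const).const_smul I)).const_smul _

theorem dbar_eq_zero_of_eventuallyEq_const {f : ℂ → ℂ} {z c : ℂ} (h : f =ᶠ[𝓝 z] fun _ => c) :
    dbar f z = 0 := by
  rw [dbar_congr h]
  exact dbar_eq_zero (differentiableAt_const c)

theorem tsupport_dbar_subset (f : ℂ → ℂ) : tsupport (dbar f) ⊆ tsupport f := by
  refine closure_minimal (fun z hz => ?_) (isClosed_tsupport f)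
  by_contra h
  exact hz (dbar_eq_zero_of_eventuallyEq_const (notMem_tsupport_iff_eventuallyEq.1 h))

/-- A smooth partition of unity subordinate to a finite open cover of the plane, together with
cutoff functions that are equal to one near the supports. -/
theorem exists_partitionOfUnity_cutoff {ι : Type*} [Fintype ι] {V : ι → Set ℂ}
    (hV : ∀ i, IsOpen (V i)) (hcov : ∀ z, ∃ i, z ∈ V i) :
    ∃ χ ψ : ι → ℂ → ℂ, (∀ i, ContDiff ℝ 2 (χ i)) ∧ (∀ i, ContDiff ℝ 2 (ψ i)) ∧
      (∀ i, tsupport (χ i) ⊆ V i) ∧ (∀ i, tsupport (ψ i) ⊆ V i) ∧ (∀ z, ∑ i, χ i z = 1) ∧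
      ∀ i, ∀ z ∈ tsupport (χ i), ψ i =ᶠ[𝓝 z] fun _ => 1 := by
  obtain ⟨f, hf⟩ := SmoothPartitionOfUnity.exists_isSubordinate 𝓘(ℝ, ℂ) isClosed_univ V hV
    (fun z _ => mem_iUnion.2 (hcov z))
  have hts : ∀ g : ℂ → ℝ, tsupport (fun z => (g z : ℂ)) = tsupport g := fun g => by
    rw [tsupport, tsupport]
    congr 1
    ext z
    simp
  have hψ : ∀ i, ∃ ψ : ℂ → ℂ, ContDiff ℝ 2 ψ ∧ tsupport ψ ⊆ V i ∧
      ∀ z ∈ tsupport (f i), ψ =ᶠ[𝓝 z] fun _ => 1 := by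
    intro i
    obtain ⟨O, hO, hsO, hOV⟩ := normal_exists_closure_subset (isClosed_tsupport (f i)) (hV i) (hf i)
    obtain ⟨g, hg1, hg0, -⟩ := exists_contMDiffMap_one_nhds_of_subset_interior 𝓘(ℝ, ℂ) (n := 2)
      (s := tsupport (f i)) (t := closure O) (isClosed_tsupport _)
      (hsO.trans (hO.subset_interior_iff.2 subset_closure))
    refine ⟨fun z => (g z : ℂ), ofRealCLM.contDiff.comp g.contMDiff.contDiff, ?_, fun z hz => ?_⟩
    · rw [hts]
      refine (closure_minimal (fun z hz => ?_) isClosed_closure).trans hOV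
      by_contra h
      exact hz (hg0 z h)
    · filter_upwards [(eventually_nhdsSet_iff_forall.1 hg1) z hz] with y hy
      rw [hy, ofReal_one]
  choose ψ hψ1 hψ2 hψ3 using hψ
  refine ⟨fun i z => (f i z : ℂ), ψ, fun i => ?_, hψ1, fun i => ?_, hψ2, fun z => ?_, fun i z hz => ?_⟩
  · exact (ofRealCLM.contDiff.comp (f i).contMDiff.contDiff).of_le (by norm_cast)
  · rw [hts]; exact hf i
  · have := f.sum_eq_one (mem_univ z)
    rw [finsum_eq_sum_of_fintype] at this
    beta_reduce
    exact_mod_cast this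
  · rw [hts] at hz
    exact hψ3 i z hz

theorem contDiff_smul_of_tsupport {G : Type*} [NormedAddCommGroup G] [NormedSpace ℂ G]
    [CompleteSpace G] {φ : ℂ → ℂ} (hφ : ContDiff ℝ 1 φ) {g : ℂ → G}
    (hg : ∀ z ∈ tsupport φ, AnalyticAt ℂ g z) : ContDiff ℝ 1 (fun z => φ z • g z) := by
  rw [contDiff_iff_contDiffAt]
  intro z
  by_cases hz : z ∈ tsupport φ
  · exact hφ.contDiffAt.smul ((hg z hz).contDiffAt.restrict_scalars ℝ)
  · refine (contDiffAt_const (c := (0 : G))).congr_of_eventuallyEq ?_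
    filter_upwards [notMem_tsupport_iff_eventuallyEq.1 hz] with y hy
    simp [hy]

theorem dbar_smul_clm_apply_of_tsupport {G G' : Type*} [NormedAddCommGroup G] [NormedSpace ℂ G]
    [NormedAddCommGroup G'] [NormedSpace ℂ G'] {φ : ℂ → ℂ} {z : ℂ}
    (hφ : DifferentiableAt ℝ φ z) {g : ℂ → G →L[ℂ] G'}
    (hg : z ∈ tsupport φ → AnalyticAt ℂ g z) {w : ℂ → G} (hw : DifferentiableAt ℝ w z) :
    DifferentiableAt ℝ (fun y => φ y • g y (w y)) z ∧
      dbar (fun y => φ y • g y (w y)) z = dbar φ z • g z (w z) + φ z • g z (dbar w z) := by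
  by_cases hz : z ∈ tsupport φ
  · obtain ⟨h1, h2⟩ := dbar_clm_apply (hg hz).differentiableAt hw
    refine ⟨hφ.smul h1, ?_⟩
    rw [dbar_smul hφ h1, h2]
  · have h0 := notMem_tsupport_iff_eventuallyEq.1 hz
    have h1 : (fun y => φ y • g y (w y)) =ᶠ[𝓝 z] fun _ => 0 := by
      filter_upwards [h0] with y hy
      simp [hy]
    refine ⟨(differentiableAt_const _).congr_of_eventuallyEq h1, ?_⟩
    rw [dbar_congr h1, dbar_eq_zero (differentiableAt_const _),
      dbar_eq_zero_of_eventuallyEq_const h0, h0.self_of_nhds]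
    simp

theorem exists_bump {V : Set ℂ} (hV : IsOpen V) {q : ℂ} (hq : q ∈ V) :
    ∃ φ : ℂ → ℂ, ContDiff ℝ 2 φ ∧ HasCompactSupport φ ∧ tsupport φ ⊆ V ∧
      φ =ᶠ[𝓝 q] fun _ => 1 := by
  obtain ⟨r, hr, hrV⟩ := Metric.nhds_basis_closedBall.mem_iff.1 (hV.mem_nhds hq)
  let f : ContDiffBump q := ⟨r / 2, r, by positivity, by linarith⟩
  have hts : tsupport (fun z => (f z : ℂ)) = Metric.closedBall q r := by
    rw [← f.tsupport_eq, tsupport, tsupport]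
    congr 1
    ext z
    simp
  refine ⟨fun z => (f z : ℂ), ofRealCLM.contDiff.comp f.contDiff, ?_, hts ▸ hrV, ?_⟩
  · rw [HasCompactSupport, hts]; exact isCompact_closedBall q r
  · filter_upwards [f.eventuallyEq_one] with y hy
    rw [hy]; simp

/-- On the compact support of `f` the kernel is `O(1 / |z|)`. -/
theorem tendsto_cauchyTransform_cobounded {E : Type*} [NormedAddCommGroup E] [NormedSpace ℂ E]
    {f : ℂ → E} (hf : Continuous f) (hfc : HasCompactSupport f) :
    Tendsto (cauchyTransform f) (cobounded ℂ) (𝓝 0) := by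
  obtain ⟨R, hR⟩ := hfc.isBounded.exists_norm_le
  set c : ℝ := Real.pi⁻¹ * ∫ w, ‖f w‖ with hc
  have hfi : Integrable fun w => ‖f w‖ := (hf.integrable_of_hasCompactSupport hfc).norm
  have h1 : Tendsto (fun z : ℂ => (‖z‖ - R)⁻¹ * c) (cobounded ℂ) (𝓝 0) := by
    have h2 : Tendsto (fun z : ℂ => ‖z‖ - R) (cobounded ℂ) atTop :=
      tendsto_atTop_add_const_right _ _ tendsto_norm_cobounded_atTop
    simpa using (tendsto_inv_atTop_zero.comp h2).mul_const c
  refine squeeze_zero_norm' ?_ h1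
  have h3 : ∀ᶠ z : ℂ in cobounded ℂ, R < ‖z‖ :=
    tendsto_norm_cobounded_atTop.eventually (eventually_gt_atTop R)
  filter_upwards [h3] with z hz
  rw [cauchyTransform, norm_smul]
  have hpi : ‖(Real.pi : ℂ)⁻¹‖ = Real.pi⁻¹ := by
    rw [norm_inv, norm_real, Real.norm_of_nonneg Real.pi_pos.le]
  rw [hpi, hc, mul_left_comm]
  gcongr
  rw [← integral_const_mul]
  refine norm_integral_le_of_norm_le (hfi.const_mul _) (Eventually.of_forall fun w => ?_)
  rw [norm_smul, norm_inv]
  by_cases hw : w ∈ tsupport f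
  · gcongr
    linarith [hR w hw, norm_sub_norm_le z w]
  · rw [image_eq_zero_of_notMem_tsupport hw]; simp

theorem tendsto_zpow_mul_prod_sub (u : Finset ℂ) :
    Tendsto (fun z : ℂ => z ^ (-(u.card : ℤ)) * ∏ p ∈ u, (z - p)) (cobounded ℂ) (𝓝 1) := by
  have h1 : ∀ p : ℂ, Tendsto (fun z : ℂ => z⁻¹ * (z - p)) (cobounded ℂ) (𝓝 1) := by
    intro p
    have h2 := ((tendsto_inv₀_cobounded (α := ℂ)).mul_const p).const_sub 1
    rw [zero_mul, sub_zero] at h2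
    refine h2.congr' ?_
    filter_upwards [eventually_ne_cobounded (0 : ℂ)] with z hz
    rw [mul_sub, inv_mul_cancel₀ hz]
  have h3 := tendsto_finsetProd u fun p _ => h1 p
  rw [Finset.prod_const_one] at h3
  refine h3.congr fun z => ?_
  rw [Finset.prod_mul_distrib, Finset.prod_const, zpow_neg, zpow_natCast, inv_pow]

end Cutoff

/-! ### Transition functions and a finite cover -/

section MeromorphicSections

open Filter Bornology Complex MeasureTheory

namespace HolomorphicBundle

variable {k : ℕ} {N : ℂ → Type*} [∀ z, AddCommGroup (N z)] [∀ z, Module ℂ (N z)]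
  (B : HolomorphicBundle k N)

/-- `Θ` is a holomorphic trivialisation near `z`. -/
def IsTrivAt (Θ : ∀ z, N z →ₗ[ℂ] (Fin k → ℂ)) (z : ℂ) : Prop :=
  ∀ᶠ y in 𝓝 z, Bijective (Θ y) ∧ ∀ s, B.HolAt s y ↔ AnalyticAt ℂ (fun ξ => Θ ξ (s ξ)) y

/-- The transition function between two trivialisations. -/
noncomputable def transition (Θ Θ' : ∀ z, N z →ₗ[ℂ] (Fin k → ℂ)) (z : ℂ) :
    (Fin k → ℂ) →L[ℂ] (Fin k → ℂ) :=
  LinearMap.toContinuousLinearMap (Θ' z ∘ₗ (Θ z).inverseOrZero)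

theorem transition_apply (Θ Θ' : ∀ z, N z →ₗ[ℂ] (Fin k → ℂ)) (z : ℂ) (v : Fin k → ℂ) :
    transition Θ Θ' z v = Θ' z ((Θ z).inverseOrZero v) := rfl

variable {B} {Θ Θ' : ∀ z, N z →ₗ[ℂ] (Fin k → ℂ)} {z : ℂ}

theorem IsTrivAt.holAt_const (h : B.IsTrivAt Θ z) (v : Fin k → ℂ) :
    B.HolAt (fun y => (Θ y).inverseOrZero v) z := by
  refine (h.self_of_nhds.2 _).2 ((analyticAt_const (v := v)).congr ?_)
  filter_upwards [h] with y hy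
  rw [LinearMap.apply_inverseOrZero hy.1]

theorem IsTrivAt.analyticAt_transition (h : B.IsTrivAt Θ z) (h' : B.IsTrivAt Θ' z) :
    AnalyticAt ℂ (transition Θ Θ') z := by
  -- A linear map is assembled from its columns, and these are the coordinates of the local sections
  -- that are constant in `Θ`.
  have h1 : transition Θ Θ' = fun y => ∑ l, (ContinuousLinearMap.smulRightL ℂ (Fin k → ℂ)
      (Fin k → ℂ) (ContinuousLinearMap.proj l)) (transition Θ Θ' y (Pi.single l 1)) := by
    funext y
    ext v i
    conv_lhs => rw [← Finset.univ_sum_single v, map_sum]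
    simp only [ContinuousLinearMap.sum_apply, Finset.sum_apply]
    refine Finset.sum_congr rfl fun l _ => ?_
    have : Pi.single l (v l) = v l • (Pi.single l 1 : Fin k → ℂ) := by
      rw [← Pi.single_smul, smul_eq_mul, mul_one]
    rw [this, map_smul]
    simp
  rw [h1]
  refine Finset.analyticAt_fun_sum _ fun l _ => ?_
  refine (ContinuousLinearMap.analyticAt _ _).comp ?_
  simp only [transition_apply]
  exact (h'.self_of_nhds.2 _).1 (h.holAt_const _)

theorem IsTrivAt.holAt_of_dbar (h : B.IsTrivAt Θ z) {s : ∀ z, N z}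
    (hs : ∀ᶠ y in 𝓝 z, DifferentiableAt ℝ (fun y => Θ y (s y)) y ∧
      dbar (fun y => Θ y (s y)) y = 0) : B.HolAt s z := by
  refine (h.self_of_nhds.2 s).2 (analyticAt_iff_eventually_differentiableAt.2 ?_)
  filter_upwards [hs] with y hy
  exact differentiableAt_of_dbar_eq_zero hy.1 hy.2

variable (B) in
-- Finitely many bounded patches cover a closed disc, and `triv` serves outside it. Only the patch
-- `i₀` reaches `∞`, so the derivatives of the cutoffs will have compact support.
theorem exists_finite_cover : ∃ (ι : Type) (_ : Fintype ι) (Θ : ι → ∀ z, N z →ₗ[ℂ] (Fin k → ℂ))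
    (V : ι → Set ℂ) (i₀ : ι), (∀ i, IsOpen (V i)) ∧ (∀ z, ∃ i, z ∈ V i) ∧
      (∀ i, i ≠ i₀ → IsBounded (V i)) ∧ Θ i₀ = B.triv ∧ ∀ i, ∀ z ∈ V i, B.IsTrivAt (Θ i) z := by
  classical
  obtain ⟨r, -, hr⟩ := (hasBasis_cobounded_norm (E := ℂ)).eventually_iff.1 B.eventually_triv
  choose Θ hΘ using B.exists_triv
  have hO : ∀ z₀, ∃ O : Set ℂ, IsOpen O ∧ z₀ ∈ O ∧ IsBounded O ∧ ∀ z ∈ O, B.IsTrivAt (Θ z₀) z := by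
    intro z₀
    obtain ⟨O, hOs, hO, hz⟩ := mem_nhds_iff.1 (hΘ z₀)
    exact ⟨O ∩ Metric.ball z₀ 1, hO.inter Metric.isOpen_ball, ⟨hz, Metric.mem_ball_self one_pos⟩,
      Metric.isBounded_ball.subset inter_subset_right,
      fun z hz => Filter.mem_of_superset (hO.mem_nhds hz.1) hOs⟩
  choose O hO1 hO2 hO3 hO4 using hO
  obtain ⟨t, -, ht⟩ := (isCompact_closedBall (0 : ℂ) r).elim_nhds_subcover O
    fun z _ => (hO1 z).mem_nhds (hO2 z)
  refine ⟨Option t, inferInstance, fun o => o.elim B.triv fun z => Θ z,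
    fun o => o.elim {z | r < ‖z‖} fun z => O z, none, ?_, ?_, ?_, rfl, ?_⟩
  · rintro (_ | z)
    · exact isOpen_lt continuous_const continuous_norm
    · exact hO1 _
  · intro z
    by_cases hz : r < ‖z‖
    · exact ⟨none, hz⟩
    · obtain ⟨y, hy, hzy⟩ := mem_iUnion₂.1 (ht (mem_closedBall_zero_iff.2 (not_lt.1 hz)))
      exact ⟨some ⟨y, hy⟩, hzy⟩
  · rintro (_ | z) h
    · exact absurd rfl h
    · exact hO3 _
  · rintro (_ | z₀) z hz
    · filter_upwards [(isOpen_lt continuous_const continuous_norm).mem_nhds hz] with y hy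
      exact hr (le_of_lt hy)
    · exact hO4 _ z hz

end HolomorphicBundle

end MeromorphicSections

/-! ### Existence of sections with a pole at infinity -/

section MeromorphicSectionsExist

open Filter Bornology Complex MeasureTheory

namespace HolomorphicBundle

variable {k : ℕ} {N : ℂ → Type*} [∀ z, AddCommGroup (N z)] [∀ z, Module ℂ (N z)]
  (B : HolomorphicBundle k N)

/-- There is a point at which the sections that are holomorphic on the complex plane and have a pole
at `∞` take all directions. -/
theorem exists_section_through : ∃ q : ℂ, (∃ Θ, B.IsTrivAt Θ q) ∧ ∀ v : N q, ∃ (s : ∀ z, N z) (d : ℤ)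
    (c : ℂ), (∀ z, B.HolAt s z) ∧ B.HasLeadingCoeff s d 0 ∧ c ≠ 0 ∧ s q = c • v := by
  classical
  -- The section sought is `(z - q) Q₁ (φ v / (z - q) - ∑ ψ_i u_i)`, with `v` extended as a constant
  -- in one patch and each `u_i`, read in patch `i`, a Cauchy transform of `a_i` minus principal
  -- parts. Off the poles, holomorphy means `∑ ψ_i a_i = η v - ∑ (∂ψ_i/∂z̄) u_i`, where `η =
  -- (∂φ/∂z̄) / (z - q)`. If `a_i` is `χ_i` times the right-hand side, the left-hand side becomes
  -- the right one, as `ψ_i = 1` on the support of `χ_i`. This is the integral equation.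
  obtain ⟨ι, _, Θ, V, i₀, hV, hcov, hVb, hΘ₀, hΘ⟩ := B.exists_finite_cover
  obtain ⟨χ, ψ, hχ, hψ, hχV, hψV, hχ1, hψχ⟩ := exists_partitionOfUnity_cutoff hV hcov
  set g : ι → ι → ℂ → (Fin k → ℂ) →L[ℂ] (Fin k → ℂ) := fun i j => transition (Θ i) (Θ j) with hg
  have hgan : ∀ i j z, z ∈ V i → z ∈ V j → AnalyticAt ℂ (g i j) z := fun i j z hi hj =>
    (hΘ i z hi).analyticAt_transition (hΘ j z hj)
  set A : ι → Set ℂ := fun i => tsupport (dbar (ψ i)) with hA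
  obtain ⟨R, hR⟩ : ∃ R, ∀ i, i ≠ i₀ → ∀ z ∈ V i, ‖z‖ ≤ R := by
    have : ∀ i, ∃ R, i ≠ i₀ → ∀ z ∈ V i, ‖z‖ ≤ R := fun i => by
      by_cases hi : i = i₀
      · exact ⟨0, fun h => absurd hi h⟩
      · obtain ⟨R, hR⟩ := (hVb i hi).exists_norm_le
        exact ⟨R, fun _ => hR⟩
    choose R hR using this
    exact ⟨∑ i, |R i|, fun i hi z hz => (hR i hi z hz).trans ((le_abs_self _).trans
      (Finset.single_le_sum (f := fun i => |R i|) (fun _ _ => abs_nonneg _) (Finset.mem_univ i)))⟩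
  have hfar : ∀ z, R < ‖z‖ → (∀ i, i ≠ i₀ → z ∉ V i) ∧ χ i₀ z = 1 := by
    intro z hz
    have h1 : ∀ i, i ≠ i₀ → z ∉ V i := fun i hi h => absurd (hR i hi z h) (not_le.2 hz)
    refine ⟨h1, ?_⟩
    rw [← hχ1 z, Finset.sum_eq_single_of_mem i₀ (Finset.mem_univ _)]
    intro i _ hi
    exact image_eq_zero_of_notMem_tsupport fun h => h1 i hi (hχV i h)
  have hfar_ψ : ∀ z, R < ‖z‖ → ψ i₀ =ᶠ[𝓝 z] fun _ => 1 := fun z hz =>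
    hψχ i₀ z (subset_tsupport _ (by rw [mem_support, (hfar z hz).2]; exact one_ne_zero))
  have hAb : ∀ i, ∀ z ∈ A i, ‖z‖ ≤ R := by
    intro i z hz
    by_contra h
    rw [not_le] at h
    by_cases hi : i = i₀
    · subst hi
      refine (notMem_tsupport_iff_eventuallyEq.2 ?_) hz
      filter_upwards [(hfar_ψ z h).eventually_nhds] with y hy
      exact dbar_eq_zero_of_eventuallyEq_const hy
    · exact (hfar z h).1 i hi (hψV i (tsupport_dbar_subset _ hz))
  have hAc : ∀ i, IsCompact (A i) := fun i =>
    (isCompact_closedBall (0 : ℂ) R).of_isClosed_subset (isClosed_tsupport _)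
      fun z hz => mem_closedBall_zero_iff.2 (hAb i z hz)
  -- The decisive disjointness: `ψ i` is constant near the support of `χ i`, so the Cauchy kernel is
  -- never met on its diagonal.
  have hAχ : ∀ i z, z ∈ A i → z ∉ tsupport (χ i) := by
    intro i z hz hzχ
    refine (notMem_tsupport_iff_eventuallyEq.2 ?_) hz
    filter_upwards [(hψχ i z hzχ).eventually_nhds] with y hy
    exact dbar_eq_zero_of_eventuallyEq_const hy
  -- Supports of the densities, truncated to be compact: beyond `R` the derivatives of the `ψ i`
  -- vanish, and beyond `1` the function `η` does.
  set S : ι → Set ℂ := fun i => tsupport (χ i) ∩ Metric.closedBall 0 (max R 1) with hS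
  have hSc : ∀ i, IsCompact (S i) := fun i =>
    (isCompact_closedBall (0 : ℂ) _).inter_left (isClosed_tsupport _)
  set K : ι → ι → ℂ → (Fin k → ℂ) →L[ℂ] (Fin k → ℂ) := fun j i z =>
    (χ j z * dbar (ψ i) z) • g i j z with hK
  have hKc : ∀ j i, ContDiff ℝ 1 (K j i) := fun j i => by
    refine contDiff_smul_of_tsupport (((hχ j).of_le (by norm_num)).mul (contDiff_dbar (hψ i)))
      fun z hz => hgan i j z ?_ ?_
    · exact hψV i (tsupport_dbar_subset _ (tsupport_mul_subset_right hz))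
    · exact hχV j (tsupport_mul_subset_left hz)
  have hK0 : ∀ j i z, χ j z * dbar (ψ i) z = 0 → K j i z = 0 := fun j i z h => by
    simp only [hK]
    rw [h]
    exact zero_smul ℂ (g i j z)
  obtain ⟨P, hPA, hsol⟩ := exists_solution_integral_equation hKc hAc hSc
    (fun i => disjoint_left.2 fun z hz hz' => hAχ i z hz hz'.1)
    (fun j i z hz => hK0 j i z (by rw [image_eq_zero_of_notMem_tsupport hz, mul_zero]))
  obtain ⟨i₁, hi₁⟩ := hcov 0
  set D : Set ℂ := Metric.ball 0 1 ∩ V i₁ with hD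
  have hDo : IsOpen D := Metric.isOpen_ball.inter (hV i₁)
  set poles : Finset ℂ := Finset.univ.biUnion P with hpoles
  -- Off the poles the polynomial `Q₁` does not vanish, so the value at `q` will be a nonzero
  -- multiple of `v`.
  obtain ⟨q, hqD, hqpoles⟩ : ∃ q ∈ D, q ∉ poles :=
    (infinite_of_mem_nhds (0 : ℂ) (hDo.mem_nhds ⟨Metric.mem_ball_self one_pos, hi₁⟩)).exists_notMem_finset poles
  refine ⟨q, ⟨Θ i₁, hΘ i₁ q hqD.2⟩, fun v => ?_⟩
  obtain ⟨φ, hφ, hφc, hφD, hφ1⟩ := exists_bump hDo hqD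
  set v₀ : Fin k → ℂ := Θ i₁ q v with hv₀
  have hφV : tsupport φ ⊆ V i₁ := hφD.trans inter_subset_right
  -- the right-hand side of the equation
  set η : ℂ → ℂ := fun z => dbar φ z * (z - q)⁻¹ with hη
  have hη0 : η =ᶠ[𝓝 q] fun _ => 0 := by
    filter_upwards [hφ1.eventually_nhds] with y hy
    simp only [hη]
    rw [dbar_eq_zero_of_eventuallyEq_const hy, zero_mul]
  have hηc : ContDiff ℝ 1 η := by
    rw [contDiff_iff_contDiffAt]
    intro z
    by_cases hz : z = q
    · rw [hz]; exact contDiffAt_const.congr_of_eventuallyEq hη0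
    · have h1 : ContDiffAt ℝ 1 (fun z => (z - q)⁻¹) z :=
        (contDiffAt_id.sub contDiffAt_const).inv (sub_ne_zero.2 hz)
      exact (contDiff_dbar hφ).contDiffAt.mul h1
  have hηφ : tsupport η ⊆ tsupport φ :=
    tsupport_mul_subset_left.trans (tsupport_dbar_subset φ)
  have hηq : ∀ z, (z - q) * η z = dbar φ z := by
    intro z
    by_cases hz : z = q
    · rw [hz, sub_self, zero_mul, dbar_eq_zero_of_eventuallyEq_const hφ1]
    · simp only [hη]
      have := sub_ne_zero.2 hz
      field_simp
  set b : ι → ℂ → Fin k → ℂ := fun j z => (χ j z * η z) • g i₁ j z v₀ with hb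
  have hbc : ∀ j, ContDiff ℝ 1 (b j) := fun j => by
    refine contDiff_smul_of_tsupport (((hχ j).of_le (by norm_num)).mul hηc) fun z hz => ?_
    have h1 := hgan i₁ j z (hφV (hηφ (tsupport_mul_subset_right hz)))
      (hχV j (tsupport_mul_subset_left hz))
    exact (ContinuousLinearMap.apply ℂ (Fin k → ℂ) v₀).analyticAt _ |>.comp h1
  have hbs : ∀ j, HasCompactSupport (b j) := fun j =>
    HasCompactSupport.intro hφc.isCompact fun z hz => by
      simp only [hb]
      rw [image_eq_zero_of_notMem_tsupport fun h => hz (hηφ h), mul_zero, zero_smul]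
  obtain ⟨a, ρ, hac, hae⟩ := hsol b hbc hbs
  have haχ : ∀ j z, z ∉ tsupport (χ j) → a j z = 0 := by
    intro j z hz
    have h0 := image_eq_zero_of_notMem_tsupport hz
    rw [hae j z, Finset.sum_eq_zero, sub_zero]
    · simp only [hb]; rw [h0, zero_mul, zero_smul]
    · intro i _
      rw [hK0 j i z (by rw [h0, zero_mul]), ContinuousLinearMap.zero_apply]
  have haS : ∀ j z, z ∉ S j → a j z = 0 := by
    intro j z hz
    by_cases hzχ : z ∈ tsupport (χ j)
    · have hzR : max R 1 < ‖z‖ := by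
        by_contra h
        exact hz ⟨hzχ, mem_closedBall_zero_iff.2 (not_lt.1 h)⟩
      rw [hae j z, Finset.sum_eq_zero, sub_zero]
      · simp only [hb]
        have h1 : z ∉ tsupport η := fun h => by
          have h2 := (hφD (hηφ h)).1
          rw [mem_ball_zero_iff] at h2
          linarith [le_max_right R 1]
        rw [image_eq_zero_of_notMem_tsupport h1, mul_zero, zero_smul]
      · intro i _
        have h1 : z ∉ A i := fun h => by linarith [hAb i z h, le_max_left R 1]
        rw [hK0 j i z (by rw [image_eq_zero_of_notMem_tsupport h1, mul_zero]),
          ContinuousLinearMap.zero_apply]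
    · exact haχ j z hzχ
  have hacs : ∀ j, HasCompactSupport (a j) := fun j => HasCompactSupport.intro (hSc j) (haS j)
  have hT : ∀ j z, (Real.pi : ℂ)⁻¹ • (∫ w in S j, (z - w)⁻¹ • a j w) = cauchyTransform (a j) z := by
    intro j z
    rw [cauchyTransform, setIntegral_eq_integral_of_forall_compl_eq_zero]
    intro w hw
    rw [haS j w hw, smul_zero]
  simp only [hT] at hae
  -- the section
  set Q₁ : ℂ → ℂ := fun z => ∏ p ∈ poles, (z - p) with hQ₁
  set r : ι → ℂ → Fin k → ℂ := fun i z =>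
    (z - q) • ∑ p ∈ P i, (∏ p' ∈ poles.erase p, (z - p')) • ρ i p with hr
  -- This is `(z - q) Q₁ u_i` with the poles of the principal parts cancelled. It is defined
  -- everywhere, and vanishes at `q`.
  set w : ι → ℂ → Fin k → ℂ := fun i z =>
    ((z - q) * Q₁ z) • cauchyTransform (a i) z - r i z with hw
  have hQd : Differentiable ℂ fun z => (z - q) * Q₁ z := by
    refine (differentiable_id.sub_const q).mul ?_
    exact Differentiable.fun_finsetProd fun p _ => differentiable_id.sub_const p
  have hrd : ∀ i, Differentiable ℂ (r i) := fun i =>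
    (differentiable_id.sub_const q).smul (Differentiable.fun_sum fun p _ =>
      (Differentiable.fun_finsetProd fun p _ => differentiable_id.sub_const p).smul_const _)
  have hTd : ∀ i, Differentiable ℝ (cauchyTransform (a i)) := fun i =>
    (contDiff_cauchyTransform (hac i) (hacs i)).differentiable (by norm_num)
  have hwd : ∀ i z, DifferentiableAt ℝ (w i) z ∧ dbar (w i) z = ((z - q) * Q₁ z) • a i z := by
    intro i z
    have h1 := (hQd z).restrictScalars ℝ
    have h2 := (hrd i z).restrictScalars ℝ
    have h4 : DifferentiableAt ℝ (fun z => ((z - q) * Q₁ z) • cauchyTransform (a i) z) z :=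
      h1.smul (hTd i z)
    refine ⟨h4.sub h2, ?_⟩
    simp only [hw]
    rw [dbar_sub h4 h2, dbar_smul h1 (hTd i z), dbar_eq_zero (hQd z),
      dbar_eq_zero (hrd i z), dbar_cauchyTransform (hac i) (hacs i), zero_smul, zero_add, sub_zero]
  set s : ∀ z, N z := fun z => φ z • (Θ i₁ z).inverseOrZero (Q₁ z • v₀) -
    ∑ i, ψ i z • (Θ i z).inverseOrZero (w i z) with hs
  -- the key identity in the fibres
  have hkey : ∀ z, dbar φ z • (Θ i₁ z).inverseOrZero (Q₁ z • v₀) - ∑ i, (dbar (ψ i) z •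
      (Θ i z).inverseOrZero (w i z) + ψ i z • (Θ i z).inverseOrZero (((z - q) * Q₁ z) • a i z))
      = 0 := by
    intro z
    set Y : N z := η z • (Θ i₁ z).inverseOrZero v₀ with hY
    set u : ι → Fin k → ℂ := fun i => cauchyTransform (a i) z - ∑ p ∈ P i, (z - p)⁻¹ • ρ i p
      with hu
    have h1 : dbar φ z • (Θ i₁ z).inverseOrZero (Q₁ z • v₀) = ((z - q) * Q₁ z) • Y := by
      rw [← hηq z, map_smul, hY, smul_smul, smul_smul]
      congr 1; ring
    have h2 : ∀ i, dbar (ψ i) z • (Θ i z).inverseOrZero (w i z) =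
        ((z - q) * Q₁ z) • dbar (ψ i) z • (Θ i z).inverseOrZero (u i) := by
      intro i
      by_cases hz : z ∈ A i
      · have hwu : w i z = ((z - q) * Q₁ z) • u i := by
          simp only [hw, hu, hr]
          rw [smul_sub]
          congr 1
          rw [mul_smul]
          congr 1
          rw [Finset.smul_sum]
          refine Finset.sum_congr rfl fun p hp => ?_
          have hzp : z - p ≠ 0 := sub_ne_zero.2 fun h => hPA i p hp (h ▸ hz)
          rw [smul_smul]
          congr 1
          simp only [hQ₁]
          rw [← Finset.mul_prod_erase poles (fun p => z - p)
            (Finset.mem_biUnion.2 ⟨i, Finset.mem_univ _, hp⟩)]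
          field_simp
        rw [hwu, map_smul, smul_comm]
      · rw [image_eq_zero_of_notMem_tsupport hz, zero_smul, zero_smul, smul_zero]
    have h3 : ∀ i, ψ i z • (Θ i z).inverseOrZero (((z - q) * Q₁ z) • a i z) =
        ((z - q) * Q₁ z) • (Θ i z).inverseOrZero (a i z) := by
      intro i
      by_cases hz : z ∈ tsupport (χ i)
      · rw [(hψχ i z hz).self_of_nhds, one_smul, map_smul]
      · rw [haχ i z hz, smul_zero, map_zero, smul_zero, smul_zero]
    -- The integral equation transported to the fibre, where all components `a i` come from one
    -- vector, weighted by `χ i`.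
    have h4 : ∀ i, (Θ i z).inverseOrZero (a i z) =
        χ i z • (Y - ∑ l, dbar (ψ l) z • (Θ l z).inverseOrZero (u l)) := by
      intro i
      by_cases hz : z ∈ tsupport (χ i)
      · have hbij := (hΘ i z (hχV i hz)).self_of_nhds.1
        rw [hae i z]
        simp only [hb, hK, hg, ContinuousLinearMap.smul_apply, transition_apply]
        rw [map_sub, map_sum, smul_sub, Finset.smul_sum]
        simp only [map_smul, LinearMap.inverseOrZero_apply hbij, mul_smul]
        rfl
      · rw [haχ i z hz, image_eq_zero_of_notMem_tsupport hz, map_zero, zero_smul]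
    rw [h1, Finset.sum_add_distrib]
    simp only [h2, h3]
    simp only [h4]
    rw [← Finset.smul_sum, ← Finset.smul_sum, ← Finset.sum_smul, hχ1, one_smul, ← smul_add,
      ← smul_sub]
    simp
  have hhol : ∀ z, B.HolAt s z := by
    intro z
    obtain ⟨j, hj⟩ := hcov z
    refine (hΘ j z hj).holAt_of_dbar ?_
    filter_upwards [(hV j).mem_nhds hj] with y hy
    have hQ₁d : DifferentiableAt ℂ (fun z => Q₁ z • v₀) y :=
      (Differentiable.fun_finsetProd fun p _ => differentiable_id.sub_const p).smul_const v₀ y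
    have h1 := dbar_smul_clm_apply_of_tsupport ((hφ.differentiable (by norm_num)) y)
      (g := g i₁ j) (fun h => hgan i₁ j y (hφV h) hy) (hQ₁d.restrictScalars ℝ)
    have h2 := fun i => dbar_smul_clm_apply_of_tsupport (((hψ i).differentiable (by norm_num)) y)
      (g := g i j) (fun h => hgan i j y (hψV i h) hy) (hwd i y).1
    have h3 : (fun y => Θ j y (s y)) = fun y => φ y • g i₁ j y (Q₁ y • v₀) -
        ∑ i, ψ i y • g i j y (w i y) := by
      funext y
      simp only [hs, hg, transition_apply, map_sub, map_sum, map_smul]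
    have h4 : DifferentiableAt ℝ (fun y => ∑ i, ψ i y • g i j y (w i y)) y :=
      DifferentiableAt.fun_sum fun i _ => (h2 i).1
    rw [h3]
    refine ⟨h1.1.sub h4, ?_⟩
    rw [dbar_sub h1.1 h4, dbar_sum fun i _ => (h2 i).1, h1.2, dbar_eq_zero hQ₁d]
    simp only [(h2 _).2, (hwd _ y).2]
    have h5 := congrArg (Θ j y) (hkey y)
    simp only [map_sub, map_sum, map_add, map_smul, map_zero] at h5
    simp only [hg, transition_apply, map_zero, smul_zero, add_zero, map_smul]
    exact h5
  have hwq : ∀ i, w i q = 0 := fun i => by simp [hw, hr]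
  refine ⟨s, poles.card + 1, Q₁ q, hhol, ?_, ?_, ?_⟩
  · have h1 := tendsto_cauchyTransform_cobounded (hac i₀).continuous (hacs i₀)
    have h2 : Tendsto (fun z : ℂ => z ^ (-(poles.card + 1 : ℤ)) * ((z - q) * Q₁ z)) (cobounded ℂ)
        (𝓝 1) := by
      have := tendsto_zpow_mul_prod_sub (insert q poles)
      rw [Finset.card_insert_of_notMem hqpoles] at this
      simpa only [Finset.prod_insert hqpoles, Nat.cast_add, Nat.cast_one] using this
    -- Each term of `r i₀` lacks one of the factors `z - p`, so its degree is one less than that of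
    -- `(z - q) Q₁`.
    have h3 : Tendsto (fun z : ℂ => z ^ (-(poles.card + 1 : ℤ)) • r i₀ z) (cobounded ℂ) (𝓝 0) := by
      have h4 : ∀ p ∈ P i₀, Tendsto (fun z : ℂ => z⁻¹ • (z ^ (-(poles.card : ℤ)) *
          ∏ p' ∈ insert q (poles.erase p), (z - p')) • ρ i₀ p) (cobounded ℂ) (𝓝 0) := by
        intro p hp
        have hppoles : p ∈ poles := Finset.mem_biUnion.2 ⟨i₀, Finset.mem_univ _, hp⟩
        have h5 := tendsto_zpow_mul_prod_sub (insert q (poles.erase p))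
        rw [Finset.card_insert_of_notMem fun h => hqpoles (Finset.mem_of_mem_erase h),
          Finset.card_erase_add_one hppoles] at h5
        have h6 := (tendsto_inv₀_cobounded (α := ℂ)).smul (h5.smul_const (ρ i₀ p))
        rwa [zero_smul] at h6
      have h7 := tendsto_finsetSum _ h4
      rw [Finset.sum_const_zero] at h7
      refine h7.congr' ?_
      filter_upwards [eventually_ne_cobounded (0 : ℂ)] with z hz
      simp only [hr, Finset.smul_sum]
      refine Finset.sum_congr rfl fun p hp => ?_
      rw [Finset.prod_insert fun h => hqpoles (Finset.mem_of_mem_erase h), smul_smul, smul_smul,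
        smul_smul, neg_add, zpow_add₀ hz, zpow_neg_one]
      congr 1; ring
    have h8 := ((h2.smul h1).sub h3).neg
    rw [smul_zero, sub_zero, neg_zero] at h8
    refine h8.congr' ?_
    have hev : ∀ᶠ z : ℂ in cobounded ℂ, max R 1 < ‖z‖ :=
      tendsto_norm_cobounded_atTop.eventually (eventually_gt_atTop _)
    filter_upwards [hev, B.eventually_triv] with z hz hzt
    have hzR : R < ‖z‖ := (le_max_left _ _).trans_lt hz
    -- Near `∞` only the patch `i₀` contributes, with cutoff `1`.
    have h9 : s z = -(B.triv z).inverseOrZero (w i₀ z) := by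
      have h10 : φ z = 0 := image_eq_zero_of_notMem_tsupport fun h => by
        have h2 := (hφD h).1
        rw [mem_ball_zero_iff] at h2
        linarith [le_max_right R 1]
      simp only [hs]
      rw [h10, zero_smul, zero_sub, Finset.sum_eq_single_of_mem i₀ (Finset.mem_univ _),
        (hfar_ψ z hzR).self_of_nhds, one_smul, hΘ₀]
      intro i _ hi
      rw [image_eq_zero_of_notMem_tsupport fun h => (hfar z hzR).1 i hi (hψV i h), zero_smul]
    rw [h9, map_neg, LinearMap.apply_inverseOrZero hzt.1, smul_neg]
    simp only [hw, smul_sub, smul_smul]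
  · simp only [hQ₁]
    exact Finset.prod_ne_zero_iff.2 fun p hp => sub_ne_zero.2 fun h => hqpoles (h ▸ hp)
  · simp only [hs, hwq, map_zero, smul_zero, Finset.sum_const_zero, sub_zero]
    rw [hφ1.self_of_nhds, one_smul, map_smul, hv₀,
      LinearMap.inverseOrZero_apply (hΘ i₁ q hqD.2).self_of_nhds.1]

/-- Sections through the vectors of a basis at `q` take nonzero multiples of them as values, hence
are independent there. -/
theorem exists_isFrameCandidate : ∃ s d, B.IsFrameCandidate s d := by
  obtain ⟨q, ⟨Θ, hΘ⟩, h⟩ := B.exists_section_through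
  have hbij := hΘ.self_of_nhds.1
  let e := LinearEquiv.ofBijective (Θ q) hbij
  choose s d c hs hd hc hsq using fun i : Fin k => h (e.symm (Pi.single i 1))
  refine ⟨s, d, hs, fun i => ⟨0, hd i⟩, q, ?_⟩
  have h1 : LinearIndependent ℂ fun i : Fin k => e.symm (Pi.single i 1) := by
    have := (Pi.basisFun ℂ (Fin k)).linearIndependent.map' e.symm.toLinearMap e.symm.ker
    simpa [Function.comp_def] using this
  have h2 := h1.units_smul fun i => Units.mk0 (c i) (hc i)
  convert h2 using 1
  funext i
  rw [hsq]; rfl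

end HolomorphicBundle

end MeromorphicSectionsExist

/-! ### Components in a holomorphic frame -/

section MatrixInverse

/-- By Cramer's rule the inverse is the adjugate over the determinant, both polynomial in the
entries. -/
theorem contDiffAt_inv_mulVec {k : ℕ} {p : (Fin k → Fin k → ℂ) × (Fin k → ℂ)}
    (hp : (Matrix.of p.1).det ≠ 0) : ContDiffAt ℂ ω
      (fun p : (Fin k → Fin k → ℂ) × (Fin k → ℂ) => (Matrix.of p.1)⁻¹.mulVec p.2) p := by
  have hdet : ∀ A : (Fin k → Fin k → ℂ) × (Fin k → ℂ) → Matrix (Fin k) (Fin k) ℂ,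
      (∀ i j, ContDiff ℂ ω fun p => A p i j) → ContDiff ℂ ω fun p => (A p).det := by
    intro A hA
    simp only [Matrix.det_apply]
    exact ContDiff.sum fun σ _ => (contDiff_prod fun i _ => hA _ _).const_smul _
  have hentry : ∀ i j, ContDiff ℂ ω
      fun p : (Fin k → Fin k → ℂ) × (Fin k → ℂ) => Matrix.of p.1 i j := by
    intro i j
    exact (contDiff_apply_apply ℂ ℂ i j).comp contDiff_fst
  have hadj : ∀ i j, ContDiff ℂ ω
      fun p : (Fin k → Fin k → ℂ) × (Fin k → ℂ) => (Matrix.of p.1).adjugate i j := by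
    intro i j
    simp only [Matrix.adjugate_apply]
    refine hdet _ fun a b => ?_
    by_cases ha : a = j
    · subst ha; simp only [Matrix.updateRow_self]; exact contDiff_const
    · simp only [Matrix.updateRow_ne ha]; exact hentry a b
  rw [contDiffAt_pi]
  intro i
  simp only [Matrix.mulVec, dotProduct, Matrix.inv_def, Matrix.smul_apply, Ring.inverse_eq_inv',
    smul_eq_mul]
  refine ContDiffAt.sum fun j _ => ?_
  refine (((hdet _ hentry).contDiffAt.inv hp).mul (hadj i j).contDiffAt).mul ?_
  exact ((contDiff_apply ℂ ℂ j).comp contDiff_snd).contDiffAt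

/-- The components of a holomorphic section in a holomorphic frame are holomorphic. -/
theorem contMDiffAt_basis_repr {k : ℕ} {E X : Type*} [NormedAddCommGroup E] [NormedSpace ℂ E]
    [TopologicalSpace X] [ChartedSpace E X] {N : X → Type*} [∀ y, AddCommGroup (N y)]
    [∀ y, Module ℂ (N y)] {Θ : ∀ y, N y →ₗ[ℂ] (Fin k → ℂ)} {x : X}
    (hΘ : ∀ᶠ y in 𝓝 x, Bijective (Θ y)) {b : ∀ y, Module.Basis (Fin k) ℂ (N y)} {s : ∀ y, N y}
    (hb : ∀ i, ContMDiffAt 𝓘(ℂ, E) 𝓘(ℂ, Fin k → ℂ) ω (fun y => Θ y (b y i)) x)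
    (hs : ContMDiffAt 𝓘(ℂ, E) 𝓘(ℂ, Fin k → ℂ) ω (fun y => Θ y (s y)) x) :
    ContMDiffAt 𝓘(ℂ, E) 𝓘(ℂ, Fin k → ℂ) ω (fun y => ((b y).repr (s y) : Fin k → ℂ)) x := by
  set A : X → Fin k → Fin k → ℂ := fun y i j => Θ y (b y j) i with hA
  have hdet : ∀ y, Bijective (Θ y) → (Matrix.of (A y)).det ≠ 0 := by
    intro y hy
    have h2 : Matrix.of (A y) = (Pi.basisFun ℂ (Fin k)).toMatrix
        ((b y).map (LinearEquiv.ofBijective (Θ y) hy)) := by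
      ext i j
      simp [hA, Module.Basis.toMatrix_apply]
    rw [h2, ← isUnit_iff_ne_zero, ← Matrix.isUnit_iff_isUnit_det]
    have := Module.Basis.invertibleToMatrix (Pi.basisFun ℂ (Fin k))
        ((b y).map (LinearEquiv.ofBijective (Θ y) hy))
    exact isUnit_of_invertible _
  have hA' : ContMDiffAt 𝓘(ℂ, E) 𝓘(ℂ, Fin k → Fin k → ℂ) ω A x := by
    rw [contMDiffAt_pi_space]
    intro i
    rw [contMDiffAt_pi_space]
    intro j
    exact contMDiffAt_pi_space.1 (hb j) i
  have h1 := (contDiffAt_inv_mulVec (p := (A x, Θ x (s x)))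
    (hdet x hΘ.self_of_nhds)).contMDiffAt.comp x (hA'.prodMk_space hs)
  refine h1.congr_of_eventuallyEq ?_
  filter_upwards [hΘ] with y hy
  have h2 : (Matrix.of (A y)).mulVec ((b y).repr (s y)) = Θ y (s y) := by
    conv_rhs => rw [← (b y).sum_repr (s y), map_sum]
    ext i
    simp [Matrix.mulVec, dotProduct, hA, mul_comm]
  simp only [comp_apply]
  rw [← h2, Matrix.mulVec_mulVec, Matrix.nonsing_inv_mul _ (isUnit_iff_ne_zero.2 (hdet y hy)),
    Matrix.one_mulVec]

end MatrixInverse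

/-! ### Holomorphy on the projective line in its two coordinates -/

section Coordinates

variable {V : Type*} [NormedAddCommGroup V] [NormedSpace ℂ V] [CompleteSpace V]

theorem contMDiffAt_complex_iff_analyticAt {c : ℂ → V} {z : ℂ} :
    ContMDiffAt 𝓘(ℂ) 𝓘(ℂ, V) ω c z ↔ AnalyticAt ℂ c z := by
  rw [contMDiffAt_iff_contDiffAt]
  exact ⟨fun h => h.analyticAt, fun h => h.contDiffAt⟩

namespace ProjLine

theorem contMDiffAt_iff_chart {e : OpenPartialHomeomorph (OnePoint ℂ) ℂ}
    (he : e ∈ atlas ℂ (OnePoint ℂ)) (het : e.target = univ) {c : OnePoint ℂ → V} (z : ℂ) :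
    ContMDiffAt 𝓘(ℂ) 𝓘(ℂ, V) ω c (e.symm z) ↔ AnalyticAt ℂ (fun z => c (e.symm z)) z := by
  have he' : e ∈ IsManifold.maximalAtlas 𝓘(ℂ) ω (OnePoint ℂ) :=
    IsManifold.subset_maximalAtlas he
  have hz : z ∈ e.target := het ▸ mem_univ z
  rw [← contMDiffAt_complex_iff_analyticAt]
  constructor
  · intro h
    have h1 := (contMDiffOn_symm_of_mem_maximalAtlas he').contMDiffAt (e.open_target.mem_nhds hz)
    exact h.comp z h1
  · intro h
    have h1 := (contMDiffOn_of_mem_maximalAtlas he').contMDiffAt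
      (e.open_source.mem_nhds (e.map_target hz))
    have h2 : ContMDiffAt 𝓘(ℂ) 𝓘(ℂ, V) ω (fun z => c (e.symm z)) (e (e.symm z)) := by
      rwa [e.right_inv hz]
    refine (h2.comp _ h1).congr_of_eventuallyEq ?_
    filter_upwards [e.open_source.mem_nhds (e.map_target hz)] with y hy
    simp only [comp_apply, e.left_inv hy]

theorem contMDiffAt_coe_iff {c : OnePoint ℂ → V} (z : ℂ) :
    ContMDiffAt 𝓘(ℂ) 𝓘(ℂ, V) ω c (z : OnePoint ℂ) ↔ AnalyticAt ℂ (fun z : ℂ => c z) z := by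
  have := contMDiffAt_iff_chart (e := chartZero) (Or.inl rfl) (by simp [chartZero]) (c := c) z
  simpa only [chartZero_symm] using this

theorem contMDiffAt_inv_iff {c : OnePoint ℂ → V} (z : ℂ) :
    ContMDiffAt 𝓘(ℂ) 𝓘(ℂ, V) ω c (inv z) ↔ AnalyticAt ℂ (fun z : ℂ => c (inv z)) z := by
  have := contMDiffAt_iff_chart (e := chartInfty) (Or.inr rfl)
    (by simp [chartInfty, chartZero]) (c := c) z
  simpa only [chartInfty_symm] using this

theorem tendsto_coe_cobounded :
    Filter.Tendsto ((↑) : ℂ → OnePoint ℂ) (Bornology.cobounded ℂ) (𝓝 OnePoint.infty) := by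
  have := OnePoint.tendsto_coe_infty (X := ℂ)
  rwa [Filter.coclosedCompact_eq_cocompact, ← Metric.cobounded_eq_cocompact] at this

end ProjLine

end Coordinates

/-! ### Splitting of the normal bundle -/

section NormalBundle

variable {EZ EM EF Z M F : Type*}
  [NormedAddCommGroup EZ] [NormedSpace ℂ EZ] [TopologicalSpace Z] [ChartedSpace EZ Z]
  [IsManifold 𝓘(ℂ, EZ) ω Z]
  [NormedAddCommGroup EM] [NormedSpace ℂ EM] [TopologicalSpace M] [ChartedSpace EM M]
  [IsManifold 𝓘(ℂ, EM) ω M]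
  [NormedAddCommGroup EF] [NormedSpace ℂ EF] [TopologicalSpace F] [ChartedSpace EF F]

namespace RationalCurveFamily

variable {proj : Z → OnePoint ℂ} (C : RationalCurveFamily EZ EM EF M F proj)

open Filter Bornology ProjLine

variable {C} in
theorem isHolomorphicSection_iff {x : M} {V : Set (OnePoint ℂ)} {s : ∀ ζ, C.Normal x ζ} :
    C.IsHolomorphicSection x V s ↔ ∀ ζ ∈ V, C.IsHolomorphicSection x {ζ} s :=
  ⟨fun h _ hζ ζ' hζ' => h ζ' (mem_singleton_iff.1 hζ' ▸ hζ), fun h ζ hζ => h ζ hζ ζ rfl⟩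

/-- A local trivialisation of the normal bundle of `X_x` near `ζ₀`. -/
def IsLocalTriv (k : ℕ) (x : M) (Θ : ∀ ζ, C.Normal x ζ →ₗ[ℂ] (Fin k → ℂ)) (ζ₀ : OnePoint ℂ) :
    Prop :=
  ∀ᶠ ζ in 𝓝 ζ₀, Bijective (Θ ζ) ∧ ∀ s : ∀ ζ, C.Normal x ζ, C.IsHolomorphicSection x {ζ} s ↔
    ContMDiffAt 𝓘(ℂ) 𝓘(ℂ, Fin k → ℂ) ω (fun ξ => Θ ξ (s ξ)) ζ

/-- Extension of a section over the complex plane to the projective line. -/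
def extend (x : M) (v : C.Normal x OnePoint.infty) (s : ∀ z : ℂ, C.Normal x (z : OnePoint ℂ)) :
    ∀ ζ, C.Normal x ζ :=
  fun ζ => @OnePoint.rec ℂ (fun ζ => C.Normal x ζ) v s ζ

variable {C} {k : ℕ} {x : M} {Θ : ∀ ζ, C.Normal x ζ →ₗ[ℂ] (Fin k → ℂ)}

theorem IsLocalTriv.coe {z₀ : ℂ} (h : C.IsLocalTriv k x Θ z₀) :
    ∀ᶠ z : ℂ in 𝓝 z₀, Bijective (Θ z) ∧ ∀ s : ∀ ζ, C.Normal x ζ,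
      C.IsHolomorphicSection x {(z : OnePoint ℂ)} s ↔
        AnalyticAt ℂ (fun y : ℂ => Θ y (s y)) z := by
  filter_upwards [(OnePoint.continuous_coe.continuousAt (x := z₀)).eventually h] with z hz
  refine ⟨hz.1, fun s => (hz.2 s).trans ?_⟩
  exact contMDiffAt_coe_iff (c := fun ξ => Θ ξ (s ξ)) z

theorem IsLocalTriv.infty (h : C.IsLocalTriv k x Θ OnePoint.infty) :
    ∀ᶠ z : ℂ in cobounded ℂ, Bijective (Θ z) ∧ ∀ s : ∀ ζ, C.Normal x ζ,
      C.IsHolomorphicSection x {(z : OnePoint ℂ)} s ↔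
        AnalyticAt ℂ (fun y : ℂ => Θ y (s y)) z := by
  filter_upwards [tendsto_coe_cobounded.eventually h] with z hz
  refine ⟨hz.1, fun s => (hz.2 s).trans ?_⟩
  exact contMDiffAt_coe_iff (c := fun ξ => Θ ξ (s ξ)) z

theorem IsLocalTriv.inv {z₀ : ℂ} (h : C.IsLocalTriv k x Θ (ProjLine.inv z₀)) :
    ∀ᶠ z : ℂ in 𝓝 z₀, Bijective (Θ (ProjLine.inv z)) ∧ ∀ s : ∀ ζ, C.Normal x ζ,
      C.IsHolomorphicSection x {ProjLine.inv z} s ↔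
        AnalyticAt ℂ (fun y : ℂ => Θ (ProjLine.inv y) (s (ProjLine.inv y))) z := by
  have hc : ContinuousAt (fun z : ℂ => ProjLine.inv (z : OnePoint ℂ)) z₀ :=
    (ProjLine.inv.continuous.comp OnePoint.continuous_coe).continuousAt
  filter_upwards [hc.eventually h] with z hz
  refine ⟨hz.1, fun s => (hz.2 s).trans ?_⟩
  exact contMDiffAt_inv_iff (c := fun ξ => Θ ξ (s ξ)) z

/-- The normal bundle of `X_x`, restricted to the complex plane, with a trivialisation near `∞`. -/
def normalBundle (hloc : ∀ ζ₀, ∃ Θ, C.IsLocalTriv k x Θ ζ₀)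
    (h : C.IsLocalTriv k x Θ OnePoint.infty) :
    HolomorphicBundle k (fun z : ℂ => C.Normal x (z : OnePoint ℂ)) where
  -- The value at `∞` is arbitrary: holomorphy at a finite point does not see it.
  HolAt s z := C.IsHolomorphicSection x {(z : OnePoint ℂ)} (C.extend x 0 s)
  exists_triv z₀ := by
    obtain ⟨Θ, hΘ⟩ := hloc z₀
    exact ⟨fun z => Θ z, hΘ.coe.mono fun z hz => ⟨hz.1, fun s => hz.2 _⟩⟩
  triv z := Θ z
  eventually_triv := h.infty.mono fun z hz => ⟨hz.1, fun s => hz.2 _⟩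

theorem isHolomorphicSection_congr (hloc : ∀ ζ₀, ∃ Θ, C.IsLocalTriv k x Θ ζ₀)
    {s t : ∀ ζ, C.Normal x ζ} {ζ₀ : OnePoint ℂ} (hs : C.IsHolomorphicSection x {ζ₀} s)
    (h : ∀ᶠ ζ in 𝓝 ζ₀, s ζ = t ζ) : C.IsHolomorphicSection x {ζ₀} t := by
  obtain ⟨Θ, hΘ⟩ := hloc ζ₀
  refine (hΘ.self_of_nhds.2 t).2 (((hΘ.self_of_nhds.2 s).1 hs).congr_of_eventuallyEq ?_)
  filter_upwards [h] with ζ hζ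
  rw [hζ]

theorem eventually_coe_of_forall {p : OnePoint ℂ → Prop} (h : ∀ z : ℂ, p z) (z : ℂ) :
    ∀ᶠ ζ in 𝓝 (z : OnePoint ℂ), p ζ := by
  filter_upwards [isOpen_compl_singleton.mem_nhds (OnePoint.coe_ne_infty z)] with ζ hζ
  induction ζ using OnePoint.rec with
  | infty => exact absurd rfl hζ
  | coe y => exact h y

theorem normalBundle_holAt_iff (hloc : ∀ ζ₀, ∃ Θ, C.IsLocalTriv k x Θ ζ₀)
    (h : C.IsLocalTriv k x Θ OnePoint.infty) (s : ∀ ζ, C.Normal x ζ) (z : ℂ) :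
    (normalBundle hloc h).HolAt (fun z => s z) z ↔ C.IsHolomorphicSection x {(z : OnePoint ℂ)} s := by
  have h1 : ∀ᶠ ζ in 𝓝 (z : OnePoint ℂ), C.extend x 0 (fun z => s z) ζ = s ζ :=
    eventually_coe_of_forall (fun _ => rfl) z
  exact ⟨fun hs => isHolomorphicSection_congr hloc hs h1,
    fun hs => isHolomorphicSection_congr hloc hs (h1.mono fun _ => Eq.symm)⟩

/-- Translates poles at `∞` into holomorphy on `ℙ¹`: in the coordinate `1 / z` the rescaled section
is holomorphic, with the leading coefficient as its value at `0`. -/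
theorem normalBundle_infty (hloc : ∀ ζ₀, ∃ Θ, C.IsLocalTriv k x Θ ζ₀)
    (h : C.IsLocalTriv k x Θ OnePoint.infty) {s : ∀ z : ℂ, C.Normal x (z : OnePoint ℂ)}
    (hs : ∀ z, (normalBundle hloc h).HolAt s z) {d : ℤ} {v : C.Normal x OnePoint.infty}
    (hL : (normalBundle hloc h).HasLeadingCoeff s d (Θ _ v)) :
    C.IsHolomorphicSection x {OnePoint.infty} (C.extend x v fun z => z ^ (-d) • s z) := by
  obtain ⟨f, hf, hf0, hfs⟩ := HolomorphicBundle.exists_analyticAt_of_hasLeadingCoeff hs hL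
  set F : OnePoint ℂ → (Fin k → ℂ) := fun ζ => Θ ζ (C.extend x v (fun z => z ^ (-d) • s z) ζ)
  refine (h.self_of_nhds.2 _).2 ?_
  change ContMDiffAt 𝓘(ℂ) 𝓘(ℂ, Fin k → ℂ) ω F OnePoint.infty
  rw [← ProjLine.inv_zero, contMDiffAt_inv_iff]
  refine hf.congr ?_
  have h1 : ∀ᶠ w : ℂ in 𝓝[≠] 0, f w = F (ProjLine.inv w) := by
    filter_upwards [Filter.tendsto_inv₀_nhdsNE_zero.eventually hfs, self_mem_nhdsWithin]
      with w hw hw0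
    rw [_root_.inv_inv] at hw
    rw [inv_coe hw0, hw]
    exact (map_smul _ _ _).symm
  rw [eventually_nhdsWithin_iff] at h1
  filter_upwards [h1] with w hw
  by_cases hw0 : w = 0
  · subst hw0
    rw [ProjLine.inv_zero, hf0]
    rfl
  · exact hw hw0

/-- A section without pole extends over `∞` to a global section, hence comes from the
finite-dimensional space `T_x M`. This is the only use of completeness in the splitting. -/
theorem finiteDimensional_sectionsWithPole [FiniteDimensional ℂ EM]
    (hloc : ∀ ζ₀, ∃ Θ, C.IsLocalTriv k x Θ ζ₀)
    (h : C.IsLocalTriv k x Θ OnePoint.infty) (hC : range (C.kodaira x) = C.globalSections x) :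
    FiniteDimensional ℂ ((normalBundle hloc h).sectionsWithPole 0) := by
  let f : EM →ₗ[ℂ] ∀ z : ℂ, C.Normal x (z : OnePoint ℂ) :=
    LinearMap.pi fun z => C.kodairaAt (C.sec x z)
  refine Submodule.finiteDimensional_of_le (S₂ := LinearMap.range f) ?_
  rintro s ⟨hs, L, hL⟩
  obtain ⟨v, hv⟩ := h.self_of_nhds.1.2 L
  have h1 := normalBundle_infty hloc h hs (hv.symm ▸ hL)
  simp only [neg_zero, zpow_zero, one_smul] at h1
  have h2 : C.extend x v s ∈ C.globalSections x := by
    refine isHolomorphicSection_iff.2 fun ζ _ => ?_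
    induction ζ using OnePoint.rec with
    | infty => exact h1
    | coe z => exact (normalBundle_holAt_iff hloc h (C.extend x v s) z).1 (hs z)
  rw [← hC] at h2
  obtain ⟨u, hu⟩ := h2
  refine ⟨u, ?_⟩
  funext z
  exact congrFun hu z

/-- The frames of the trivialisation exhibit the normal bundle as a sum of line bundles. -/
def Trivialisation.IsAdapted (T : C.Trivialisation k x) (n : Fin k → ℤ) : Prop :=
  ∀ l : ℂ, l ≠ 0 → ∀ i, T.frame i l = l ^ (-n i) • T.frameHat i l

/-- The sections of the minimal frame serve over `U`; divided by `z ^ d i` and extended by their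
leading coefficients, they serve over `Û`. A pole of order `d i` thus gives the summand `O(-d i)`.
-/
theorem exists_isAdapted_aux [FiniteDimensional ℂ EM] (hloc : ∀ ζ₀, ∃ Θ, C.IsLocalTriv k x Θ ζ₀)
    (hC : range (C.kodaira x) = C.globalSections x) :
    ∃ (n : Fin k → ℤ) (T : C.Trivialisation k x), T.IsAdapted n := by
  obtain ⟨Θ, h⟩ := hloc OnePoint.infty
  obtain ⟨s, d, L, hs, hL, hli, hLi⟩ := (normalBundle hloc h).exists_frame
    (finiteDimensional_sectionsWithPole hloc h hC) (normalBundle hloc h).exists_isFrameCandidate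
  choose v hv using fun i => h.self_of_nhds.1.2 (L i)
  have hrank : ∀ ζ, Module.finrank ℂ (C.Normal x ζ) = k := by
    intro ζ
    obtain ⟨Θ', h'⟩ := hloc ζ
    rw [(LinearEquiv.ofBijective _ h'.self_of_nhds.1).finrank_eq, Module.finrank_fin_fun]
  have hspan : ∀ ζ (b : Fin k → C.Normal x ζ), LinearIndependent ℂ b →
      ⊤ ≤ Submodule.span ℂ (range b) := by
    intro ζ b hb
    have : FiniteDimensional ℂ (C.Normal x ζ) := by
      obtain ⟨Θ', h'⟩ := hloc ζ
      exact (LinearEquiv.ofBijective _ h'.self_of_nhds.1).symm.finiteDimensional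
    rw [hb.span_eq_top_of_card_eq_finrank' (by rw [hrank, Fintype.card_fin])]
  have hliHat : ∀ ζ ∈ Uhat, LinearIndependent ℂ fun i =>
      C.extend x (v i) (fun z => z ^ (-d i) • s i z) ζ := by
    intro ζ hζ
    induction ζ using OnePoint.rec with
    | infty =>
      have h1 : LinearIndependent ℂ fun i => Θ OnePoint.infty (v i) := by
        simpa only [hv] using hLi
      exact LinearIndependent.of_comp (Θ OnePoint.infty) h1
    | coe z =>
      have hz : z ≠ 0 := fun h0 => hζ (by rw [h0]; rfl)
      exact (hli z).units_smul fun i => Units.mk0 (z ^ (-d i)) (zpow_ne_zero _ hz)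
  have hsm : ∀ i, ∀ z : ℂ, z ≠ 0 → (normalBundle hloc h).HolAt (fun z => z ^ (-d i) • s i z) z := by
    intro i z hz
    refine (hs i z).smul ?_
    exact AnalyticAt.zpow analyticAt_id hz
  refine ⟨fun i => -d i, ⟨fun i => C.extend x 0 (s i),
    fun i => C.extend x (v i) (fun z => z ^ (-d i) • s i z), ⟨fun i => ?_, fun ζ hζ => ?_,
      fun ζ hζ => ?_⟩, ⟨fun i => ?_, hliHat, fun ζ hζ => hspan ζ _ (hliHat ζ hζ)⟩⟩, ?_⟩
  · refine isHolomorphicSection_iff.2 fun ζ hζ => ?_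
    induction ζ using OnePoint.rec with
    | infty => exact absurd rfl hζ
    | coe z => exact hs i z
  · induction ζ using OnePoint.rec with
    | infty => exact absurd rfl hζ
    | coe z => exact hli z
  · induction ζ using OnePoint.rec with
    | infty => exact absurd rfl hζ
    | coe z => exact hspan _ _ (hli z)
  · refine isHolomorphicSection_iff.2 fun ζ hζ => ?_
    induction ζ using OnePoint.rec with
    | infty => exact normalBundle_infty hloc h (hs i) ((hv i).symm ▸ hL i)
    | coe z =>
      have hz : z ≠ 0 := fun h0 => hζ (by rw [h0]; rfl)
      exact (normalBundle_holAt_iff hloc h _ z).1 (hsm i z hz)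
  · intro l hl i
    change s i l = l ^ (- -d i) • l ^ (-d i) • s i l
    rw [smul_smul, ← zpow_add₀ hl, neg_add_cancel, zpow_zero, one_smul]

/-- The Birkhoff-Grothendieck theorem for the normal bundle of `X_x`. -/
theorem exists_isAdapted [FiniteDimensional ℂ EM] (hloc : ∀ ζ₀, ∃ Θ, C.IsLocalTriv k x Θ ζ₀)
    (hC : range (C.kodaira x) = C.globalSections x) :
    ∃ (n : Fin k → ℤ) (T : C.Trivialisation k x), Antitone n ∧ T.IsAdapted n := by
  obtain ⟨n, T, hT⟩ := exists_isAdapted_aux hloc hC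
  let σ : Equiv.Perm (Fin k) := Tuple.sort fun i => -n i
  refine ⟨n ∘ σ, ⟨fun i => T.frame (σ i), fun i => T.frameHat (σ i), ⟨fun i => T.isFrame.1 _,
    fun ζ hζ => (T.isFrame.2 ζ hζ).comp _ σ.injective, fun ζ hζ => ?_⟩,
    ⟨fun i => T.isFrameHat.1 _, fun ζ hζ => (T.isFrameHat.2 ζ hζ).comp _ σ.injective,
      fun ζ hζ => ?_⟩⟩, ?_, fun l hl i => hT l hl _⟩
  · exact (T.isFrame.3 ζ hζ).trans_eq
      (congrArg _ (σ.surjective.range_comp fun i => T.frame i ζ).symm)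
  · exact (T.isFrameHat.3 ζ hζ).trans_eq
      (congrArg _ (σ.surjective.range_comp fun i => T.frameHat i ζ).symm)
  · intro i j hij
    have := Tuple.monotone_sort (fun i => -n i) hij
    exact neg_le_neg_iff.1 this

end RationalCurveFamily

end NormalBundle

/-! ### Polynomials as sections of line bundles -/

section Polynomials

open Filter Bornology

/-- A function that is entire in `l`, and that after multiplication with a power of `l` is entire in
`1 / l`, is a polynomial. -/
theorem exists_coeff_of_mul_eq_pow_mul (n : ℕ) {a b : ℂ → ℂ} (ha : Differentiable ℂ a)
    (hb : Differentiable ℂ b) (h : ∀ l ≠ 0, a l * l = l ^ n * b l⁻¹) :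
    ∃ c : Fin n → ℂ, ∀ l, a l = ∑ j, c j * l ^ (j : ℕ) := by
  -- Here `n` counts coefficients, one more than the degree. For `n = 0` the function tends to `0`
  -- at `∞` and vanishes by Liouville; the inductive step splits off the constant term.
  induction n generalizing a b with
  | zero =>
    refine ⟨fun j => j.elim0, fun l => ?_⟩
    rw [Fin.sum_univ_zero]
    refine ha.apply_eq_of_tendsto_cocompact l ?_
    rw [← Metric.cobounded_eq_cocompact]
    have h1 : Tendsto (fun l : ℂ => l⁻¹ * b l⁻¹) (Bornology.cobounded ℂ) (𝓝 (0 * b 0)) :=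
      tendsto_inv₀_cobounded.mul ((hb.continuous.tendsto 0).comp tendsto_inv₀_cobounded)
    rw [zero_mul] at h1
    refine h1.congr' ?_
    filter_upwards [eventually_ne_cobounded (0 : ℂ)] with l hl
    have := h l hl
    rw [pow_zero, one_mul] at this
    rw [← this, mul_comm, mul_inv_cancel_right₀ hl]
  | succ n ih =>
    have hd : Differentiable ℂ (dslope a 0) := fun l => by
      by_cases hl : l = 0
      · subst hl
        obtain ⟨p, hp⟩ := ha.analyticAt 0
        exact hp.has_fpower_series_dslope_fslope.analyticAt.differentiableAt
      · exact (differentiableAt_dslope_of_ne hl).2 (ha l)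
    have h0 : ∀ l, dslope a 0 l * l = a l - a 0 := fun l => by
      have := sub_smul_dslope a 0 l
      rw [sub_zero, smul_eq_mul, mul_comm] at this
      exact this
    obtain ⟨c, hc⟩ := ih hd (b := fun m => b m - a 0 * m ^ n) (by fun_prop) fun l hl => by
      have h1 := h l hl
      have h2 : a l = l ^ n * b l⁻¹ := by
        rw [pow_succ, mul_right_comm] at h1
        exact mul_right_cancel₀ hl h1
      rw [h0, h2, inv_pow]
      have := pow_ne_zero n hl
      field_simp
    refine ⟨Fin.cons (a 0) c, fun l => ?_⟩
    rw [Fin.sum_univ_succ]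
    simp only [Fin.cons_zero, Fin.cons_succ, Fin.val_zero, pow_zero, mul_one, Fin.val_succ, pow_succ]
    have h1 := h0 l
    rw [hc l, Finset.sum_mul] at h1
    rw [eq_sub_iff_add_eq'] at h1
    rw [← h1]
    simp only [mul_assoc]

theorem exists_coeff_of_eq_zpow_mul {n : ℤ} {a b : ℂ → ℂ} (ha : Differentiable ℂ a)
    (hb : Differentiable ℂ b) (h : ∀ l ≠ 0, a l = l ^ n * b l⁻¹) :
    ∃ c : Fin (n + 1).toNat → ℂ, ∀ l, a l = ∑ j, c j * l ^ (j : ℕ) := by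
  -- If `n < -1`, the surplus of negative powers of `l` is absorbed into `b` as powers of `1 / l`.
  refine exists_coeff_of_mul_eq_pow_mul _ ha (b := fun m => m ^ (-(n + 1)).toNat * b m)
    (by fun_prop) fun l hl => ?_
  rw [h l hl, inv_pow, ← zpow_natCast, ← zpow_natCast, ← zpow_neg, ← mul_assoc, ← zpow_add₀ hl]
  rw [show ((n + 1).toNat : ℤ) + -((-(n + 1)).toNat : ℤ) = n + 1 by omega, zpow_add_one₀ hl]
  ring

theorem coeff_unique {n : ℕ} {c c' : Fin n → ℂ}
    (h : ∀ l : ℂ, ∑ j, c j * l ^ (j : ℕ) = ∑ j, c' j * l ^ (j : ℕ)) : c = c' := by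
  have h1 : ∑ j : Fin n, Polynomial.C (c j) * Polynomial.X ^ (j : ℕ) =
      ∑ j : Fin n, Polynomial.C (c' j) * Polynomial.X ^ (j : ℕ) := by
    refine Polynomial.funext fun l => ?_
    simpa [Polynomial.eval_finset_sum] using h l
  funext i
  have h2 := congrArg (fun p => Polynomial.coeff p (i : ℕ)) h1
  simpa [Polynomial.finset_sum_coeff, Polynomial.coeff_X_pow, Fin.val_inj,
    Finset.sum_ite_eq] using h2

end Polynomials

/-! ### Splittings as adapted trivialisations -/

section Splittings

theorem analyticAt_iff_basis_repr {k : ℕ} {N : ℂ → Type*} [∀ y, AddCommGroup (N y)]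
    [∀ y, Module ℂ (N y)] {Θ : ∀ y, N y →ₗ[ℂ] (Fin k → ℂ)} {z : ℂ}
    (hΘ : ∀ᶠ y in 𝓝 z, Bijective (Θ y)) {b : ∀ y, Module.Basis (Fin k) ℂ (N y)} {s : ∀ y, N y}
    (hb : ∀ i, AnalyticAt ℂ (fun y => Θ y (b y i)) z) :
    AnalyticAt ℂ (fun y => Θ y (s y)) z ↔
      AnalyticAt ℂ (fun y => ((b y).repr (s y) : Fin k → ℂ)) z := by
  constructor
  · intro hs
    simp only [← contMDiffAt_complex_iff_analyticAt] at *
    exact contMDiffAt_basis_repr hΘ hb hs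
  · intro hs
    have h1 : (fun y => Θ y (s y)) = fun y => ∑ i, (b y).repr (s y) i • Θ y (b y i) := by
      funext y
      conv_lhs => rw [← (b y).sum_repr (s y), map_sum]
      simp only [map_smul]
    rw [h1]
    refine Finset.analyticAt_fun_sum _ fun i _ => ?_
    exact (analyticAt_pi_iff.1 hs i).smul (hb i)

variable {EZ EM EF Z M F : Type*}
  [NormedAddCommGroup EZ] [NormedSpace ℂ EZ] [TopologicalSpace Z] [ChartedSpace EZ Z]
  [IsManifold 𝓘(ℂ, EZ) ω Z]
  [NormedAddCommGroup EM] [NormedSpace ℂ EM] [TopologicalSpace M] [ChartedSpace EM M]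
  [IsManifold 𝓘(ℂ, EM) ω M]
  [NormedAddCommGroup EF] [NormedSpace ℂ EF] [TopologicalSpace F] [ChartedSpace EF F]

namespace RationalCurveFamily.Trivialisation

variable {proj : Z → OnePoint ℂ} {C : RationalCurveFamily EZ EM EF M F proj} {k : ℕ} {x : M}
  (T T' : C.Trivialisation k x)

open ProjLine

theorem basis_apply (l : ℂ) (i : Fin k) : T.basis l i = T.frame i l :=
  Module.Basis.mk_apply _ _ _

theorem basisHat_apply (ζ : OnePoint ℂ) (hζ : ζ ∈ Uhat) (i : Fin k) :
    T.basisHat ζ hζ i = T.frameHat i ζ :=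
  Module.Basis.mk_apply _ _ _

theorem isHolomorphicSection_coe_iff (hloc : ∀ ζ₀, ∃ Θ, C.IsLocalTriv k x Θ ζ₀)
    {s : ∀ ζ, C.Normal x ζ} {l : ℂ} : C.IsHolomorphicSection x {(l : OnePoint ℂ)} s ↔
      AnalyticAt ℂ (fun z : ℂ => ((T.basis z).repr (s z) : Fin k → ℂ)) l := by
  obtain ⟨Θ, hΘ⟩ := hloc l
  rw [hΘ.coe.self_of_nhds.2 s]
  refine analyticAt_iff_basis_repr (N := fun z : ℂ => C.Normal x z) (Θ := fun z => Θ z)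
    (b := T.basis) (s := fun z => s z) (hΘ.coe.mono fun _ h => h.1) fun i => ?_
  simp only [basis_apply]
  exact (hΘ.coe.self_of_nhds.2 _).1
    (isHolomorphicSection_iff.1 (T.isFrame.holomorphic i) _ (coe_mem_U l))

theorem isHolomorphicSection_inv_iff (hloc : ∀ ζ₀, ∃ Θ, C.IsLocalTriv k x Θ ζ₀)
    {s : ∀ ζ, C.Normal x ζ} {m : ℂ} : C.IsHolomorphicSection x {ProjLine.inv m} s ↔
      AnalyticAt ℂ (fun z : ℂ => ((T.basisHat _ (inv_mem_Uhat z)).repr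
        (s (ProjLine.inv z)) : Fin k → ℂ)) m := by
  obtain ⟨Θ, hΘ⟩ := hloc (ProjLine.inv m)
  rw [hΘ.inv.self_of_nhds.2 s]
  refine analyticAt_iff_basis_repr (N := fun z : ℂ => C.Normal x (ProjLine.inv z))
    (Θ := fun z => Θ (ProjLine.inv z)) (b := fun z => T.basisHat _ (inv_mem_Uhat z))
    (s := fun z => s (ProjLine.inv z)) (hΘ.inv.mono fun _ h => h.1) fun i => ?_
  simp only [basisHat_apply]
  exact (hΘ.inv.self_of_nhds.2 _).1
    (isHolomorphicSection_iff.1 (T.isFrameHat.holomorphic i) _ (inv_mem_Uhat m))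

/-- The matrix over `U` of the change of trivialisation. -/
noncomputable def change (l : ℂ) : Matrix (Fin k) (Fin k) ℂ := (T.basis l).toMatrix (T'.basis l)

/-- The matrix over `Û` of the change of trivialisation. -/
noncomputable def changeHat (m : ℂ) : Matrix (Fin k) (Fin k) ℂ :=
  (T.basisHat _ (inv_mem_Uhat m)).toMatrix (T'.basisHat _ (inv_mem_Uhat m))

variable {T T'}

theorem changeHat_inv (l : ℂˣ) : T.changeHat T' (l : ℂ)⁻¹ =
    (T.basisHat _ (coe_mem_Uhat l)).toMatrix (T'.basisHat _ (coe_mem_Uhat l)) := by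
  -- The two points are equal only propositionally and the bases depend on them, so the point is
  -- made a variable.
  have h : ∀ ζ (hζ : ζ ∈ Uhat), ζ = ((l : ℂ) : OnePoint ℂ) →
      (T.basisHat _ hζ).toMatrix (T'.basisHat _ hζ) =
        (T.basisHat _ (coe_mem_Uhat l)).toMatrix (T'.basisHat _ (coe_mem_Uhat l)) := by
    rintro _ _ rfl; rfl
  exact h _ _ (by rw [inv_coe (inv_ne_zero l.ne_zero), _root_.inv_inv])

theorem isUnit_change (l : ℂ) : IsUnit (T.change T' l) := by
  have : Invertible (T.change T' l) := Module.Basis.invertibleToMatrix (T.basis l) (T'.basis l)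
  exact isUnit_of_invertible _

theorem isUnit_changeHat (m : ℂ) : IsUnit (T.changeHat T' m) := by
  have : Invertible (T.changeHat T' m) :=
    Module.Basis.invertibleToMatrix (T.basisHat _ (inv_mem_Uhat m)) (T'.basisHat _ (inv_mem_Uhat m))
  exact isUnit_of_invertible _

theorem change_inv (l : ℂ) : (T.change T' l)⁻¹ = T'.change T l :=
  Matrix.inv_eq_left_inv (Module.Basis.toMatrix_mul_toMatrix_flip _ _)

/-- The right-hand side does not mention `T`; this is why the frames do not depend on the
trivialisation. -/
theorem frameSection_change (u : TangentSpace 𝓘(ℂ, EM) x) (l : ℂ) :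
    T.frameSection (T.change T') u l = (T'.basis l).repr (C.kodaira x u (l : OnePoint ℂ)) := by
  rw [frameSection, change_inv, change]
  exact Module.Basis.toMatrix_mulVec_repr _ _ _

theorem frameSectionHat_changeHat (u : TangentSpace 𝓘(ℂ, EM) x) (m : ℂ) :
    T.frameSectionHat (T.changeHat T') u m =
      (T'.basisHat _ (inv_mem_Uhat m)).repr (C.kodaira x u (ProjLine.inv m)) := by
  rw [frameSectionHat, changeHat,
    Matrix.inv_eq_left_inv (Module.Basis.toMatrix_mul_toMatrix_flip _ _)]
  exact Module.Basis.toMatrix_mulVec_repr _ _ _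

variable {n : Fin k → ℤ}

theorem IsAdapted.repr_eq (h : T'.IsAdapted n) (l : ℂˣ) (ζ : OnePoint ℂ) (hζ : ζ ∈ Uhat)
    (hl : ζ = ((l : ℂ) : OnePoint ℂ)) (s : ∀ ζ, C.Normal x ζ) (i : Fin k) :
    (T'.basisHat ζ hζ).repr (s ζ) i = (l : ℂ) ^ (-n i) * (T'.basis (l : ℂ)).repr (s (l : ℂ)) i := by
  subst hl
  have h1 : s ((l : ℂ) : OnePoint ℂ) = ∑ j, ((l : ℂ) ^ (-n j) * (T'.basis (l : ℂ)).repr (s (l : ℂ)) j) •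
      T'.basisHat _ hζ j := by
    conv_lhs => rw [← (T'.basis (l : ℂ)).sum_repr (s ((l : ℂ) : OnePoint ℂ))]
    refine Finset.sum_congr rfl fun j _ => ?_
    rw [basis_apply, basisHat_apply, h _ l.ne_zero, smul_smul, mul_comm]
  conv_lhs => rw [h1, Module.Basis.repr_sum_self]

theorem IsAdapted.patching_eq (h : T'.IsAdapted n) (l : ℂˣ) :
    T'.patching l = Matrix.diagonal fun i => (l : ℂ) ^ (-n i) := by
  ext i j
  rw [patching, Module.Basis.toMatrix_apply, basis_apply, h _ l.ne_zero, ← basisHat_apply _ _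
    (coe_mem_Uhat l), map_smul, Module.Basis.repr_self, Matrix.diagonal_apply]
  by_cases hij : i = j
  · subst hij; simp
  · rw [if_neg hij]; simp [Ne.symm hij]

/-- Change of basis turns the patching of `T` into that of `T'`, which is diagonal. The columns of
the change matrices are components of holomorphic frames in holomorphic frames. -/
theorem IsAdapted.isSplitting (hloc : ∀ ζ₀, ∃ Θ, C.IsLocalTriv k x Θ ζ₀) (h : T'.IsAdapted n) :
    T.IsSplitting n (T.change T') (T.changeHat T') where
  holomorphic i j := by
    intro l
    have h1 := (T.isHolomorphicSection_coe_iff hloc).1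
      (isHolomorphicSection_iff.1 (T'.isFrame.holomorphic j) _ (coe_mem_U l))
    have h2 := (analyticAt_pi_iff.1 h1 i).differentiableAt
    simpa only [change, Module.Basis.toMatrix_apply, basis_apply] using h2
  holomorphicHat i j := by
    intro l
    have h1 := (T.isHolomorphicSection_inv_iff hloc).1
      (isHolomorphicSection_iff.1 (T'.isFrameHat.holomorphic j) _ (inv_mem_Uhat l))
    have h2 := (analyticAt_pi_iff.1 h1 i).differentiableAt
    simpa only [changeHat, Module.Basis.toMatrix_apply, basisHat_apply] using h2
  isUnit := isUnit_change
  isUnitHat := isUnit_changeHat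
  split l := by
    rw [changeHat_inv, change_inv, change, ← h.patching_eq l, patching, patching,
      Module.Basis.toMatrix_mul_toMatrix, Module.Basis.toMatrix_mul_toMatrix]

/-- Every splitting comes from an adapted trivialisation. -/
theorem IsSplitting.exists_isAdapted (hloc : ∀ ζ₀, ∃ Θ, C.IsLocalTriv k x Θ ζ₀)
    {H Hhat : ℂ → Matrix (Fin k) (Fin k) ℂ} (h : T.IsSplitting n H Hhat) :
    ∃ T' : C.Trivialisation k x, T'.IsAdapted n ∧ T.change T' = H ∧ T.changeHat T' = Hhat := by
  -- The columns of `H` and `Hhat` are taken as the components of new frames; the splitting equation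
  -- then says that these are adapted.
  set f : Fin k → ∀ ζ, C.Normal x ζ := fun i ζ => ∑ j, H (chartZero ζ) j i • T.frame j ζ with hf
  set fhat : Fin k → ∀ ζ, C.Normal x ζ := fun i ζ =>
    ∑ j, Hhat (chartInfty ζ) j i • T.frameHat j ζ with hfhat
  have hfl : ∀ (l : ℂ) i, f i l = ∑ j, H l j i • T.basis l j := fun l i => by
    simp only [hf, chartZero_coe, basis_apply]
  have hfhat_inv : ∀ (m : ℂ) i, fhat i (ProjLine.inv m) =
      ∑ j, Hhat m j i • T.basisHat _ (inv_mem_Uhat m) j := fun m i => by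
    simp only [hfhat, chartInfty_apply, ProjLine.inv_inv, chartZero_coe, basisHat_apply]
  have key : ∀ {V : Type _} [AddCommGroup V] [Module ℂ V] (b : Module.Basis (Fin k) ℂ V)
      (A : Matrix (Fin k) (Fin k) ℂ), IsUnit A →
      LinearIndependent ℂ (fun i => ∑ j, A j i • b j) ∧
        ⊤ ≤ Submodule.span ℂ (range fun i => ∑ j, A j i • b j) := by
    intro V _ _ b A hA
    have h1 : b.toMatrix (fun i => ∑ j, A j i • b j) = A := by
      ext i j
      rw [Module.Basis.toMatrix_apply, Module.Basis.repr_sum_self]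
    have h2 := (b.is_basis_iff_det (v := fun i => ∑ j, A j i • b j)).2 (by
      rw [Module.Basis.det_apply, h1]; exact (Matrix.isUnit_iff_isUnit_det A).1 hA)
    exact ⟨h2.1, h2.2.ge⟩
  have hUhat : ∀ ζ ∈ Uhat, ∃ m : ℂ, ζ = ProjLine.inv m := by
    intro ζ hζ
    induction ζ using OnePoint.rec with
    | infty => exact ⟨0, inv_zero.symm⟩
    | coe l =>
      have hl : l ≠ 0 := fun h0 => hζ (by rw [h0]; rfl)
      exact ⟨l⁻¹, by rw [inv_coe (inv_ne_zero hl), _root_.inv_inv]⟩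
  have hU : ∀ ζ ∈ U, ∃ l : ℂ, ζ = l := by
    intro ζ hζ
    induction ζ using OnePoint.rec with
    | infty => exact absurd rfl hζ
    | coe l => exact ⟨l, rfl⟩
  let T' : C.Trivialisation k x := ⟨f, fhat, ⟨fun i => ?_, fun ζ hζ => ?_, fun ζ hζ => ?_⟩,
    ⟨fun i => ?_, fun ζ hζ => ?_, fun ζ hζ => ?_⟩⟩
  · refine ⟨T', ?_, ?_, ?_⟩
    · intro l hl i
      set l' : ℂˣ := Units.mk0 l hl
      change f i l = l ^ (-n i) • fhat i l
      have h1 : fhat i l = ∑ j, Hhat l⁻¹ j i • T.basisHat l (coe_mem_Uhat l') j := by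
        simp only [hfhat, chartInfty_apply, inv_coe hl, chartZero_coe]
        exact Finset.sum_congr rfl fun j _ =>
          congrArg (Hhat l⁻¹ j i • ·) (T.basisHat_apply _ _ j).symm
      have h2 : ∀ j, T.basis l j = ∑ a, T.patching l' a j • T.basisHat l (coe_mem_Uhat l') a :=
        fun j => ((T.basisHat l (coe_mem_Uhat l')).sum_repr (T.basis l j)).symm
      have h3 : T.patching l' * H l = Hhat l⁻¹ * Matrix.diagonal (fun i => l ^ (-n i)) := by
        rw [h.split l', Matrix.mul_assoc]
        change _ * ((H l)⁻¹ * H l) = _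
        rw [Matrix.nonsing_inv_mul _ ((Matrix.isUnit_iff_isUnit_det _).1 (h.isUnit l)),
          Matrix.mul_one]
        rfl
      rw [hfl, h1]
      simp only [h2, Finset.smul_sum, smul_smul]
      rw [Finset.sum_comm]
      refine Finset.sum_congr rfl fun a _ => ?_
      rw [← Finset.sum_smul]
      congr 1
      have h4 := congrFun (congrFun h3 a) i
      rw [Matrix.mul_apply, Matrix.mul_diagonal] at h4
      rw [mul_comm (l ^ (-n i)), ← h4]
      exact Finset.sum_congr rfl fun j _ => mul_comm _ _
    · funext l
      ext i j
      rw [change, Module.Basis.toMatrix_apply, basis_apply]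
      change (T.basis l).repr (f j l) i = _
      rw [hfl, Module.Basis.repr_sum_self]
    · funext l
      ext i j
      rw [changeHat, Module.Basis.toMatrix_apply, basisHat_apply]
      change (T.basisHat _ _).repr (fhat j _) i = _
      rw [hfhat_inv, Module.Basis.repr_sum_self]
  · refine isHolomorphicSection_iff.2 fun ζ hζ => ?_
    obtain ⟨l, rfl⟩ := hU ζ hζ
    rw [T.isHolomorphicSection_coe_iff hloc]
    simp only [hfl, Module.Basis.repr_sum_self]
    exact analyticAt_pi_iff.2 fun j => (h.holomorphic j i).analyticAt l
  · obtain ⟨l, rfl⟩ := hU ζ hζ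
    simp only [hfl]
    exact (key (T.basis l) (H l) (h.isUnit l)).1
  · obtain ⟨l, rfl⟩ := hU ζ hζ
    simp only [hfl]
    exact (key (T.basis l) (H l) (h.isUnit l)).2
  · refine isHolomorphicSection_iff.2 fun ζ hζ => ?_
    obtain ⟨l, rfl⟩ := hUhat ζ hζ
    rw [T.isHolomorphicSection_inv_iff hloc]
    simp only [hfhat_inv, Module.Basis.repr_sum_self]
    exact analyticAt_pi_iff.2 fun j => (h.holomorphicHat j i).analyticAt l
  · obtain ⟨l, rfl⟩ := hUhat ζ hζ
    simp only [hfhat_inv]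
    exact (key (T.basisHat _ (inv_mem_Uhat l)) (Hhat l) (h.isUnitHat l)).1
  · obtain ⟨l, rfl⟩ := hUhat ζ hζ
    simp only [hfhat_inv]
    exact (key (T.basisHat _ (inv_mem_Uhat l)) (Hhat l) (h.isUnitHat l)).2

end RationalCurveFamily.Trivialisation

end Splittings

/-! ### Counting arguments for the uniqueness of the type -/

section TypeUnique

/-- The columns with index in `p` are independent and supported on the rows in `q`, so there are no
more of them than such rows. -/
theorem card_le_card_of_isUnit {k : ℕ} {A : Matrix (Fin k) (Fin k) ℂ} (hA : IsUnit A)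
    {p q : Fin k → Prop} [DecidablePred p] [DecidablePred q]
    (h : ∀ i j, p i → ¬ q j → A j i = 0) :
    (Finset.univ.filter p).card ≤ (Finset.univ.filter q).card := by
  have h1 : Injective (Matrix.toLin' (A.submatrix (fun j : {j // q j} => (j : Fin k))
      (fun i : {i // p i} => (i : Fin k)))) := by
    rw [injective_iff_map_eq_zero]
    intro g hg
    set g' : Fin k → ℂ := fun i => if hi : p i then g ⟨i, hi⟩ else 0 with hg'
    have h2 : ∀ j, A.mulVec g' j = ∑ i : {i // p i}, A j i * g i := by
      intro j
      have h3 : ∑ i : {i // p i}, A j i * g i = ∑ i : {i // p i}, A j i * g' i :=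
        Finset.sum_congr rfl fun i _ => by simp [hg', i.2]
      rw [Matrix.mulVec, dotProduct, h3,
        ← Finset.sum_subtype (Finset.univ.filter p) (by simp) fun i => A j i * g' i]
      refine (Finset.sum_filter_of_ne fun i _ hi => ?_).symm
      by_contra hpi
      simp [hg', hpi] at hi
    have h3 : A.mulVec g' = 0 := by
      funext j
      rw [h2]
      by_cases hj : q j
      · exact congrFun hg ⟨j, hj⟩
      · exact Finset.sum_eq_zero fun i _ => by rw [h i j i.2 hj, zero_mul]
    have h4 : g' = 0 := by
      have := congrArg (A⁻¹).mulVec h3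
      rwa [Matrix.mulVec_mulVec, Matrix.nonsing_inv_mul _ ((Matrix.isUnit_iff_isUnit_det _).1 hA),
        Matrix.one_mulVec, Matrix.mulVec_zero] at this
    funext i
    have := congrFun h4 i
    rw [hg'] at this
    simpa [i.2] using this
  have h2 := LinearMap.finrank_le_finrank_of_injective h1
  rwa [Module.finrank_fintype_fun_eq_card, Module.finrank_fintype_fun_eq_card,
    Fintype.card_subtype, Fintype.card_subtype] at h2

/-- Differences of consecutive counts give the multiplicity of each value; fibres of equal size are
then matched. -/
theorem exists_perm_of_card_eq {k : ℕ} {n n' : Fin k → ℤ}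
    (h : ∀ t, (Finset.univ.filter fun i => t ≤ n i).card =
      (Finset.univ.filter fun i => t ≤ n' i).card) :
    ∃ σ : Equiv.Perm (Fin k), n' = n ∘ σ := by
  have key : ∀ (n : Fin k → ℤ) t, (Finset.univ.filter fun i => t ≤ n i).card =
      (Finset.univ.filter fun i => n i = t).card +
        (Finset.univ.filter fun i => t + 1 ≤ n i).card := by
    intro n t
    rw [← Finset.card_union_of_disjoint]
    · congr 1
      ext i
      simp only [Finset.mem_filter, Finset.mem_univ, true_and, Finset.mem_union]
      omega
    · rw [Finset.disjoint_filter]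
      intro i _ h1 h2
      omega
  have h1 : ∀ t, Fintype.card {i // n' i = t} = Fintype.card {i // n i = t} := by
    intro t
    rw [Fintype.card_subtype, Fintype.card_subtype]
    have h2 := h t
    have h3 := h (t + 1)
    have h4 := key n t
    have h5 := key n' t
    omega
  let σ : Equiv.Perm (Fin k) := Equiv.ofFiberEquiv fun t => Fintype.equivOfCardEq (h1 t)
  exact ⟨σ, funext fun i => (Equiv.ofFiberEquiv_map _ i).symm⟩

end TypeUnique

/-! ### Global sections, frames and automorphisms in adapted trivialisations -/

section AdaptedTrivialisations

variable {EZ EM EF Z M F : Type*}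
  [NormedAddCommGroup EZ] [NormedSpace ℂ EZ] [TopologicalSpace Z] [ChartedSpace EZ Z]
  [IsManifold 𝓘(ℂ, EZ) ω Z]
  [NormedAddCommGroup EM] [NormedSpace ℂ EM] [TopologicalSpace M] [ChartedSpace EM M]
  [IsManifold 𝓘(ℂ, EM) ω M]
  [NormedAddCommGroup EF] [NormedSpace ℂ EF] [TopologicalSpace F] [ChartedSpace EF F]

namespace RationalCurveFamily.Trivialisation

variable {proj : Z → OnePoint ℂ} {C : RationalCurveFamily EZ EM EF M F proj} {k : ℕ} {x : M}
  {T T' : C.Trivialisation k x} {n n' : Fin k → ℤ}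

open ProjLine

/-- There is no nonzero homomorphism from `O(a)` to `O(b)` if `b < a`: such an entry of the change
matrix is a polynomial of negative degree. The invertible change matrix at `l = 0` therefore has a
block of zeros, which gives the inequality. -/
theorem IsAdapted.card_le (hloc : ∀ ζ₀, ∃ Θ, C.IsLocalTriv k x Θ ζ₀) (h : T.IsAdapted n)
    (h' : T'.IsAdapted n') (t : ℤ) :
    (Finset.univ.filter fun i => t ≤ n' i).card ≤ (Finset.univ.filter fun i => t ≤ n i).card := by
  have hs := h'.isSplitting (T := T) hloc
  refine card_le_card_of_isUnit (hs.isUnit 0) fun i j hi hj => ?_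
  have hlt : n j < n' i := (not_le.1 hj).trans_le hi
  have h1 : ∀ l : ℂ, l ≠ 0 → T.change T' l j i = l ^ (n j - n' i) * T.changeHat T' l⁻¹ j i := by
    intro l hl
    have h2 := hs.split (Units.mk0 l hl)
    rw [h.patching_eq] at h2
    have h3 := congrArg (fun A => A * T.change T' l) h2
    change _ = _ * (T.change T' l)⁻¹ * T.change T' l at h3
    rw [Matrix.nonsing_inv_mul_cancel_right _ _ ((Matrix.isUnit_iff_isUnit_det _).1 (hs.isUnit l))]
      at h3
    have h4 := congrFun (congrFun h3 j) i
    simp only [Units.val_mk0, Matrix.diagonal_mul, Matrix.mul_diagonal] at h4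
    rw [sub_eq_add_neg, zpow_add₀ hl, mul_assoc, mul_comm (l ^ (-n' i)), ← h4, ← mul_assoc,
      ← zpow_add₀ hl, add_neg_cancel, zpow_zero, one_mul]
  obtain ⟨c, hc⟩ := exists_coeff_of_eq_zpow_mul (hs.holomorphic j i) (hs.holomorphicHat j i) h1
  rw [hc 0]
  have : IsEmpty (Fin (n j - n' i + 1).toNat) := by
    rw [show (n j - n' i + 1).toNat = 0 by omega]; infer_instance
  exact Finset.sum_of_isEmpty _

/-- The type of a splitting is unique up to permutations. -/
theorem IsAdapted.exists_perm (hloc : ∀ ζ₀, ∃ Θ, C.IsLocalTriv k x Θ ζ₀) (h : T.IsAdapted n)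
    (h' : T'.IsAdapted n') : ∃ σ : Equiv.Perm (Fin k), n' = n ∘ σ :=
  exists_perm_of_card_eq fun t => le_antisymm (h'.card_le hloc h t) (h.card_le hloc h' t)

theorem IsAdapted.exists_coeff (hloc : ∀ ζ₀, ∃ Θ, C.IsLocalTriv k x Θ ζ₀) (h : T.IsAdapted n)
    {s : ∀ ζ, C.Normal x ζ} (hs : s ∈ C.globalSections x) :
    ∃ c : ∀ i, Fin (n i + 1).toNat → ℂ, ∀ (l : ℂ) i,
      (T.basis l).repr (s l) i = ∑ j, c i j * l ^ (j : ℕ) := by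
  have h1 : ∀ i, Differentiable ℂ fun l : ℂ => (T.basis l).repr (s l) i := fun i l =>
    (analyticAt_pi_iff.1 ((T.isHolomorphicSection_coe_iff hloc).1
      (isHolomorphicSection_iff.1 hs _ (mem_univ _))) i).differentiableAt
  have h2 : ∀ i, Differentiable ℂ fun m : ℂ =>
      (T.basisHat _ (inv_mem_Uhat m)).repr (s (ProjLine.inv m)) i := fun i l =>
    (analyticAt_pi_iff.1 ((T.isHolomorphicSection_inv_iff hloc).1
      (isHolomorphicSection_iff.1 hs _ (mem_univ _))) i).differentiableAt
  have h3 : ∀ i, ∀ l : ℂ, l ≠ 0 → (T.basis l).repr (s l) i =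
      l ^ n i * (T.basisHat _ (inv_mem_Uhat l⁻¹)).repr (s (ProjLine.inv (l⁻¹ : ℂ))) i := by
    intro i l hl
    rw [h.repr_eq (Units.mk0 l hl) _ _ (by rw [inv_coe (inv_ne_zero hl), _root_.inv_inv]; rfl) s i,
      Units.val_mk0, ← mul_assoc, ← zpow_add₀ hl, add_neg_cancel, zpow_zero, one_mul]
  choose c hc using fun i => exists_coeff_of_eq_zpow_mul (h1 i) (h2 i) (h3 i)
  exact ⟨c, fun l i => hc i l⟩

theorem IsAdapted.exists_globalSection (hloc : ∀ ζ₀, ∃ Θ, C.IsLocalTriv k x Θ ζ₀)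
    (h : T.IsAdapted n) (c : ∀ i, Fin (n i + 1).toNat → ℂ) :
    ∃ s ∈ C.globalSections x, ∀ (l : ℂ) i,
      (T.basis l).repr (s l) i = ∑ j, c i j * l ^ (j : ℕ) := by
  -- Over `Û` the components are `∑ c j * m ^ (n - j)`, polynomial because `j ≤ n`. At `m = 0`, with
  -- `0 ^ 0 = 1`, only the top coefficient remains.
  set v : C.Normal x OnePoint.infty :=
    ∑ i, (∑ j, c i j * 0 ^ ((n i).toNat - j)) • T.frameHat i OnePoint.infty with hv
  set s : ∀ ζ, C.Normal x ζ := C.extend x v fun l => ∑ i, (∑ j, c i j * l ^ (j : ℕ)) • T.basis l i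
    with hs
  have h1 : ∀ (l : ℂ) i, (T.basis l).repr (s l) i = ∑ j, c i j * l ^ (j : ℕ) := fun l i =>
    congrFun ((T.basis l).repr_sum_self _) i
  have h2 : ∀ (m : ℂ) i, (T.basisHat _ (inv_mem_Uhat m)).repr (s (ProjLine.inv m)) i =
      ∑ j, c i j * m ^ ((n i).toNat - j) := by
    intro m i
    by_cases hm : m = 0
    · subst hm
      have h3 : ∀ ζ (hζ : ζ ∈ Uhat), ζ = OnePoint.infty →
          (T.basisHat ζ hζ).repr (s ζ) i = ∑ j, c i j * 0 ^ ((n i).toNat - j) := by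
        rintro _ hζ rfl
        have h4 : s OnePoint.infty =
            ∑ i, (∑ j, c i j * 0 ^ ((n i).toNat - j)) • T.basisHat OnePoint.infty hζ i := by
          simp only [basisHat_apply]
          rfl
        rw [h4, Module.Basis.repr_sum_self]
      exact h3 _ _ inv_zero
    · rw [h.repr_eq (Units.mk0 m hm)⁻¹ _ _ (by rw [inv_coe hm]; rfl) s i, h1, Finset.mul_sum]
      refine Finset.sum_congr rfl fun j _ => ?_
      have hj : (j : ℕ) ≤ (n i).toNat := by have := j.2; omega
      have hn : n i = (n i).toNat := by have := j.2; omega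
      have hpow : m ^ n i = m ^ (n i).toNat := by
        conv_lhs => rw [hn]
        rw [zpow_natCast]
      rw [Units.val_inv_eq_inv_val, Units.val_mk0, inv_zpow, zpow_neg, _root_.inv_inv, hpow,
        pow_sub₀ _ hm hj, inv_pow]
      ring
  refine ⟨s, isHolomorphicSection_iff.2 fun ζ _ => ?_, h1⟩
  induction ζ using OnePoint.rec with
  | infty =>
    rw [← ProjLine.inv_zero, T.isHolomorphicSection_inv_iff hloc]
    refine analyticAt_pi_iff.2 fun i => ?_
    simp only [h2]
    fun_prop
  | coe l =>
    rw [T.isHolomorphicSection_coe_iff hloc]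
    refine analyticAt_pi_iff.2 fun i => ?_
    simp only [h1]
    fun_prop

/-- Completeness and the description of global sections by coefficients identify `T_x M` with the
space of all coefficient vectors, and the `e i j` are the coordinates. Surjectivity of this map
makes them independent, and injectivity makes them span. -/
theorem IsAdapted.exists_coframe [FiniteDimensional ℂ EM]
    (hloc : ∀ ζ₀, ∃ Θ, C.IsLocalTriv k x Θ ζ₀) (h : T.IsAdapted n)
    (hinj : Injective (C.kodaira x)) (hrange : range (C.kodaira x) = C.globalSections x) :
    ∃ e : Coframe EM n x,
      (∀ (u : TangentSpace 𝓘(ℂ, EM) x) (l : ℂ) i,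
        (T.basis l).repr (C.kodaira x u l) i = ∑ j, e i j u * l ^ (j : ℕ)) ∧
      LinearIndependent ℂ (fun p : Σ i, Fin (n i + 1).toNat => e p.1 p.2) ∧
      Submodule.span ℂ (range fun p : Σ i, Fin (n i + 1).toNat => e p.1 p.2) = ⊤ := by
  choose c hc using fun u : TangentSpace 𝓘(ℂ, EM) x =>
    h.exists_coeff hloc (s := C.kodaira x u) (hrange ▸ mem_range_self u)
  have hadd : ∀ (u v : TangentSpace 𝓘(ℂ, EM) x) ζ,
      C.kodaira x (u + v) ζ = C.kodaira x u ζ + C.kodaira x v ζ := fun u v ζ =>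
    map_add (C.kodairaAt (C.sec x ζ)) u v
  have hsmul : ∀ (a : ℂ) (u : TangentSpace 𝓘(ℂ, EM) x) ζ,
      C.kodaira x (a • u) ζ = a • C.kodaira x u ζ := fun a u ζ =>
    map_smul (C.kodairaAt (C.sec x ζ)) a u
  let e : Coframe EM n x := fun i j =>
    { toFun := fun u => c u i j
      map_add' := fun u v => by
        have : c (u + v) i = c u i + c v i := coeff_unique fun l => by
          rw [← hc (u + v) l i, hadd, map_add, Finsupp.add_apply, hc, hc, ← Finset.sum_add_distrib]
          exact Finset.sum_congr rfl fun j _ => (add_mul _ _ _).symm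
        exact congrFun this j
      map_smul' := fun a u => by
        have : c (a • u) i = a • c u i := coeff_unique fun l => by
          rw [← hc (a • u) l i, hsmul, map_smul, Finsupp.smul_apply, hc, smul_eq_mul, Finset.mul_sum]
          exact Finset.sum_congr rfl fun j _ => (mul_assoc _ _ _).symm
        exact congrFun this j }
  have hsurj : ∀ d : ∀ i, Fin (n i + 1).toNat → ℂ, ∃ u, ∀ i j, e i j u = d i j := by
    intro d
    obtain ⟨s, hs, hsd⟩ := h.exists_globalSection hloc d
    rw [← hrange] at hs
    obtain ⟨u, rfl⟩ := hs
    refine ⟨u, fun i j => ?_⟩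
    have : c u i = d i := coeff_unique fun l => by rw [← hc u l i, hsd]
    exact congrFun this j
  have hinj' : ∀ u, (∀ i j, e i j u = 0) → u = 0 := by
    intro u hu
    have hK : ∀ l : ℂ, C.kodaira x u l = 0 := by
      intro l
      apply (T.basis l).repr.injective
      ext i
      rw [hc u l i, map_zero, Finsupp.zero_apply]
      exact Finset.sum_eq_zero fun j _ => by rw [show c u i j = 0 from hu i j, zero_mul]
    have hK0 : ∀ ζ, C.kodaira x u ζ = 0 := by
      intro ζ
      induction ζ using OnePoint.rec with
      | coe l => exact hK l
      | infty =>
        -- The trivialisation over `U` does not reach `∞`; there the section vanishes by continuity.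
        have h1 : ∀ i, (fun m : ℂ => (T.basisHat _ (inv_mem_Uhat m)).repr
            (C.kodaira x u (ProjLine.inv m)) i) = fun _ => 0 := by
          intro i
          refine Continuous.ext_on (dense_compl_singleton (0 : ℂ)) ?_ continuous_const ?_
          · rw [continuous_iff_continuousAt]
            intro m
            have hs : C.kodaira x u ∈ C.globalSections x := hrange ▸ mem_range_self u
            exact (analyticAt_pi_iff.1 ((T.isHolomorphicSection_inv_iff hloc).1
              (isHolomorphicSection_iff.1 hs _ (mem_univ _))) i).continuousAt
          · intro m hm
            have h2 : ∀ ζ, ζ = ((m⁻¹ : ℂ) : OnePoint ℂ) → C.kodaira x u ζ = 0 := by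
              rintro _ rfl; exact hK _
            simp only [h2 _ (inv_coe hm), map_zero, Finsupp.zero_apply]
        have h3 : C.kodaira x u (ProjLine.inv ((0 : ℂ) : OnePoint ℂ)) = 0 := by
          apply (T.basisHat _ (inv_mem_Uhat 0)).repr.injective
          ext i
          rw [map_zero, Finsupp.zero_apply]
          exact congrFun (h1 i) 0
        rwa [ProjLine.inv_zero] at h3
    refine hinj ?_
    funext ζ
    rw [hK0]
    exact (map_zero (C.kodairaAt (C.sec x ζ))).symm
  have hli : LinearIndependent ℂ (fun p : Σ i, Fin (n i + 1).toNat => e p.1 p.2) := by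
    classical
    rw [Fintype.linearIndependent_iff]
    intro g hg p
    obtain ⟨u, hu⟩ := hsurj fun i j => if (⟨i, j⟩ : Σ i, Fin (n i + 1).toNat) = p then 1 else 0
    have h1 := congrArg (fun f : Module.Dual ℂ (TangentSpace 𝓘(ℂ, EM) x) => f u) hg
    simpa [LinearMap.sum_apply, hu] using h1
  refine ⟨e, fun u l i => hc u l i, hli, ?_⟩
  have : FiniteDimensional ℂ (TangentSpace 𝓘(ℂ, EM) x) := inferInstanceAs (FiniteDimensional ℂ EM)
  let f : TangentSpace 𝓘(ℂ, EM) x →ₗ[ℂ] ((Σ i, Fin (n i + 1).toNat) → ℂ) :=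
    LinearMap.pi fun p => e p.1 p.2
  have hf : Injective f := (injective_iff_map_eq_zero f).2 fun u hu =>
    hinj' u fun i j => congrFun hu ⟨i, j⟩
  have h1 := LinearMap.finrank_le_finrank_of_injective hf
  rw [Module.finrank_fintype_fun_eq_card] at h1
  refine hli.span_eq_top_of_card_eq_finrank' (le_antisymm hli.fintype_card_le_finrank ?_)
  rwa [Subspace.dual_finrank_eq]

theorem coframe_unique {e e' : Coframe EM n x} {H : ℂ → Matrix (Fin k) (Fin k) ℂ}
    (h : T.GivesFrame H e) (h' : T.GivesFrame H e') : e' = e := by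
  funext i j
  refine LinearMap.ext fun u => ?_
  exact congrFun (coeff_unique (c := fun j => e' i j u) (c' := fun j => e i j u)
    fun l => (h' u l i).symm.trans (h u l i)) j

/-- The image of a trivialisation under an invertible endomorphism of the normal bundle. -/
noncomputable def mapEnd (T : C.Trivialisation k x) {g : ∀ ζ, Module.End ℂ (C.Normal x ζ)}
    (hg : g ∈ C.endSections x) (hu : ∀ ζ, IsUnit (g ζ)) : C.Trivialisation k x where
  frame i ζ := g ζ (T.frame i ζ)
  frameHat i ζ := g ζ (T.frameHat i ζ)
  isFrame :=
    { holomorphic := fun i => hg _ isOpen_compl_singleton _ (T.isFrame.holomorphic i)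
      linearIndependent := fun ζ hζ => (T.isFrame.linearIndependent ζ hζ).map' (g ζ)
        (LinearMap.ker_eq_bot.2 ((Module.End.isUnit_iff _).1 (hu ζ)).1)
      span_eq_top := fun ζ hζ => by
        have h1 := Submodule.map_mono (f := g ζ) (T.isFrame.span_eq_top ζ hζ)
        rwa [Submodule.map_top, LinearMap.range_eq_top.2 ((Module.End.isUnit_iff _).1 (hu ζ)).2,
          Submodule.map_span, ← range_comp] at h1 }
  isFrameHat :=
    { holomorphic := fun i => hg _ isOpen_compl_singleton _ (T.isFrameHat.holomorphic i)
      linearIndependent := fun ζ hζ => (T.isFrameHat.linearIndependent ζ hζ).map' (g ζ)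
        (LinearMap.ker_eq_bot.2 ((Module.End.isUnit_iff _).1 (hu ζ)).1)
      span_eq_top := fun ζ hζ => by
        have h1 := Submodule.map_mono (f := g ζ) (T.isFrameHat.span_eq_top ζ hζ)
        rwa [Submodule.map_top, LinearMap.range_eq_top.2 ((Module.End.isUnit_iff _).1 (hu ζ)).2,
          Submodule.map_span, ← range_comp] at h1 }

theorem endMatrix_mul_change {T T' T'' : C.Trivialisation k x}
    {g : ∀ ζ, Module.End ℂ (C.Normal x ζ)} {l : ℂ}
    (hg : ∀ i, g l (T'.frame i l) = T''.frame i l) :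
    T.endMatrix g l * T.change T' l = T.change T'' l := by
  rw [endMatrix, change, change, linearMap_toMatrix_mul_basis_toMatrix]
  ext i j
  rw [LinearMap.toMatrix_apply, Module.Basis.toMatrix_apply, basis_apply, basis_apply, hg]

theorem endMatrixHat_mul_changeHat {T T' T'' : C.Trivialisation k x}
    {g : ∀ ζ, Module.End ℂ (C.Normal x ζ)} {m : ℂ}
    (hg : ∀ i, g (ProjLine.inv m) (T'.frameHat i (ProjLine.inv m)) =
      T''.frameHat i (ProjLine.inv m)) :
    T.endMatrixHat g m * T.changeHat T' m = T.changeHat T'' m := by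
  rw [endMatrixHat, changeHat, changeHat, linearMap_toMatrix_mul_basis_toMatrix]
  ext i j
  rw [LinearMap.toMatrix_apply, Module.Basis.toMatrix_apply, basisHat_apply, basisHat_apply, hg]

/-- Two adapted trivialisations differ by an automorphism of the normal bundle. -/
theorem IsAdapted.exists_end (hloc : ∀ ζ₀, ∃ Θ, C.IsLocalTriv k x Θ ζ₀) (h : T.IsAdapted n)
    (h' : T'.IsAdapted n) : ∃ g : ∀ ζ, Module.End ℂ (C.Normal x ζ), g ∈ C.endSections x ∧
      (∀ ζ, IsUnit (g ζ)) ∧ (∀ (l : ℂ) i, g l (T.frame i l) = T'.frame i l) ∧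
      (∀ (m : ℂ) i, g (ProjLine.inv m) (T.frameHat i (ProjLine.inv m)) =
        T'.frameHat i (ProjLine.inv m)) := by
  have hinf : OnePoint.infty ∈ Uhat := by simp [Uhat]
  -- Frame is sent to frame over `U`, and at `∞` the hatted frames are used. Both transitions have
  -- the same factors `l ^ (-n i)`, so `g'` matches the hatted frames on all of `Û`.
  let g' : ∀ ζ, C.Normal x ζ ≃ₗ[ℂ] C.Normal x ζ := fun ζ =>
    @OnePoint.rec ℂ (fun ζ => C.Normal x ζ ≃ₗ[ℂ] C.Normal x ζ)
      ((T.basisHat _ hinf).equiv (T'.basisHat _ hinf) (Equiv.refl _))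
      (fun l => (T.basis l).equiv (T'.basis l) (Equiv.refl _)) ζ
  have hU : ∀ (l : ℂ) i, g' l (T.frame i l) = T'.frame i l := by
    intro l i
    rw [← basis_apply, ← basis_apply]
    exact (T.basis l).equiv_apply _ _ _
  have hUhat : ∀ ζ ∈ Uhat, ∀ i, g' ζ (T.frameHat i ζ) = T'.frameHat i ζ := by
    intro ζ hζ i
    induction ζ using OnePoint.rec with
    | infty =>
      rw [← basisHat_apply _ _ hinf, ← basisHat_apply _ _ hinf]
      exact (T.basisHat _ hinf).equiv_apply _ _ _
    | coe l =>
      have hl : l ≠ 0 := fun h0 => hζ (by rw [h0]; rfl)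
      have h1 := hU l i
      rw [h l hl, h' l hl, map_smul] at h1
      exact smul_right_injective _ (zpow_ne_zero (-n i) hl) h1
  have hrepr : ∀ {ζ : OnePoint ℂ} (b b' : Module.Basis (Fin k) ℂ (C.Normal x ζ)),
      (∀ i, g' ζ (b i) = b' i) → ∀ v, (b'.repr (g' ζ v) : Fin k → ℂ) = b.repr v := by
    intro ζ b b' hb v
    conv_lhs => rw [← b.sum_repr v, map_sum]
    simp only [map_smul, hb]
    exact b'.repr_sum_self _
  refine ⟨fun ζ => (g' ζ).toLinearMap, fun V _ s hs => ?_, fun ζ =>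
    (Module.End.isUnit_iff _).2 (g' ζ).bijective, hU, fun m i => hUhat _ (inv_mem_Uhat m) i⟩
  -- The components of `g' s` in `T'` are those of `s` in `T`, so holomorphy is preserved.
  refine isHolomorphicSection_iff.2 fun ζ hζ => ?_
  have hs' := isHolomorphicSection_iff.1 hs ζ hζ
  induction ζ using OnePoint.rec with
  | infty =>
    rw [← ProjLine.inv_zero] at hs' ⊢
    rw [T.isHolomorphicSection_inv_iff hloc] at hs'
    rw [T'.isHolomorphicSection_inv_iff hloc]
    refine hs'.congr (Filter.Eventually.of_forall fun m => ?_)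
    exact (hrepr _ _ (fun i => by
      rw [basisHat_apply, basisHat_apply]; exact hUhat _ (inv_mem_Uhat m) i) _).symm
  | coe l =>
    rw [T.isHolomorphicSection_coe_iff hloc] at hs'
    rw [T'.isHolomorphicSection_coe_iff hloc]
    refine hs'.congr (Filter.Eventually.of_forall fun m => ?_)
    exact (hrepr _ _ (fun i => by rw [basis_apply, basis_apply]; exact hU m i) _).symm

end RationalCurveFamily.Trivialisation

end AdaptedTrivialisations

/-! ### Holomorphic dependence of the frame on the curve -/

section Holomorphy

variable {EZ EM EF Z M F : Type*}
  [NormedAddCommGroup EZ] [NormedSpace ℂ EZ] [TopologicalSpace Z] [ChartedSpace EZ Z]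
  [IsManifold 𝓘(ℂ, EZ) ω Z]
  [NormedAddCommGroup EM] [NormedSpace ℂ EM] [FiniteDimensional ℂ EM]
  [TopologicalSpace M] [ChartedSpace EM M] [IsManifold 𝓘(ℂ, EM) ω M]
  [NormedAddCommGroup EF] [NormedSpace ℂ EF] [FiniteDimensional ℂ EF]
  [TopologicalSpace F] [ChartedSpace EF F] [IsManifold 𝓘(ℂ, EF) ω F]
  {k : ℕ} {proj : Z → OnePoint ℂ} (C : RationalCurveFamily EZ EM EF M F proj)

namespace RationalCurveFamily

open ProjLine

/-- At a fixed `l` both the frame of `T` and the Kodaira section have holomorphic coordinates in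
`x`, and only inversions of matrices are applied to them. -/
theorem contMDiffAt_frameSection (hdim : Module.finrank ℂ EZ = k + 1)
    (hproj : ContMDiff 𝓘(ℂ, EZ) 𝓘(ℂ) ω proj) {W : Set M} (hW : IsOpen W)
    {T : ∀ x, C.Trivialisation k x} {H : M → ℂ → Matrix (Fin k) (Fin k) ℂ}
    (hT : ∀ i, C.IsHolomorphicSectionFamily (W ×ˢ U) fun x => (T x).frame i)
    (hH : ∀ i j, ContMDiffOn (𝓘(ℂ, EM).prod 𝓘(ℂ)) 𝓘(ℂ) ω
      (fun q : M × ℂ => H q.1 q.2 i j) (W ×ˢ univ))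
    (hu : ∀ x ∈ W, ∀ l, IsUnit (H x l)) {X : ∀ x : M, TangentSpace 𝓘(ℂ, EM) x} {x : M}
    (hx : x ∈ W) (hX : ContMDiffAt 𝓘(ℂ, EM) 𝓘(ℂ, EM).tangent ω
      (fun x => (⟨x, X x⟩ : TangentBundle 𝓘(ℂ, EM) M)) x) (l : ℂ) :
    ContMDiffAt 𝓘(ℂ, EM) 𝓘(ℂ, Fin k → ℂ) ω
      (fun y => (T y).frameSection (H y) (X y) l) x := by
  obtain ⟨Θ, hΘ, hs, hκ⟩ := C.exists_coord_family hdim hproj x (l : OnePoint ℂ)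
  have h1 := contMDiffAt_basis_repr (N := fun y => C.Normal y (l : OnePoint ℂ)) hΘ
    (b := fun y => (T y).basis l) (s := fun y => C.kodaira y (X y) l) (fun i => by
      simp only [Trivialisation.basis_apply]
      refine hs (fun y => (T y).frame i) fun q hq => ?_
      obtain rfl := mem_singleton_iff.1 hq
      exact hT i (x, (l : OnePoint ℂ)) (mk_mem_prod hx (coe_mem_U l))) (hκ X hX)
  have h2 : ContMDiffAt 𝓘(ℂ, EM) 𝓘(ℂ, Fin k → Fin k → ℂ) ω (fun y i j => H y l i j) x := by
    rw [contMDiffAt_pi_space]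
    intro i
    rw [contMDiffAt_pi_space]
    intro j
    have h3 := (hH i j).contMDiffAt (x := (x, l)) ((hW.prod isOpen_univ).mem_nhds (mk_mem_prod hx (mem_univ l)))
    have h4 : ContMDiffAt 𝓘(ℂ, EM) (𝓘(ℂ, EM).prod 𝓘(ℂ)) ω (fun y : M => (y, l)) x :=
      contMDiffAt_id.prodMk contMDiffAt_const
    exact h3.comp x h4
  exact (contDiffAt_inv_mulVec (p := (fun i j => H x l i j, (T x).basis l |>.repr
    (C.kodaira x (X x) l))) ((Matrix.isUnit_iff_isUnit_det _).1 (hu x hx l)).ne_zero).contMDiffAt.comp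
    x (h2.prodMk_space h1)

/-- The one-forms of a frame that is defined by a splitting depending holomorphically on the point
are holomorphic. -/
theorem isHolomorphicOneFormOn_of_givesFrame (hdim : Module.finrank ℂ EZ = k + 1)
    (hproj : ContMDiff 𝓘(ℂ, EZ) 𝓘(ℂ) ω proj) {W : Set M} (hW : IsOpen W) {n : Fin k → ℤ}
    {T : ∀ x, C.Trivialisation k x} {H : M → ℂ → Matrix (Fin k) (Fin k) ℂ}
    {e : ∀ x, Coframe EM n x}
    (hT : ∀ i, C.IsHolomorphicSectionFamily (W ×ˢ U) fun x => (T x).frame i)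
    (hH : ∀ i j, ContMDiffOn (𝓘(ℂ, EM).prod 𝓘(ℂ)) 𝓘(ℂ) ω
      (fun q : M × ℂ => H q.1 q.2 i j) (W ×ˢ univ))
    (hu : ∀ x ∈ W, ∀ l, IsUnit (H x l)) (he : ∀ x ∈ W, (T x).GivesFrame (H x) (e x))
    (i : Fin k) (j : Fin (n i + 1).toNat) :
    IsHolomorphicOneFormOn W (fun x => e x i j) := by
  intro W' hW' hW'o X hX x hx
  have hXx := hX.contMDiffAt (hW'o.mem_nhds hx)
  -- The coefficients of a polynomial with `n i + 1` coefficients are a fixed linear function of its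
  -- values at `0, 1, …, n i`, by inversion of a Vandermonde matrix with distinct nodes.
  set A : Matrix (Fin (n i + 1).toNat) (Fin (n i + 1).toNat) ℂ :=
    Matrix.vandermonde fun a => ((a : ℕ) : ℂ) with hA
  have hdet : IsUnit A.det := by
    rw [isUnit_iff_ne_zero, hA, Matrix.det_vandermonde_ne_zero_iff]
    intro a b hab
    exact Fin.ext (Nat.cast_injective hab)
  set v : M → Fin (n i + 1).toNat → ℂ := fun y a =>
    (T y).frameSection (H y) (X y) ((a : ℕ) : ℂ) i with hv
  have hvx : ContMDiffAt 𝓘(ℂ, EM) 𝓘(ℂ, Fin (n i + 1).toNat → ℂ) ω v x := by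
    rw [contMDiffAt_pi_space]
    intro a
    exact contMDiffAt_pi_space.1
      (C.contMDiffAt_frameSection hdim hproj hW hT hH hu (hW' hx) hXx _) i
  have h1 : ContMDiffAt 𝓘(ℂ, EM) 𝓘(ℂ, Fin (n i + 1).toNat → ℂ) ω
      (fun y => A⁻¹.mulVec (v y)) x :=
    (LinearMap.toContinuousLinearMap (Matrix.toLin' A⁻¹)).contDiff.contDiffAt.contMDiffAt.comp x hvx
  refine ((contMDiffAt_pi_space.1 h1 j).congr_of_eventuallyEq ?_).contMDiffWithinAt
  filter_upwards [hW.mem_nhds (hW' hx)] with y hy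
  have h2 : A.mulVec (fun j => e y i j (X y)) = v y := by
    funext a
    simp only [hv]
    rw [he y hy (X y) _ i]
    simp only [hA, Matrix.mulVec, dotProduct, Matrix.vandermonde_apply]
    exact Finset.sum_congr rfl fun b _ => mul_comm _ _
  rw [← h2, Matrix.mulVec_mulVec, Matrix.nonsing_inv_mul _ hdet, Matrix.one_mulVec]

end RationalCurveFamily

end Holomorphy
-- The theorem
theorem mainTheorem5
    {EZ EM EF Z M F : Type*}
    [NormedAddCommGroup EZ] [NormedSpace ℂ EZ] [TopologicalSpace Z] [ChartedSpace EZ Z]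
    [IsManifold 𝓘(ℂ, EZ) ω Z]
    [NormedAddCommGroup EM] [NormedSpace ℂ EM] [FiniteDimensional ℂ EM]
    [TopologicalSpace M] [ChartedSpace EM M] [IsManifold 𝓘(ℂ, EM) ω M]
    [NormedAddCommGroup EF] [NormedSpace ℂ EF] [FiniteDimensional ℂ EF]
    [TopologicalSpace F] [ChartedSpace EF F] [IsManifold 𝓘(ℂ, EF) ω F]
    (k : ℕ) (hdim : Module.finrank ℂ EZ = k + 1)
    (proj : Z → OnePoint ℂ) (hproj : ContMDiff 𝓘(ℂ, EZ) 𝓘(ℂ) ω proj)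
    (C : RationalCurveFamily EZ EM EF M F proj) (hC : C.IsComplete) :
    (∀ x : M, Nonempty (C.Trivialisation k x) ∧ ∃ n : Fin k → ℤ, Antitone n ∧
      (∀ T : C.Trivialisation k x,
        -- the patching of `N_x` has a splitting, and its type is unique
        (∃ H Hhat, T.IsSplitting n H Hhat) ∧
        (∀ (n' : Fin k → ℤ) (H Hhat : ℂ → Matrix (Fin k) (Fin k) ℂ), T.IsSplitting n' H Hhat →
          ∃ σ : Equiv.Perm (Fin k), n' = n ∘ σ) ∧
        -- `H⁻¹ dw|` is a global section, and its coefficients form a frame of one-forms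
        (∀ H Hhat, T.IsSplitting n H Hhat →
          (∀ (u : TangentSpace 𝓘(ℂ, EM) x) (l : ℂˣ) (i : Fin k),
            T.frameSectionHat Hhat u ((l : ℂ)⁻¹) i =
              (l : ℂ) ^ (-n i) * T.frameSection H u (l : ℂ) i) ∧
          ∃ e : Coframe EM n x, T.GivesFrame H e ∧
            (∀ e' : Coframe EM n x, T.GivesFrame H e' → e' = e) ∧
            LinearIndependent ℂ (fun p : Σ i, Fin (n i + 1).toNat => e p.1 p.2) ∧
            Submodule.span ℂ (range fun p : Σ i, Fin (n i + 1).toNat => e p.1 p.2) = ⊤) ∧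
        -- the redundancy consists in multiplying by an invertible element of `H⁰(N_x ⊗ N_x*)`
        (∀ H Hhat H' Hhat', T.IsSplitting n H Hhat → T.IsSplitting n H' Hhat' →
          ∃! g : ∀ ζ, Module.End ℂ (C.Normal x ζ), g ∈ C.endSections x ∧ (∀ ζ, IsUnit (g ζ)) ∧
            (∀ l, H' l = T.endMatrix g l * H l) ∧
            (∀ m, Hhat' m = T.endMatrixHat g m * Hhat m)) ∧
        (∀ H Hhat, T.IsSplitting n H Hhat →
          ∀ g ∈ C.endSections x, (∀ ζ, IsUnit (g ζ)) →
            T.IsSplitting n (fun l => T.endMatrix g l * H l)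
              (fun m => T.endMatrixHat g m * Hhat m))) ∧
      -- the family of frames does not depend on the trivialisations
      (∀ T T' : C.Trivialisation k x, T.frames n = T'.frames n)) ∧
    -- a splitting that depends holomorphically on `x` gives rise to holomorphic one-forms
    (∀ (W : Set M) (_ : IsOpen W) (n : Fin k → ℤ) (T : ∀ x, C.Trivialisation k x)
      (H Hhat : M → ℂ → Matrix (Fin k) (Fin k) ℂ) (e : ∀ x, Coframe EM n x),
      (∀ i, C.IsHolomorphicSectionFamily (W ×ˢ ProjLine.U) (fun x => (T x).frame i)) →
      (∀ i j, ContMDiffOn (𝓘(ℂ, EM).prod 𝓘(ℂ)) 𝓘(ℂ) ω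
        (fun q : M × ℂ => H q.1 q.2 i j) (W ×ˢ univ)) →
      (∀ x ∈ W, (T x).IsSplitting n (H x) (Hhat x) ∧ (T x).GivesFrame (H x) (e x)) →
      ∀ i j, IsHolomorphicOneFormOn W (fun x => e x i j)) := by
  refine ⟨fun x => ?_, fun W hW n T H Hhat e hT hH h i j => ?_⟩
  · have hloc : ∀ ζ₀, ∃ Θ, C.IsLocalTriv k x Θ ζ₀ := fun ζ₀ => C.exists_localTriv hdim hproj x ζ₀
    obtain ⟨hinj, hrange⟩ := hC x
    obtain ⟨n, T₀, hn, hT₀⟩ := RationalCurveFamily.exists_isAdapted hloc hrange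
    refine ⟨⟨T₀⟩, n, hn, fun T => ⟨⟨_, _, hT₀.isSplitting hloc⟩, ?_, ?_, ?_, ?_⟩, ?_⟩
    · intro n' H Hhat h
      obtain ⟨T', hT', -⟩ := h.exists_isAdapted hloc
      exact hT₀.exists_perm hloc hT'
    · intro H Hhat h
      -- From here on the splitting is the change of basis from `T` to an adapted `T'`, and
      -- assertions about `H` become assertions about components in `T'`.
      obtain ⟨T', hT', rfl, rfl⟩ := h.exists_isAdapted hloc
      refine ⟨fun u l i => ?_, ?_⟩
      · rw [RationalCurveFamily.Trivialisation.frameSectionHat_changeHat,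
          RationalCurveFamily.Trivialisation.frameSection_change]
        exact hT'.repr_eq l _ _ (by
          rw [ProjLine.inv_coe (inv_ne_zero l.ne_zero), inv_inv]) (C.kodaira x u) i
      · obtain ⟨e, he, hli, hspan⟩ := hT'.exists_coframe hloc hinj hrange
        have hgives : T.GivesFrame (T.change T') e := fun u l i => by
          rw [RationalCurveFamily.Trivialisation.frameSection_change]
          exact he u l i
        exact ⟨e, hgives, fun e' he' =>
          RationalCurveFamily.Trivialisation.coframe_unique hgives he', hli, hspan⟩
    · intro H Hhat H' Hhat' h h'
      obtain ⟨T₁, hT₁, rfl, rfl⟩ := h.exists_isAdapted hloc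
      obtain ⟨T₂, hT₂, rfl, rfl⟩ := h'.exists_isAdapted hloc
      obtain ⟨g, hg, hgu, hgU, hgUhat⟩ := hT₁.exists_end hloc hT₂
      have h1 : ∀ l, T.change T₂ l = T.endMatrix g l * T.change T₁ l := fun l =>
        (RationalCurveFamily.Trivialisation.endMatrix_mul_change (hgU l)).symm
      have h2 : ∀ m, T.changeHat T₂ m = T.endMatrixHat g m * T.changeHat T₁ m := fun m =>
        (RationalCurveFamily.Trivialisation.endMatrixHat_mul_changeHat (hgUhat m)).symm
      refine ⟨g, ⟨hg, hgu, h1, h2⟩, ?_⟩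
      rintro g' ⟨-, -, h1', h2'⟩
      -- Cancelling the invertible `H` determines the matrix of `g` over `U`; the remaining point
      -- `∞` is reached through `Hhat` at `m = 0`.
      have h3 : ∀ l : ℂ, g' l = g l := fun l =>
        (LinearMap.toMatrix (T.basis l) (T.basis l)).injective
          ((RationalCurveFamily.Trivialisation.isUnit_change l).mul_right_cancel
            ((h1' l).symm.trans (h1 l)))
      have h4 : g' (ProjLine.inv (0 : ℂ)) = g (ProjLine.inv (0 : ℂ)) :=
        (LinearMap.toMatrix (T.basisHat _ (ProjLine.inv_mem_Uhat 0))
          (T.basisHat _ (ProjLine.inv_mem_Uhat 0))).injective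
          ((RationalCurveFamily.Trivialisation.isUnit_changeHat 0).mul_right_cancel
            ((h2' 0).symm.trans (h2 0)))
      rw [ProjLine.inv_zero] at h4
      funext ζ
      induction ζ using OnePoint.rec with
      | infty => exact h4
      | coe l => exact h3 l
    · intro H Hhat h g hg hgu
      obtain ⟨T', hT', rfl, rfl⟩ := h.exists_isAdapted hloc
      -- An automorphism is linear on fibres, so it preserves the relation between the two frames.
      have h1 : (T'.mapEnd hg hgu).IsAdapted n := fun l hl i => by
        change g l (T'.frame i l) = l ^ (-n i) • g l (T'.frameHat i l)
        rw [hT' l hl i, map_smul]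
      have h2 := h1.isSplitting (T := T) hloc
      have h3 : T.change (T'.mapEnd hg hgu) = fun l => T.endMatrix g l * T.change T' l :=
        funext fun l =>
          (RationalCurveFamily.Trivialisation.endMatrix_mul_change fun _ => rfl).symm
      have h4 : T.changeHat (T'.mapEnd hg hgu) = fun m => T.endMatrixHat g m * T.changeHat T' m :=
        funext fun m =>
          (RationalCurveFamily.Trivialisation.endMatrixHat_mul_changeHat fun _ => rfl).symm
      rwa [h3, h4] at h2
    · have key : ∀ T T' : C.Trivialisation k x, T.frames n ⊆ T'.frames n := by
        rintro T T' e ⟨H, Hhat, h, he⟩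
        obtain ⟨S, hS, rfl, rfl⟩ := h.exists_isAdapted hloc
        -- The same adapted `S` gives a splitting of the patching of `T'`, with the same components
        -- of the Kodaira section.
        refine ⟨_, _, hS.isSplitting hloc, fun u l i => ?_⟩
        rw [← he u l i, RationalCurveFamily.Trivialisation.frameSection_change,
          RationalCurveFamily.Trivialisation.frameSection_change]
      exact fun T T' => (key T T').antisymm (key T' T)
  · exact C.isHolomorphicOneFormOn_of_givesFrame hdim hproj hW hT hH
      (fun x hx => (h x hx).1.isUnit) (fun x hx => (h x hx).2) i j
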